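/- Let $n\ge 2$, let $\Omega\subset\mathbb R^n$ be a domain (a nonempty connected open set), $0<T<\infty$, $Q=\Omega\times\,]0,T[$, and let $\partial'Q=(\partial\Omega\times\,]0,T[)\cup(\overline\Omega\times\{0\})$ be the parabolic boundary of $Q$. Consider $$\mathcal M u\equiv \partial_t u-D_i\big(a_{ij}(x;t)D_ju\big)+b_i(x;t)D_iu$$ (summation over repeated indices $i,j=1,\dots,n$; $D_i=\partial/\partial x_i$), where the $a_{ij}$ are bounded measurable functions on $Q$ such that, for some constant $\nu>0$, $$\nu|\xi|^2\le a_{ij}(x;t)\xi_i\xi_j\le\nu^{-1}|\xi|^2\qquad\text{for all }\xi\in\mathbb R^n\text{ and almost all }(x;t)\in Q,$$ and the measurable vector field $\mathbf b=(b_i)$ satisfies $\mathbf b\in L_{q,\ell}(Q)=L_\ell(]0,T[\to L_q(\Omega))$ for some $q,\ell\in\,]0,\infty]$ with $$\frac nq+\frac2\ell-1\in[0,1[ ,$$ and $\operatorname{div}\mathbf b\le0$ in $Q$ in the sense of distributions (divergence in $x$). Let $V$ be a Lipschitz supersolution of $\mathcal MV=0$ in $Q$, i.e. a Lipschitz function on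 $Q$ (extended by continuity to $\overline Q$) with $$\int_Q\big(\partial_tV\,\eta+a_{ij}D_jV\,D_i\eta+b_iD_iV\,\eta\big)\,dx\,dt\ge0$$ for every Lipschitz function $\eta\ge0$ with compact support in $Q$. If $V$ is not constant in $Q$, then $V$ does not attain its minimum over $\overline Q$ at any point of $\partial Q\setminus\overline{\partial'Q}=\Omega\times\{T\}$. -/

import Mathlib

open MeasureTheory Set
open scoped ENNReal NNReal

/-- Space-time `ℝⁿ × ℝ`; a point is `(x, t)`. -/
abbrev SpaceTime (n : ℕ) : Type := EuclideanSpace ℝ (Fin n) × ℝ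

/-- The cylinder `Q = Ω × ]0,T[`. -/
def spaceTimeCylinder {n : ℕ} (Ω : Set (EuclideanSpace ℝ (Fin n))) (T : ℝ) : Set (SpaceTime n) :=
  Ω ×ˢ Ioo 0 T

/-- The lateral surface `∂''Q = ∂Ω × ]0,T[`. -/
def lateralSurface {n : ℕ} (Ω : Set (EuclideanSpace ℝ (Fin n))) (T : ℝ) : Set (SpaceTime n) :=
  frontier Ω ×ˢ Ioo 0 T

/-- The parabolic boundary `∂'Q = ∂''Q ∪ (closure Ω × {0})`. -/
def parabolicBoundary {n : ℕ} (Ω : Set (EuclideanSpace ℝ (Fin n))) (T : ℝ) :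
    Set (SpaceTime n) :=
  lateralSurface Ω T ∪ closure Ω ×ˢ {0}

/-- The spatial derivative `D_i u` (classical; for Lipschitz `u` it exists almost everywhere). -/
noncomputable def spaceDeriv {n : ℕ} (i : Fin n) (u : SpaceTime n → ℝ) (z : SpaceTime n) : ℝ :=
  fderiv ℝ u z (EuclideanSpace.single i 1, 0)

/-- The time derivative `∂ₜ u` (classical; for Lipschitz `u` it exists almost everywhere). -/
noncomputable def timeDeriv {n : ℕ} (u : SpaceTime n → ℝ) (z : SpaceTime n) : ℝ :=
  fderiv ℝ u z (0, 1)

/-- The coefficient matrix `a` is measurable, bounded and uniformly elliptic on `Q` with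
constant `ν`. If `a` is symmetric, boundedness follows from the upper ellipticity bound. -/
structure IsUniformlyElliptic {n : ℕ} (a : SpaceTime n → Matrix (Fin n) (Fin n) ℝ) (ν : ℝ)
    (Q : Set (SpaceTime n)) : Prop where
  pos : 0 < ν
  aemeasurable : ∀ i j, AEMeasurable (fun z => a z i j) (volume.restrict Q)
  bounded : ∃ M : ℝ, ∀ᵐ z ∂(volume.restrict Q), ∀ i j, |a z i j| ≤ M
  elliptic : ∀ᵐ z ∂(volume.restrict Q), ∀ ξ : EuclideanSpace ℝ (Fin n),
    ν * ‖ξ‖ ^ 2 ≤ ∑ i, ∑ j, a z i j * ξ i * ξ j ∧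
      ∑ i, ∑ j, a z i j * ξ i * ξ j ≤ ν⁻¹ * ‖ξ‖ ^ 2

/-- The norm of `L_{q,ℓ}(Ω × ]0,T[) = L_ℓ(]0,T[ → L_q(Ω))`, with values in `[0,∞]`. -/
noncomputable def mixedNorm {n : ℕ} (b : SpaceTime n → EuclideanSpace ℝ (Fin n)) (q ℓ : ℝ≥0∞)
    (Ω : Set (EuclideanSpace ℝ (Fin n))) (T : ℝ) : ℝ≥0∞ :=
  eLpNorm (fun t : ℝ => eLpNorm (fun x => b (x, t)) q (volume.restrict Ω)) ℓ
    (volume.restrict (Ioo 0 T))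

/-- `b ∈ L_{q,ℓ}(Ω × ]0,T[)`. -/
def MemMixedLp {n : ℕ} (b : SpaceTime n → EuclideanSpace ℝ (Fin n)) (q ℓ : ℝ≥0∞)
    (Ω : Set (EuclideanSpace ℝ (Fin n))) (T : ℝ) : Prop :=
  AEStronglyMeasurable b (volume.restrict (spaceTimeCylinder Ω T)) ∧ mixedNorm b q ℓ Ω T < ⊤

/-- `div b ≤ 0` on the open set `Q` in the sense of distributions (`div` in the space variables):
`⟨div b, φ⟩ = - ∫_Q b_i D_i φ ≤ 0` for every nonnegative `φ ∈ C_c^∞(Q)`. -/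
def DivNonpos {n : ℕ} (b : SpaceTime n → EuclideanSpace ℝ (Fin n))
    (Q : Set (SpaceTime n)) : Prop :=
  ∀ φ : SpaceTime n → ℝ, ContDiff ℝ ((⊤ : ℕ∞) : WithTop ℕ∞) φ → HasCompactSupport φ → tsupport φ ⊆ Q →
    (∀ z, 0 ≤ φ z) → - ∫ z in Q, ∑ i, b z i * spaceDeriv i φ z ≤ 0

/-- `V` is a Lipschitz function on the closure of `Q` which is a generalized supersolution in `Q`
of `∂ₜ V - D_i (a_ij D_j V) + b_i D_i V = 0`, tested against nonnegative Lipschitz functions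
compactly supported in `Q`. (A Lipschitz function on `Q` has exactly one continuous extension to
the closure, and it is Lipschitz.) -/
def IsLipschitzSupersolution {n : ℕ} (a : SpaceTime n → Matrix (Fin n) (Fin n) ℝ)
    (b : SpaceTime n → EuclideanSpace ℝ (Fin n)) (Q : Set (SpaceTime n))
    (V : SpaceTime n → ℝ) : Prop :=
  (∃ K : ℝ≥0, LipschitzOnWith K V (closure Q)) ∧
    ∀ η : SpaceTime n → ℝ, (∃ L : ℝ≥0, LipschitzWith L η) → HasCompactSupport η →
      tsupport η ⊆ Q → (∀ z, 0 ≤ η z) →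
      0 ≤ ∫ z in Q, (timeDeriv V z * η z
        + ∑ i, ∑ j, a z i j * spaceDeriv j V z * spaceDeriv i η z
        + ∑ i, b z i * spaceDeriv i V z * η z)

/-! Suppose the minimum m is attained at (x₀, T) with x₀ in Ω, and put U = V - m on a cylinder over
a small ball B about x₀. It suffices to show that U vanishes on B × [0, T]. Then the set of x in Ω
with V(x, T) = m is open; it is also relatively closed, so it is all of Ω by connectedness, and V =
m throughout Q.

The drift is controlled by one cancellation (`energy_inequality`). Let f' = -h with h ≥ 0 and h' =
-c with c ≥ 0. Test the supersolution inequality with h(U)θ, test div b ≤ 0 with f(U)θ, and add. The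
terms with b·DU cancel, the time derivatives combine to f(U)∂ₜθ, and the drift survives only as f(U)
b·Dθ. So b never meets a derivative of U and acts as a weight against squares, for which n/q + 2/ℓ <
2 is a subcritical condition (`exists_parabolic_embedding`). Two choices of f are needed.

With f = log(N + 1) - log(U + ε) and ε = exp(-k), the localized Dirichlet integral of log(U + ε) is
O(k) (`log_estimate`). Divided by k, these functions converge to the indicator of {U = 0}, while
their gradients are O(k^(-1/2)) in local L². Hence the indicator has zero weak spatial gradient
(`integral_indicator_zeroSet_mul_spaceDeriv`), and almost every time slice of {U = 0} is negligible
or the whole ball (`ae_slice_zeroSet`).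

With f = (κ - U)₊²/2, the energy inequality becomes a Caccioppoli inequality. Together with the
embedding it gives a De Giorgi iteration for the integral of 1 + |b| over sublevel sets, with
constants independent of the level. If U ≠ 0 almost everywhere in a cylinder below (x₀, t₀), this
integral over {U < k} tends to 0 with k. For small k the iteration gives U ≥ k/2 below (x₀, t₀),
hence U(x₀, t₀) > 0 (`ne_zero_of_ae_ne_zero`).

The two facts combine in `IsBddSupersolution.eq_zero_of_eq_zero`: if U(x₀, t₀) = 0, then arbitrarily
close below t₀ there are times at which U vanishes on the whole ball. The argument restarts from
such times, and an infimum argument descends to all earlier ones. -/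

set_option linter.unusedSectionVars false


/-! ### Mollification of Lipschitz functions. -/

section Mollification

open ContinuousLinearMap Filter Topology
open scoped Convolution

variable {E : Type*} [NormedAddCommGroup E] [NormedSpace ℝ E] [FiniteDimensional ℝ E]
  [MeasurableSpace E] [BorelSpace E] (μ : Measure E) [μ.IsAddHaarMeasure]
  {G : Type*} [NormedAddCommGroup G] [NormedSpace ℝ G]

/-- A sequence of smooth bump functions at the origin with supports shrinking to a point. -/
noncomputable def shrinkingBump (E : Type*) [NormedAddCommGroup E] [NormedSpace ℝ E]
    [FiniteDimensional ℝ E] (k : ℕ) : ContDiffBump (0 : E) where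
  rIn := 1 / ((k : ℝ) + 1) / 2
  rOut := 1 / ((k : ℝ) + 1)
  rIn_pos := by positivity
  rIn_lt_rOut := half_lt_self (by positivity)

/-- Convolution with the normalised bump function `shrinkingBump E k`. -/
noncomputable def mollify (k : ℕ) (f : E → G) : E → G :=
  (shrinkingBump E k).normed μ ⋆[lsmul ℝ ℝ, μ] f

lemma tendsto_shrinkingBump_rOut :
    Tendsto (fun k => (shrinkingBump E k).rOut) atTop (𝓝 0) :=
  tendsto_one_div_add_atTop_nhds_zero_nat

lemma mollify_apply (k : ℕ) (f : E → G) (x : E) :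
    mollify μ k f x = ∫ t, (shrinkingBump E k).normed μ t • f (x - t) ∂μ := rfl

lemma ae_tendsto_mollify [CompleteSpace G] {f : E → G} (hf : LocallyIntegrable f μ) :
    ∀ᵐ x ∂μ, Tendsto (fun k => mollify μ k f x) atTop (𝓝 (f x)) := by
  refine ContDiffBump.ae_convolution_tendsto_right_of_locallyIntegrable (K := 2)
    tendsto_shrinkingBump_rOut (Eventually.of_forall fun k => ?_) hf
  change 1 / ((k : ℝ) + 1) ≤ 2 * (1 / ((k : ℝ) + 1) / 2)
  linarith

lemma tendsto_mollify_of_continuous [CompleteSpace G] {f : E → G} (hf : Continuous f) (x : E) :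
    Tendsto (fun k => mollify μ k f x) atTop (𝓝 (f x)) :=
  ContDiffBump.convolution_tendsto_right_of_continuous tendsto_shrinkingBump_rOut hf x

lemma contDiff_mollify {f : E → ℝ} (hf : LocallyIntegrable f μ) (k : ℕ) :
    ContDiff ℝ ((⊤ : ℕ∞) : WithTop ℕ∞) (mollify μ k f) :=
  ((shrinkingBump E k).hasCompactSupport_normed (μ := μ)).contDiff_convolution_left (lsmul ℝ ℝ)
    (shrinkingBump E k).contDiff_normed hf

lemma mollify_nonneg {f : E → ℝ} (hf : ∀ x, 0 ≤ f x) (k : ℕ) (x : E) : 0 ≤ mollify μ k f x :=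
  integral_nonneg fun t => mul_nonneg ((shrinkingBump E k).nonneg_normed t) (hf _)

lemma norm_mollify_le {f : E → G} {C : ℝ} (hf : ∀ x, ‖f x‖ ≤ C) (k : ℕ) (x : E) :
    ‖mollify μ k f x‖ ≤ C := by
  calc ‖mollify μ k f x‖
      ≤ ∫ t, (shrinkingBump E k).normed μ t * C ∂μ := by
        refine norm_integral_le_of_norm_le
          (((shrinkingBump E k).integrable_normed).mul_const C) (ae_of_all _ fun t => ?_)
        change ‖(shrinkingBump E k).normed μ t • f (x - t)‖ ≤ _
        rw [norm_smul, Real.norm_of_nonneg ((shrinkingBump E k).nonneg_normed t)]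
        exact mul_le_mul_of_nonneg_left (hf _) ((shrinkingBump E k).nonneg_normed t)
    _ = C := by rw [integral_mul_const, (shrinkingBump E k).integral_normed, one_mul]

lemma mollify_eq_zero_of_infDist {f : E → G} {k : ℕ} {x : E}
    (h : ∀ y ∈ tsupport f, 1 / ((k : ℝ) + 1) ≤ dist x y) : mollify μ k f x = 0 := by
  rw [mollify_apply]
  refine integral_eq_zero_of_ae (ae_of_all _ fun t => ?_)
  by_cases ht : x - t ∈ tsupport f
  · have h1 := h _ ht
    have : (shrinkingBump E k).normed μ t = 0 := by
      have : t ∉ Function.support ((shrinkingBump E k).normed μ) := by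
        rw [ContDiffBump.support_normed_eq]
        simp only [Metric.mem_ball, dist_zero_right, not_lt]
        rw [dist_eq_norm, sub_sub_cancel] at h1
        exact h1
      simpa using this
    simp [this]
  · simp [image_eq_zero_of_notMem_tsupport ht]

lemma tsupport_mollify_subset {f : E → G} (k : ℕ) :
    tsupport (mollify μ k f) ⊆ Metric.cthickening (1 / ((k : ℝ) + 1)) (tsupport f) := by
  refine closure_minimal (fun x hx => ?_) Metric.isClosed_cthickening
  by_contra hx'
  refine hx (mollify_eq_zero_of_infDist μ fun y hy => ?_)
  by_contra! hlt
  exact hx' (Metric.mem_cthickening_of_dist_le x y _ _ hy hlt.le)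

lemma hasCompactSupport_mollify {f : E → G} (hf : HasCompactSupport f) (k : ℕ) :
    HasCompactSupport (mollify μ k f) :=
  (hf.cthickening (r := 1 / ((k : ℝ) + 1))).of_isClosed_subset (isClosed_tsupport _)
    (tsupport_mollify_subset μ k)

/-- By Rademacher's theorem f is differentiable almost everywhere, and the Lipschitz bound dominates
the difference quotients. So the derivative passes under the integral and falls on f rather than on
the kernel. Hence the mollified gradients keep the bound K and converge at Lebesgue points. -/
lemma LipschitzWith.hasFDerivAt_mollify {f : E → ℝ} {K : ℝ≥0} (hf : LipschitzWith K f)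
    (k : ℕ) (x : E) : HasFDerivAt (mollify μ k f) (mollify μ k (fderiv ℝ f) x) x := by
  have hint : Integrable ((shrinkingBump E k).normed μ) μ := (shrinkingBump E k).integrable_normed
  have hcont : Continuous ((shrinkingBump E k).normed μ) := (shrinkingBump E k).continuous_normed
  refine (hasFDerivAt_integral_of_dominated_loc_of_lip
    (F := fun y t => (shrinkingBump E k).normed μ t • f (y - t))
    (F' := fun t => (shrinkingBump E k).normed μ t • fderiv ℝ f (x - t))
    (bound := fun t => (shrinkingBump E k).normed μ t * K) (s := univ) univ_mem
    (Eventually.of_forall fun y => ?_) ?_ ?_ (ae_of_all _ fun t => ?_) (hint.mul_const _) ?_).2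
  · exact (hcont.smul (hf.continuous.comp (by fun_prop))).aestronglyMeasurable
  · refine (hcont.smul (hf.continuous.comp (by fun_prop))).integrable_of_hasCompactSupport ?_
    exact (shrinkingBump E k).hasCompactSupport_normed.smul_right
  · exact hcont.aestronglyMeasurable.smul
      ((measurable_fderiv ℝ f).comp (measurable_const.sub measurable_id)).aestronglyMeasurable
  · refine LipschitzOnWith.of_dist_le_mul fun y _ z _ => ?_
    have h0 := (shrinkingBump E k).nonneg_normed (μ := μ) t
    have h1 := hf.dist_le_mul (y - t) (z - t)
    rw [dist_sub_right] at h1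
    simp only [smul_eq_mul, Real.dist_eq, ← mul_sub, abs_mul, Real.coe_nnabs, abs_of_nonneg h0,
      NNReal.abs_eq]
    rw [mul_assoc]
    exact mul_le_mul_of_nonneg_left (by simpa [Real.dist_eq] using h1) h0
  · have h := (Measure.measurePreserving_sub_left μ x).quasiMeasurePreserving.ae
      (hf.ae_differentiableAt (μ := μ))
    filter_upwards [h] with t ht
    have := (ht.hasFDerivAt.comp x ((hasFDerivAt_id x).sub_const t)).const_smul
      ((shrinkingBump E k).normed μ t)
    simpa [Function.comp_def, Pi.smul_def] using this

lemma LipschitzWith.norm_fderiv_mollify_le {f : E → ℝ} {K : ℝ≥0} (hf : LipschitzWith K f)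
    (k : ℕ) (x : E) : ‖fderiv ℝ (mollify μ k f) x‖ ≤ K := by
  rw [(hf.hasFDerivAt_mollify μ k x).fderiv]
  exact norm_mollify_le μ (fun y => norm_fderiv_le_of_lipschitz ℝ hf) k x

lemma LipschitzWith.ae_tendsto_fderiv_mollify {f : E → ℝ} {K : ℝ≥0} (hf : LipschitzWith K f) :
    ∀ᵐ x ∂μ, Tendsto (fun k => fderiv ℝ (mollify μ k f) x) atTop (𝓝 (fderiv ℝ f x)) := by
  have hloc : LocallyIntegrable (fderiv ℝ f) μ := by
    refine (locallyIntegrable_const (K : ℝ)).mono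
      (measurable_fderiv ℝ f).aestronglyMeasurable (ae_of_all _ fun y => ?_)
    simpa using norm_fderiv_le_of_lipschitz ℝ hf
  filter_upwards [ae_tendsto_mollify μ hloc] with x hx
  exact hx.congr fun k => ((hf.hasFDerivAt_mollify μ k x).fderiv).symm

/-- Integration by parts against the constant function 1, whose derivative is zero. It disposes of
total derivatives of compactly supported products. -/
lemma integral_fderiv_apply_eq_zero {f : E → ℝ} {K : ℝ≥0} (hf : LipschitzWith K f)
    (hfc : HasCompactSupport f) (v : E) : ∫ x, fderiv ℝ f x v ∂μ = 0 := by
  have h := LipschitzWith.integral_lineDeriv_mul_eq (μ := μ)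
    (LipschitzWith.const (α := E) (1 : ℝ)) hf hfc (-v)
  have h1 : ∀ x, lineDeriv ℝ (fun _ : E => (1 : ℝ)) x (-v) = 0 := fun x => by simp [lineDeriv]
  simp only [h1, neg_neg, zero_mul, integral_zero, mul_one] at h
  rw [h]
  refine integral_congr_ae ?_
  filter_upwards [hf.ae_differentiableAt (μ := μ)] with x hx
  exact (hx.lineDeriv_eq_fderiv (v := v)).symm

end Mollification


/-! ### Subcritical Sobolev inequalities. -/

section Sobolev

open Filter Topology

lemma exists_eLpNorm_le_eLpNorm_fderiv {n : ℕ} (x₀ : EuclideanSpace ℝ (Fin n))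
    (R : ℝ) {p r : ℝ≥0} (hp1 : 1 ≤ p) (hpn : p < n) (hpr : (p : ℝ)⁻¹ - (n : ℝ)⁻¹ ≤ (r : ℝ)⁻¹) :
    ∃ A : ℝ≥0, ∀ g : EuclideanSpace ℝ (Fin n) → ℝ, ContDiff ℝ 1 g →
      tsupport g ⊆ Metric.closedBall x₀ R →
      eLpNorm g r volume ≤ A * eLpNorm (fderiv ℝ g) p volume := by
  refine ⟨MeasureTheory.eLpNormLESNormFDerivOfLeConst ℝ
    (volume : Measure (EuclideanSpace ℝ (Fin n))) (Metric.closedBall x₀ R) p r,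
    fun g hcd hsupp => ?_⟩
  refine eLpNorm_le_eLpNorm_fderiv_of_le (F := ℝ)
      (volume : Measure (EuclideanSpace ℝ (Fin n))) hcd
      ((subset_tsupport _).trans hsupp) hp1 ?_ ?_ Metric.isBounded_closedBall
  · rwa [finrank_euclideanSpace_fin]
  · rwa [finrank_euclideanSpace_fin, NNReal.coe_inv]

lemma eLpNorm_le_eLpNorm_two_of_tsupport_subset {n : ℕ} (x₀ : EuclideanSpace ℝ (Fin n))
    (R : ℝ) {p : ℝ≥0} (hp2 : p ≤ 2) {G : Type*} [NormedAddCommGroup G]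
    {g : EuclideanSpace ℝ (Fin n) → G} (hg : AEStronglyMeasurable g volume)
    (hsupp : tsupport g ⊆ Metric.closedBall x₀ R) :
    eLpNorm g p volume ≤
      volume (Metric.closedBall x₀ R) ^ (1 / (p : ℝ) - 1 / 2) * eLpNorm g 2 volume := by
  have hres : ∀ q : ℝ≥0∞, eLpNorm g q (volume.restrict (Metric.closedBall x₀ R))
      = eLpNorm g q volume := fun q =>
    eLpNorm_restrict_eq_of_support_subset ((subset_tsupport _).trans hsupp)
  have h2 := eLpNorm_le_eLpNorm_mul_rpow_measure_univ
    (μ := volume.restrict (Metric.closedBall x₀ R))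
    (f := g) (p := p) (q := 2) (by exact_mod_cast hp2) hg.restrict
  rw [hres, hres] at h2
  refine h2.trans (le_of_eq ?_)
  rw [mul_comm]; simp

/-- A subcritical Sobolev inequality for `C¹` functions supported in a fixed ball. -/
theorem exists_sobolev_const_of_contDiff {n : ℕ} (hn : 2 ≤ n) (x₀ : EuclideanSpace ℝ (Fin n))
    (R : ℝ) {r : ℝ} (hr : 0 < r) (hrn : (1 : ℝ) / 2 - 1 / n < 1 / r) :
    ∃ C : ℝ≥0, ∀ g : EuclideanSpace ℝ (Fin n) → ℝ, ContDiff ℝ 1 g →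
      tsupport g ⊆ Metric.closedBall x₀ R →
      (∫⁻ x, ‖g x‖ₑ ^ r) ^ (1 / r) ≤ C * (∫⁻ x, ‖fderiv ℝ g x‖ₑ ^ (2 : ℝ)) ^ (1 / (2 : ℝ)) := by
  have hn' : (2 : ℝ) ≤ n := by exact_mod_cast hn
  -- The gradient exponent must be less than n, which excludes 2 when n = 2. As r is strictly
  -- subcritical, the exponent p = max(1, (1/r + 1/n)⁻¹) < 2 still controls the `r`-norm, and
  -- Hölder's inequality on the ball returns from p to 2.
  obtain ⟨p, hp1, hp2, hpr⟩ : ∃ p : ℝ, 1 ≤ p ∧ p < 2 ∧ p⁻¹ - (n : ℝ)⁻¹ ≤ r⁻¹ := by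
    simp only [one_div] at hrn
    rcases le_total (1 : ℝ) (r⁻¹ + (n : ℝ)⁻¹) with h | h
    · exact ⟨1, le_rfl, by norm_num, by linarith [inv_one (G := ℝ)]⟩
    · have hpos : 0 < r⁻¹ + (n : ℝ)⁻¹ := by positivity
      refine ⟨(r⁻¹ + (n : ℝ)⁻¹)⁻¹, (one_le_inv₀ hpos).2 h, ?_, by rw [inv_inv]; linarith⟩
      rw [inv_lt_comm₀ hpos (by norm_num)]
      linarith
  obtain ⟨p, rfl⟩ : ∃ p' : ℝ≥0, (p' : ℝ) = p := ⟨⟨p, by linarith⟩, rfl⟩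
  obtain ⟨r, rfl⟩ : ∃ r' : ℝ≥0, (r' : ℝ) = r := ⟨⟨r, hr.le⟩, rfl⟩
  have hr0 : r ≠ 0 := by rintro rfl; simp at hr
  have hvol : volume (Metric.closedBall x₀ R) ^ (1 / (p : ℝ) - 1 / 2) ≠ ⊤ := by
    refine ENNReal.rpow_ne_top_of_nonneg ?_ measure_closedBall_lt_top.ne
    have : (0 : ℝ) < p := by linarith
    rw [sub_nonneg]
    exact one_div_le_one_div_of_le this hp2.le
  have hpn : p < n := by
    have : (p : ℝ) < n := by linarith
    exact_mod_cast this
  obtain ⟨A, hA⟩ := exists_eLpNorm_le_eLpNorm_fderiv x₀ R (by exact_mod_cast hp1) hpn hpr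
  refine ⟨A * (volume (Metric.closedBall x₀ R) ^ (1 / (p : ℝ) - 1 / 2)).toNNReal,
    fun g hcd hsupp => ?_⟩
  have h1 := hA g hcd hsupp
  have h2 := eLpNorm_le_eLpNorm_two_of_tsupport_subset x₀ R (p := p) (g := fderiv ℝ g)
    (by exact_mod_cast hp2.le)
    (measurable_fderiv ℝ g).aestronglyMeasurable ((tsupport_fderiv_subset ℝ).trans hsupp)
  have h3 : eLpNorm g r volume = (∫⁻ x, ‖g x‖ₑ ^ (r : ℝ)) ^ (1 / (r : ℝ)) := by
    rw [eLpNorm_eq_lintegral_rpow_enorm_toReal (by exact_mod_cast hr0) (by simp)]; simp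
  have h4 : eLpNorm (fderiv ℝ g) 2 volume
      = (∫⁻ x, ‖fderiv ℝ g x‖ₑ ^ (2 : ℝ)) ^ (1 / (2 : ℝ)) := by
    rw [eLpNorm_eq_lintegral_rpow_enorm_toReal (by simp) (by simp)]; simp
  rw [← h3, ← h4, ENNReal.coe_mul, ENNReal.coe_toNNReal hvol, mul_assoc]
  exact h1.trans (by gcongr)

/-- A subcritical Sobolev inequality for Lipschitz functions supported in a fixed ball. -/
theorem exists_sobolev_const {n : ℕ} (hn : 2 ≤ n) (x₀ : EuclideanSpace ℝ (Fin n)) (R : ℝ)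
    {r : ℝ} (hr : 0 < r) (hrn : (1 : ℝ) / 2 - 1 / n < 1 / r) :
    ∃ C : ℝ≥0, ∀ f : EuclideanSpace ℝ (Fin n) → ℝ, (∃ K : ℝ≥0, LipschitzWith K f) →
      tsupport f ⊆ Metric.closedBall x₀ R →
      (∫⁻ x, ‖f x‖ₑ ^ r) ^ (1 / r) ≤ C * (∫⁻ x, ‖fderiv ℝ f x‖ₑ ^ (2 : ℝ)) ^ (1 / (2 : ℝ)) := by
  -- Mollification enlarges the support by at most 1, hence R + 1. In the limit the gradients
  -- converge in the mean by domination, and Fatou's lemma suffices for the left-hand side.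
  obtain ⟨C, hC⟩ := exists_sobolev_const_of_contDiff hn x₀ (R + 1) hr hrn
  refine ⟨C, fun f ⟨K, hK⟩ hsupp => ?_⟩
  have hgsupp : ∀ k, tsupport (mollify volume k f) ⊆ Metric.closedBall x₀ (R + 1) := fun k => by
    refine (tsupport_mollify_subset volume k).trans ?_
    refine (Metric.cthickening_subset_of_subset _ hsupp).trans ?_
    refine (Metric.cthickening_mono (δ₂ := 1) ?_ _).trans ?_
    · rw [div_le_one (by positivity)]; linarith [(Nat.cast_nonneg k : (0 : ℝ) ≤ k)]
    · rw [(isCompact_closedBall x₀ R).cthickening_eq_biUnion_closedBall zero_le_one]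
      refine iUnion₂_subset fun y hy => Metric.closedBall_subset_closedBall' ?_
      rw [add_comm]; gcongr; exact hy
  have hcd : ∀ k, ContDiff ℝ ((⊤ : ℕ∞) : WithTop ℕ∞) (mollify volume k f) := fun k =>
    contDiff_mollify volume hK.continuous.locallyIntegrable k
  have hsm := fun k => hC _ ((hcd k).of_le (by norm_cast)) (hgsupp k)
  have hK2 : ∫⁻ x in Metric.closedBall x₀ (R + 1), (K : ℝ≥0∞) ^ (2 : ℝ) ≠ ⊤ := by
    rw [setLIntegral_const]
    exact ENNReal.mul_ne_top (by simp) measure_closedBall_lt_top.ne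
  have hlim : Tendsto (fun k => ∫⁻ x, ‖fderiv ℝ (mollify volume k f) x‖ₑ ^ (2 : ℝ)) atTop
      (𝓝 (∫⁻ x, ‖fderiv ℝ f x‖ₑ ^ (2 : ℝ))) := by
    refine tendsto_lintegral_of_dominated_convergence
      (fun x => (Metric.closedBall x₀ (R + 1)).indicator (fun _ => (K : ℝ≥0∞) ^ (2 : ℝ)) x)
      (fun k => by fun_prop) (fun k => ae_of_all _ fun x => ?_) ?_ ?_
    · beta_reduce
      by_cases hx : x ∈ Metric.closedBall x₀ (R + 1)
      · rw [indicator_of_mem hx]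
        gcongr
        have := hK.norm_fderiv_mollify_le volume k x
        rw [← ofReal_norm, ← ENNReal.ofReal_coe_nnreal]
        exact ENNReal.ofReal_le_ofReal this
      · have : fderiv ℝ (mollify volume k f) x = 0 := by
          by_contra h
          exact hx (hgsupp k (tsupport_fderiv_subset ℝ (subset_tsupport _ h)))
        rw [← ofReal_norm, this, norm_zero, ENNReal.ofReal_zero, ENNReal.zero_rpow_of_pos two_pos]
        exact zero_le
    · rwa [lintegral_indicator measurableSet_closedBall]
    · filter_upwards [hK.ae_tendsto_fderiv_mollify volume] with x hx
      exact (ENNReal.continuous_rpow_const.tendsto _).comp hx.enorm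
  have hfat : ∫⁻ x, ‖f x‖ₑ ^ r ≤ liminf (fun k => ∫⁻ x, ‖mollify volume k f x‖ₑ ^ r) atTop := by
    refine le_trans (lintegral_mono fun x => ?_) (lintegral_liminf_le fun k => ?_)
    · have := (ENNReal.continuous_rpow_const (y := r)).tendsto _ |>.comp
        (tendsto_mollify_of_continuous volume hK.continuous x).enorm
      exact this.liminf_eq.ge
    · have : Continuous (mollify volume k f) := (hcd k).continuous
      fun_prop
  have hrhs := ENNReal.Tendsto.const_mul (a := (C : ℝ≥0∞))
    ((ENNReal.continuous_rpow_const (y := 1 / (2 : ℝ))).tendsto _ |>.comp hlim)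
    (Or.inr ENNReal.coe_ne_top)
  have hle : liminf (fun k => ∫⁻ x, ‖mollify volume k f x‖ₑ ^ r) atTop ≤
      (C * (∫⁻ x, ‖fderiv ℝ f x‖ₑ ^ (2 : ℝ)) ^ (1 / (2 : ℝ))) ^ r := by
    have h5 := (ENNReal.continuous_rpow_const (y := r)).tendsto _ |>.comp hrhs
    rw [← h5.liminf_eq]
    refine liminf_le_liminf (Eventually.of_forall fun k => ?_)
    have h6 := ENNReal.rpow_le_rpow (hsm k) hr.le
    rwa [← ENNReal.rpow_mul, one_div_mul_cancel hr.ne', ENNReal.rpow_one] at h6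
  have h7 := ENNReal.rpow_le_rpow (hfat.trans hle) (one_div_pos.2 hr).le
  rwa [← ENNReal.rpow_mul (_ * _), mul_one_div_cancel hr.ne', ENNReal.rpow_one] at h7

end Sobolev


/-! ### The weighted parabolic embedding. -/

instance isAddHaarMeasure_volume_spaceTime (n : ℕ) :
    (volume : Measure (SpaceTime n)).IsAddHaarMeasure :=
  inferInstanceAs ((volume : Measure (EuclideanSpace ℝ (Fin n))).prod
    (volume : Measure ℝ)).IsAddHaarMeasure

/-- The squared length of the spatial gradient, with values in `[0,∞]`. -/
noncomputable def gradSq {n : ℕ} (u : SpaceTime n → ℝ) (z : SpaceTime n) : ℝ≥0∞ :=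
  ∑ i, ‖spaceDeriv i u z‖ₑ ^ (2 : ℝ)

lemma measurable_spaceDeriv {n : ℕ} (i : Fin n) (u : SpaceTime n → ℝ) :
    Measurable (spaceDeriv i u) :=
  measurable_fderiv_apply_const ℝ u _

lemma measurable_gradSq {n : ℕ} (u : SpaceTime n → ℝ) : Measurable (gradSq u) :=
  Finset.measurable_sum _ fun i _ => (measurable_spaceDeriv i u).enorm.pow_const _

/-- Cauchy–Schwarz in coordinates. It converts the operator norm of the Sobolev inequality into the
sum of squared partial derivatives in `gradSq`. -/
lemma enorm_clm_sq_le {n : ℕ} (A : EuclideanSpace ℝ (Fin n) →L[ℝ] ℝ) :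
    ‖A‖ₑ ^ (2 : ℝ) ≤ ∑ i, ‖A (EuclideanSpace.single i 1)‖ₑ ^ (2 : ℝ) := by
  have h0 : 0 ≤ ∑ i, ‖A (EuclideanSpace.single i 1)‖ ^ 2 :=
    Finset.sum_nonneg fun i _ => sq_nonneg _
  have h : ‖A‖ ≤ Real.sqrt (∑ i, ‖A (EuclideanSpace.single i 1)‖ ^ 2) := by
    refine A.opNorm_le_bound (Real.sqrt_nonneg _) fun x => ?_
    have hx : A x = ∑ i, A (EuclideanSpace.single i 1) * x i := by
      conv_lhs => rw [← (EuclideanSpace.basisFun (Fin n) ℝ).sum_repr x]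
      simp [mul_comm]
    rw [hx, EuclideanSpace.norm_eq x, ← Real.sqrt_mul h0]
    refine (Real.le_sqrt (norm_nonneg _) (by positivity)).2 ?_
    simp only [Real.norm_eq_abs, sq_abs]
    exact Finset.sum_mul_sq_le_sq_mul_sq _ _ _
  have h2 : ‖A‖ ^ 2 ≤ ∑ i, ‖A (EuclideanSpace.single i 1)‖ ^ 2 := by
    rw [← Real.sq_sqrt h0]; gcongr
  simp only [ENNReal.rpow_two, ← ofReal_norm, ← ENNReal.ofReal_pow (norm_nonneg _)]
  rw [← ENNReal.ofReal_sum_of_nonneg fun i _ => sq_nonneg _]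
  exact ENNReal.ofReal_le_ofReal h2

lemma fderiv_slice_apply {n : ℕ} {u : SpaceTime n → ℝ} {x : EuclideanSpace ℝ (Fin n)} {t : ℝ}
    (h : DifferentiableAt ℝ u (x, t)) (i : Fin n) :
    fderiv ℝ (fun y => u (y, t)) x (EuclideanSpace.single i 1) = spaceDeriv i u (x, t) := by
  have h1 : HasFDerivAt (fun y : EuclideanSpace ℝ (Fin n) => (y, t))
      ((ContinuousLinearMap.id ℝ _).prod 0) x :=
    (hasFDerivAt_id x).prodMk (hasFDerivAt_const t x)
  have := HasFDerivAt.comp x h.hasFDerivAt h1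
  have h2 : fderiv ℝ (fun y => u (y, t)) x = _ := this.fderiv
  rw [h2]
  simp [spaceDeriv]

lemma enorm_fderiv_slice_sq_le {n : ℕ} {u : SpaceTime n → ℝ} {x : EuclideanSpace ℝ (Fin n)}
    {t : ℝ} (h : DifferentiableAt ℝ u (x, t)) :
    ‖fderiv ℝ (fun y => u (y, t)) x‖ₑ ^ (2 : ℝ) ≤ gradSq u (x, t) := by
  refine (enorm_clm_sq_le _).trans (le_of_eq ?_)
  simp_rw [fderiv_slice_apply h]
  rfl

lemma ae_ae_of_ae_spaceTime {n : ℕ} {P : SpaceTime n → Prop} (h : ∀ᵐ z, P z) :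
    ∀ᵐ t : ℝ, ∀ᵐ x : EuclideanSpace ℝ (Fin n), P (x, t) := by
  have h' : ∀ᵐ z : ℝ × EuclideanSpace ℝ (Fin n) ∂(volume.prod volume), P z.swap :=
    Measure.measurePreserving_swap.quasiMeasurePreserving.ae h
  exact Measure.ae_ae_of_ae_prod h'

lemma setLIntegral_spaceTime {n : ℕ} (B : Set (EuclideanSpace ℝ (Fin n))) (I : Set ℝ)
    {f : SpaceTime n → ℝ≥0∞} (hf : AEMeasurable f (volume.restrict (B ×ˢ I))) :
    ∫⁻ z in B ×ˢ I, f z = ∫⁻ t in I, ∫⁻ x in B, f (x, t) := by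
  have : (volume : Measure (SpaceTime n)).restrict (B ×ˢ I)
    = (volume.restrict B).prod (volume.restrict I) := by
    rw [Measure.prod_restrict]; rfl
  rw [this] at hf ⊢
  exact lintegral_prod_symm _ hf

lemma LipschitzWith.slice {n : ℕ} {u : SpaceTime n → ℝ} {K : ℝ≥0} (hu : LipschitzWith K u)
    (t : ℝ) : LipschitzWith K (fun x => u (x, t)) := by
  refine LipschitzWith.of_dist_le_mul fun x y => ?_
  simpa [Prod.dist_eq] using hu.dist_le_mul (x, t) (y, t)

/-- Interpolation on a time slice. -/
lemma exists_slice_interpolation {n : ℕ} (hn : 2 ≤ n) (x₀ : EuclideanSpace ℝ (Fin n)) (R : ℝ)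
    {q m : ℝ} (hq : 1 < q) (hm0 : 0 < m) (hm1 : m < 1) (hqm : n / q < 2 * m) :
    ∃ α : ℝ, 0 ≤ α ∧ 1 < α + m ∧ ∃ C : ℝ≥0,
      ∀ (w : EuclideanSpace ℝ (Fin n) → ℝ≥0∞), Measurable w →
      ∀ f : EuclideanSpace ℝ (Fin n) → ℝ, (∃ K : ℝ≥0, LipschitzWith K f) →
      tsupport f ⊆ Metric.closedBall x₀ R →
      ∫⁻ x in Metric.closedBall x₀ R, w x * ‖f x‖ₑ ^ (2 * (α + m)) ≤
        C * (∫⁻ x in Metric.closedBall x₀ R, w x ^ q) ^ (1 / q) * (∫⁻ x, ‖f x‖ₑ ^ (2 : ℝ)) ^ α *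
          (∫⁻ x, ‖fderiv ℝ f x‖ₑ ^ (2 : ℝ)) ^ m := by
  have hn' : (2 : ℝ) ≤ n := by exact_mod_cast hn
  have hn0 : (0 : ℝ) < n := by linarith
  have hq0 : 0 < q := by linarith
  -- The interval for κ is nonempty because n/q < 2m. The bound κ < 2/n makes r = 2/(1 - κ)
  -- subcritical, and mκ > 1/q makes the final power α + m exceed 1.
  obtain ⟨κ, hκ1, hκ2⟩ : ∃ κ, 1 / (q * m) < κ ∧ κ < 2 / n := by
    refine exists_between ?_
    rw [div_lt_iff₀ hq0] at hqm
    rw [div_lt_div_iff₀ (by positivity) hn0]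
    linarith
  have hκ3 : κ < 1 := hκ2.trans_le ((div_le_one hn0).2 hn')
  have hκm : 1 / q < m * κ := by
    rw [div_lt_iff₀ (by positivity)] at hκ1
    rw [div_lt_iff₀ hq0]; linarith
  set r : ℝ := 2 / (1 - κ) with hr
  have hr0 : 0 < r := div_pos two_pos (by linarith)
  have hr1 : 1 / r = (1 - κ) / 2 := by rw [hr, one_div_div]
  have hrn : (1 : ℝ) / 2 - 1 / n < 1 / r := by
    rw [hr1]; have : 2 / (n : ℝ) = 2 * (1 / n) := by ring
    linarith
  obtain ⟨C, hC⟩ := exists_sobolev_const hn x₀ R hr0 hrn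
  set γ : ℝ := m * (1 - κ) with hγ
  have hγ0 : 0 < γ := mul_pos hm0 (by linarith)
  have hrγ : r * γ = 2 * m := by
    rw [hr, hγ]; field_simp [show (1 - κ) ≠ 0 by linarith]
  refine ⟨1 - 1 / q - γ, ?_, ?_, C ^ (2 * m), fun w hw f hf hfs => ?_⟩
  · rw [hγ]; nlinarith
  · rw [hγ]; linarith
  set α : ℝ := 1 - 1 / q - γ with hα
  have hα0 : 0 ≤ α := by rw [hα, hγ]; nlinarith
  have hfm : Measurable f := hf.choose_spec.continuous.measurable
  -- Hölder with the three exponents 1/q, α, γ of sum 1. The first factor carries the weight, the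
  -- second the L² norm, and the third becomes the Dirichlet integral through Sobolev, since rγ =
  -- 2m.
  have hH := ENNReal.lintegral_prod_norm_pow_le (μ := volume.restrict (Metric.closedBall x₀ R))
    (Finset.univ : Finset (Fin 3))
    (f := ![fun x => w x ^ q, fun x => ‖f x‖ₑ ^ (2 : ℝ), fun x => ‖f x‖ₑ ^ r])
    (fun i _ => by
      fin_cases i
      · exact (hw.pow_const q).aemeasurable
      · exact (hfm.enorm.pow_const _).aemeasurable
      · exact (hfm.enorm.pow_const _).aemeasurable)
    (p := ![1 / q, α, γ]) (by simp [Fin.sum_univ_three, hα]; ring)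
    (fun i _ => by
      fin_cases i
      · exact (one_div_pos.2 hq0).le
      · exact hα0
      · exact hγ0.le)
  simp only [Fin.prod_univ_three, Matrix.cons_val_zero, Matrix.cons_val_one,
    Matrix.cons_val] at hH
  have hpt : ∀ x, (w x ^ q) ^ (1 / q) * (‖f x‖ₑ ^ (2 : ℝ)) ^ α * (‖f x‖ₑ ^ r) ^ γ
      = w x * ‖f x‖ₑ ^ (2 * (α + m)) := fun x => by
    rw [← ENNReal.rpow_mul, ← ENNReal.rpow_mul, ← ENNReal.rpow_mul, mul_one_div_cancel hq0.ne',
      ENNReal.rpow_one, mul_assoc, ← ENNReal.rpow_add_of_nonneg _ _ (by positivity) (by positivity),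
      hrγ, mul_add]
  simp_rw [hpt] at hH
  refine hH.trans ?_
  have h1 : ∫⁻ x in Metric.closedBall x₀ R, ‖f x‖ₑ ^ (2 : ℝ) ≤ ∫⁻ x, ‖f x‖ₑ ^ (2 : ℝ) :=
    setLIntegral_le_lintegral _ _
  have h2 : (∫⁻ x in Metric.closedBall x₀ R, ‖f x‖ₑ ^ r) ^ γ ≤
      (C : ℝ≥0∞) ^ (2 * m) * (∫⁻ x, ‖fderiv ℝ f x‖ₑ ^ (2 : ℝ)) ^ m := by
    calc (∫⁻ x in Metric.closedBall x₀ R, ‖f x‖ₑ ^ r) ^ γ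
        ≤ (∫⁻ x, ‖f x‖ₑ ^ r) ^ γ := by
          gcongr; exact Measure.restrict_le_self
      _ = ((∫⁻ x, ‖f x‖ₑ ^ r) ^ (1 / r)) ^ (2 * m) := by
          rw [← ENNReal.rpow_mul, ← hrγ]; congr 1; field_simp
      _ ≤ (C * (∫⁻ x, ‖fderiv ℝ f x‖ₑ ^ (2 : ℝ)) ^ (1 / (2 : ℝ))) ^ (2 * m) := by
          gcongr; exact hC f hf hfs
      _ = _ := by
          rw [ENNReal.mul_rpow_of_nonneg _ _ (by positivity), ← ENNReal.rpow_mul]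
          congr 2; ring
  rw [← ENNReal.coe_rpow_of_nonneg _ (by positivity : 0 ≤ 2 * m)] at h2
  calc _ ≤ (∫⁻ x in Metric.closedBall x₀ R, w x ^ q) ^ (1 / q) * (∫⁻ x, ‖f x‖ₑ ^ (2 : ℝ)) ^ α *
        (((C ^ (2 * m) : ℝ≥0) : ℝ≥0∞) * (∫⁻ x, ‖fderiv ℝ f x‖ₑ ^ (2 : ℝ)) ^ m) := by gcongr
    _ = _ := by ring

/-- The weighted parabolic embedding for Lipschitz functions. -/
theorem exists_parabolic_embedding {n : ℕ} (hn : 2 ≤ n) (x₀ : EuclideanSpace ℝ (Fin n)) (R T : ℝ)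
    {q l : ℝ} (hq : 1 < q) (hl : 1 < l) (hql : n / q + 2 / l < 2) {w : SpaceTime n → ℝ≥0∞}
    (hwm : Measurable w)
    (hw : ∫⁻ t in Ioo 0 T, (∫⁻ x in Metric.closedBall x₀ R, w (x, t) ^ q) ^ (l / q) < ⊤) :
    ∃ p : ℝ, 1 < p ∧ ∃ C : ℝ≥0, ∀ u : SpaceTime n → ℝ, (∃ K : ℝ≥0, LipschitzWith K u) →
      (∀ z, z.1 ∉ Metric.closedBall x₀ R → u z = 0) → ∀ s t₀, 0 ≤ s → t₀ ≤ T → ∀ E : ℝ≥0∞,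
      (∀ t ∈ Ioo s t₀, ∫⁻ x, ‖u (x, t)‖ₑ ^ (2 : ℝ) ≤ E) →
      ∫⁻ z in univ ×ˢ Ioo s t₀, gradSq u z ≤ E →
      ∫⁻ z in Metric.closedBall x₀ R ×ˢ Ioo s t₀, w z * ‖u z‖ₑ ^ (2 * p) ≤ C * E ^ p := by
  have hl0 : 0 < l := by linarith
  have hl1 : 1 / l < 1 := (div_lt_one hl0).2 hl
  have hl2 : 0 < 1 / l := by positivity
  have e2 : 2 / l = 2 * (1 / l) := by ring
  -- The exponent 1 - 1/l is what Hölder in time leaves for the gradient once the weight has taken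
  -- 1/l. The requirement n/q < 2m is then exactly n/q + 2/l < 2.
  obtain ⟨α, hα0, hα1, C, hC⟩ := exists_slice_interpolation hn x₀ R (m := 1 - 1 / l) hq
    (by linarith) (by linarith) (by linarith)
  set m := 1 - 1 / l with hm
  have hm0 : 0 < m := by linarith
  set A := ∫⁻ t in Ioo 0 T, (∫⁻ x in Metric.closedBall x₀ R, w (x, t) ^ q) ^ (l / q) with hA
  have hAl : A ^ (1 / l) ≠ ⊤ := ENNReal.rpow_ne_top_of_nonneg hl2.le hw.ne
  refine ⟨α + m, hα1, C * (A ^ (1 / l)).toNNReal, fun u ⟨K, hK⟩ hu0 s t₀ hs ht₀ E hE hG => ?_⟩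
  have hum : Measurable u := hK.continuous.measurable
  rw [setLIntegral_spaceTime _ _ (by fun_prop)]
  rw [setLIntegral_spaceTime _ _ (measurable_gradSq u).aemeasurable] at hG
  simp only [Measure.restrict_univ] at hG
  have hae := ae_ae_of_ae_spaceTime (hK.ae_differentiableAt (μ := volume))
  have hNm : Measurable fun t => ∫⁻ x in Metric.closedBall x₀ R, w (x, t) ^ q :=
    Measurable.lintegral_prod_left' (f := fun z : SpaceTime n => w z ^ q) (hwm.pow_const q)
  have hDm : Measurable fun t => ∫⁻ x, gradSq u (x, t) :=
    Measurable.lintegral_prod_left' (measurable_gradSq u)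
  have hslice : ∀ᵐ t ∂(volume.restrict (Ioo s t₀)),
      ∫⁻ x in Metric.closedBall x₀ R, w (x, t) * ‖u (x, t)‖ₑ ^ (2 * (α + m)) ≤
      (C * E ^ α) * (((∫⁻ x in Metric.closedBall x₀ R, w (x, t) ^ q) ^ (l / q)) ^ (1 / l) *
        (∫⁻ x, gradSq u (x, t)) ^ m) := by
    rw [ae_restrict_iff' measurableSet_Ioo]
    filter_upwards [hae] with t ht htm
    have hts : tsupport (fun x => u (x, t)) ⊆ Metric.closedBall x₀ R := by
      refine closure_minimal (fun x hx => ?_) Metric.isClosed_closedBall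
      by_contra h
      exact hx (hu0 (x, t) h)
    have h1 := hC (fun x => w (x, t)) (hwm.comp (by fun_prop)) _ ⟨K, hK.slice t⟩ hts
    refine h1.trans ?_
    have h2 : ∫⁻ x, ‖fderiv ℝ (fun x => u (x, t)) x‖ₑ ^ (2 : ℝ) ≤ ∫⁻ x, gradSq u (x, t) :=
      lintegral_mono_ae (ht.mono fun x hx => enorm_fderiv_slice_sq_le hx)
    have h3 : (∫⁻ x in Metric.closedBall x₀ R, w (x, t) ^ q) ^ (1 / q) =
        ((∫⁻ x in Metric.closedBall x₀ R, w (x, t) ^ q) ^ (l / q)) ^ (1 / l) := by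
      rw [← ENNReal.rpow_mul]; congr 1; field_simp
    rw [h3]
    have h4 := hE t htm
    calc _ ≤ C * ((∫⁻ x in Metric.closedBall x₀ R, w (x, t) ^ q) ^ (l / q)) ^ (1 / l) * E ^ α *
          (∫⁻ x, gradSq u (x, t)) ^ m := by gcongr
      _ = _ := by ring
  refine (lintegral_mono_ae hslice).trans ?_
  rw [lintegral_const_mul _ (by fun_prop)]
  have hH := ENNReal.lintegral_mul_norm_pow_le (μ := volume.restrict (Ioo s t₀))
    (hNm.pow_const (l / q)).aemeasurable hDm.aemeasurable hl2.le hm0.le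
    (by rw [hm]; ring)
  have hsub : ∫⁻ t in Ioo s t₀, (∫⁻ x in Metric.closedBall x₀ R, w (x, t) ^ q) ^ (l / q) ≤ A :=
    lintegral_mono_set (Ioo_subset_Ioo hs ht₀)
  calc _ ≤ C * E ^ α * (A ^ (1 / l) * E ^ m) := by
        gcongr
        exact hH.trans (by gcongr)
    _ = _ := by
        rw [ENNReal.coe_mul, ENNReal.coe_toNNReal hAl, ENNReal.rpow_add_of_nonneg _ _ hα0 hm0.le]
        ring


/-! ### Finite exponents and the weight 1 + |b|. -/

/-- A finite exponent is kept. An infinite one is replaced by a y so large that c / y spends only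
half of the slack δ. -/
lemma ENNReal.exists_real_exponent {c δ : ℝ} (hc : 0 < c) (hδ : 0 < δ) {x : ℝ≥0∞}
    (h : ENNReal.ofReal c / x ≠ ⊤) :
    ∃ y : ℝ, 0 < y ∧ (x = ENNReal.ofReal y ∨ x = ⊤) ∧
      c / y < (ENNReal.ofReal c / x).toReal + δ := by
  have hx0 : x ≠ 0 := by
    rintro rfl
    exact h (ENNReal.div_zero (by simpa using hc))
  by_cases hx : x = ⊤
  · refine ⟨2 * c / δ, by positivity, Or.inr hx, ?_⟩
    have h0 : 0 ≤ (ENNReal.ofReal c / x).toReal := ENNReal.toReal_nonneg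
    have : c / (2 * c / δ) = δ / 2 := by field_simp
    linarith
  · refine ⟨x.toReal, ENNReal.toReal_pos hx0 hx, Or.inl (ENNReal.ofReal_toReal hx).symm, ?_⟩
    rw [ENNReal.toReal_div, ENNReal.toReal_ofReal hc.le]
    linarith

/-- Real exponents, below the given ones, that still satisfy the subcriticality condition. -/
lemma exists_real_exponents {n : ℕ} (hn : 2 ≤ n) {q ℓ : ℝ≥0∞}
    (hqℓ : (n : ℝ≥0∞) / q + 2 / ℓ < 2) :
    ∃ q' l' : ℝ, 1 < q' ∧ 1 < l' ∧ n / q' + 2 / l' < 2 ∧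
      (q = ENNReal.ofReal q' ∨ q = ⊤) ∧ (ℓ = ENNReal.ofReal l' ∨ ℓ = ⊤) := by
  have hn' : (2 : ℝ) ≤ n := by exact_mod_cast hn
  have e1 : (n : ℝ≥0∞) = ENNReal.ofReal n := by simp
  have e2 : (2 : ℝ≥0∞) = ENNReal.ofReal 2 := by simp
  have h1 : ENNReal.ofReal n / q ≠ ⊤ := by
    rw [← e1]; exact (lt_top_iff_ne_top.1 (lt_of_le_of_lt le_self_add (hqℓ.trans (by simp))))
  have h2 : ENNReal.ofReal 2 / ℓ ≠ ⊤ := by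
    rw [← e2]; exact (lt_top_iff_ne_top.1 (lt_of_le_of_lt le_add_self (hqℓ.trans (by simp))))
  set A := (ENNReal.ofReal n / q).toReal with hA
  set B := (ENNReal.ofReal 2 / ℓ).toReal with hB
  have hAB : A + B < 2 := by
    rw [hA, hB, ← ENNReal.toReal_add h1 h2]
    have : ENNReal.ofReal n / q + ENNReal.ofReal 2 / ℓ < 2 := by rwa [← e1, ← e2]
    simpa using (ENNReal.toReal_lt_toReal (ENNReal.add_ne_top.2 ⟨h1, h2⟩) (by simp)).2 this
  obtain ⟨q', hq0, hq1, hq2⟩ := ENNReal.exists_real_exponent (c := n) (δ := (2 - A - B) / 2)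
    (by linarith) (by linarith) h1
  obtain ⟨l', hl0, hl1, hl2⟩ := ENNReal.exists_real_exponent (c := 2) (δ := (2 - A - B) / 2)
    (by linarith) (by linarith) h2
  have hsum : n / q' + 2 / l' < 2 := by linarith
  have p1 : 0 < n / q' := by positivity
  have p2 : 0 < 2 / l' := by positivity
  refine ⟨q', l', ?_, ?_, hsum, hq1, hl1⟩
  · have : n / q' < 2 := by linarith
    rw [div_lt_iff₀ hq0] at this; linarith
  · have : 2 / l' < 2 := by linarith
    rw [div_lt_iff₀ hl0] at this; linarith

lemma setLIntegral_rpow_lt_top_of_eLpNorm {f : ℝ → ℝ≥0∞} {T l : ℝ} {ℓ : ℝ≥0∞} (hl : 0 < l)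
    (hℓ : ℓ = ENNReal.ofReal l ∨ ℓ = ⊤) (hf : eLpNorm f ℓ (volume.restrict (Ioo 0 T)) < ⊤) :
    ∫⁻ t in Ioo 0 T, f t ^ l < ⊤ := by
  rcases hℓ with rfl | rfl
  · have h0 : ENNReal.ofReal l ≠ 0 := by simpa using hl
    have := lintegral_rpow_enorm_lt_top_of_eLpNorm_lt_top h0 ENNReal.ofReal_ne_top hf
    simpa [ENNReal.toReal_ofReal hl.le] using this
  · rw [eLpNorm_exponent_top] at hf
    calc ∫⁻ t in Ioo 0 T, f t ^ l
        ≤ ∫⁻ t in Ioo 0 T, (eLpNormEssSup f (volume.restrict (Ioo 0 T))) ^ l := by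
          refine lintegral_mono_ae ?_
          filter_upwards [enorm_ae_le_eLpNormEssSup f (volume.restrict (Ioo 0 T))] with t ht
          gcongr
          simpa using ht
      _ < ⊤ := by
          rw [setLIntegral_const]
          exact ENNReal.mul_lt_top (ENNReal.rpow_lt_top_of_nonneg hl.le hf.ne) (by simp)

/-- On a ball inside `Ω`, the weight `1 + |b|` lies in a mixed Lebesgue space with finite
subcritical exponents. -/
theorem exists_drift_weight {n : ℕ} (hn : 2 ≤ n) {Ω : Set (EuclideanSpace ℝ (Fin n))}
    (hΩ : MeasurableSet Ω) {T : ℝ}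
    {b : SpaceTime n → EuclideanSpace ℝ (Fin n)} {q ℓ : ℝ≥0∞}
    (hqℓ : (n : ℝ≥0∞) / q + 2 / ℓ < 2) (hb : MemMixedLp b q ℓ Ω T)
    {x₀ : EuclideanSpace ℝ (Fin n)} {R : ℝ} (hB : Metric.closedBall x₀ R ⊆ Ω) :
    ∃ q' l' : ℝ, 1 < q' ∧ 1 < l' ∧ n / q' + 2 / l' < 2 ∧ ∃ w : SpaceTime n → ℝ≥0∞,
      Measurable w ∧
      (∀ᵐ z ∂(volume.restrict (Metric.closedBall x₀ R ×ˢ Ioo 0 T)), w z = 1 + ‖b z‖ₑ) ∧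
      ∫⁻ t in Ioo 0 T, (∫⁻ x in Metric.closedBall x₀ R, w (x, t) ^ q') ^ (l' / q') < ⊤ := by
  obtain ⟨q', l', hq1, hl1, hsum, hq, hl⟩ := exists_real_exponents hn hqℓ
  have hq0 : 0 < q' := by linarith
  have hl0 : 0 < l' := by linarith
  obtain ⟨hbm, hbn⟩ := hb
  set b' := hbm.mk b with hb'
  have hb'm : Measurable b' := hbm.stronglyMeasurable_mk.measurable
  have hbb' : ∀ᵐ z ∂(volume.restrict (spaceTimeCylinder Ω T)), b z = b' z := hbm.ae_eq_mk
  refine ⟨q', l', hq1, hl1, hsum, fun z => 1 + ‖b' z‖ₑ, by fun_prop, ?_, ?_⟩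
  · have := ae_restrict_of_ae_restrict_of_subset
      (prod_mono hB subset_rfl : Metric.closedBall x₀ R ×ˢ Ioo 0 T ⊆ spaceTimeCylinder Ω T) hbb'
    filter_upwards [this] with z hz
    rw [hz]
  rw [spaceTimeCylinder, ae_restrict_iff' (hΩ.prod measurableSet_Ioo)] at hbb'
  have hslice := ae_ae_of_ae_spaceTime hbb'
  set V := volume (Metric.closedBall x₀ R) with hV
  have hVt : V ≠ ⊤ := measure_closedBall_lt_top.ne
  -- For q infinite, `q.toReal` is 0 and 1 / 0 = 0, so the exponent is 1/q', the correct Hölder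
  -- power of the volume. For q finite, q = q' and the exponent is 0.
  set c : ℝ≥0∞ := V ^ (1 / q' - 1 / q.toReal) with hc
  have hct : c ≠ ⊤ := by
    refine ENNReal.rpow_ne_top_of_nonneg ?_ hVt
    rcases hq with rfl | rfl
    · rw [ENNReal.toReal_ofReal hq0.le, sub_self]
    · simpa using hq0.le
  have hd : V ^ (1 / q') ≠ ⊤ := ENNReal.rpow_ne_top_of_nonneg (by positivity) hVt
  have hq'q : ENNReal.ofReal q' ≤ q := by rcases hq with rfl | rfl <;> simp
  have hq'0 : ENNReal.ofReal q' ≠ 0 := by simpa using hq0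
  have hpt : ∀ᵐ t ∂(volume.restrict (Ioo 0 T)),
      (∫⁻ x in Metric.closedBall x₀ R, (1 + ‖b' (x, t)‖ₑ) ^ q') ^ (l' / q') ≤
        2 ^ (l' - 1) * ((V ^ (1 / q')) ^ l' +
          c ^ l' * eLpNorm (fun x => b (x, t)) q (volume.restrict Ω) ^ l') := by
    rw [ae_restrict_iff' measurableSet_Ioo]
    filter_upwards [hslice] with t ht htm
    have hbt : Measurable fun x => b' (x, t) := hb'm.comp (by fun_prop)
    have h1 : eLpNorm (fun x => b' (x, t)) q (volume.restrict Ω)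
        = eLpNorm (fun x => b (x, t)) q (volume.restrict Ω) := by
      refine eLpNorm_congr_ae ?_
      rw [Filter.EventuallyEq, ae_restrict_iff' hΩ]
      filter_upwards [ht] with x hx hxm
      exact (hx ⟨hxm, htm⟩).symm
    have h2 : eLpNorm (fun x => b' (x, t)) (ENNReal.ofReal q')
        (volume.restrict (Metric.closedBall x₀ R)) ≤
        c * eLpNorm (fun x => b (x, t)) q (volume.restrict Ω) := by
      rw [← h1]
      refine (eLpNorm_le_eLpNorm_mul_rpow_measure_univ hq'q hbt.aestronglyMeasurable).trans ?_
      rw [mul_comm, Measure.restrict_apply_univ, ENNReal.toReal_ofReal hq0.le]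
      gcongr
    have h3 : (∫⁻ x in Metric.closedBall x₀ R, (1 + ‖b' (x, t)‖ₑ) ^ q') ^ (1 / q') ≤
        V ^ (1 / q') + c * eLpNorm (fun x => b (x, t)) q (volume.restrict Ω) := by
      have := ENNReal.lintegral_Lp_add_le (μ := volume.restrict (Metric.closedBall x₀ R))
        (p := q') (f := fun _ => 1) (g := fun x => ‖b' (x, t)‖ₑ) aemeasurable_const
        hbt.enorm.aemeasurable hq1.le
      refine this.trans ?_
      gcongr
      · simp [hV]
      · rw [eLpNorm_eq_lintegral_rpow_enorm_toReal hq'0 ENNReal.ofReal_ne_top,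
          ENNReal.toReal_ofReal hq0.le] at h2
        exact h2
    calc (∫⁻ x in Metric.closedBall x₀ R, (1 + ‖b' (x, t)‖ₑ) ^ q') ^ (l' / q')
        = ((∫⁻ x in Metric.closedBall x₀ R, (1 + ‖b' (x, t)‖ₑ) ^ q') ^ (1 / q')) ^ l' := by
          rw [← ENNReal.rpow_mul]; congr 1; field_simp
      _ ≤ (V ^ (1 / q') + c * eLpNorm (fun x => b (x, t)) q (volume.restrict Ω)) ^ l' := by
          gcongr
      _ ≤ _ := by
          refine (ENNReal.rpow_add_le_mul_rpow_add_rpow _ _ hl1.le).trans ?_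
          rw [ENNReal.mul_rpow_of_nonneg _ _ hl0.le]
  refine (lintegral_mono_ae hpt).trans_lt ?_
  rw [lintegral_const_mul' _ _ (ENNReal.rpow_ne_top_of_nonneg (by linarith) (by simp)),
    lintegral_add_left (by fun_prop),
    lintegral_const_mul' _ _ (ENNReal.rpow_ne_top_of_nonneg hl0.le hct)]
  refine ENNReal.mul_lt_top (ENNReal.rpow_lt_top_of_nonneg (by linarith) (by simp))
    (ENNReal.add_lt_top.2 ⟨?_, ENNReal.mul_lt_top (ENNReal.rpow_lt_top_of_nonneg hl0.le hct) ?_⟩)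
  · rw [setLIntegral_const]
    exact ENNReal.mul_lt_top (ENNReal.rpow_lt_top_of_nonneg hl0.le hd) (by simp)
  · exact setLIntegral_rpow_lt_top_of_eLpNorm hl0 hl hbn

lemma setLIntegral_rpow_le {α : Type*} [MeasurableSpace α] {μ : Measure α} [IsFiniteMeasure μ]
    {p : ℝ} (hp : 1 < p) {f : α → ℝ≥0∞} (hf : AEMeasurable f μ) :
    ∫⁻ x, f x ∂μ ≤ (∫⁻ x, f x ^ p ∂μ) ^ (1 / p) * μ univ ^ (1 - 1 / p) := by
  have hp0 : 0 < p := by linarith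
  have hp1 : 1 / p ≤ 1 := (div_le_one hp0).2 hp.le
  have := ENNReal.lintegral_mul_norm_pow_le (μ := μ) (hf.pow_const p)
    (aemeasurable_const (b := (1 : ℝ≥0∞))) (p := 1 / p) (q := 1 - 1 / p) (by positivity)
    (by linarith) (by ring)
  simpa [← ENNReal.rpow_mul, hp0.ne'] using this

/-- Hölder's inequality in space and then in time. It is what makes b integrable on the local
cylinder, where |b| ≤ w almost everywhere. -/
lemma setLIntegral_weight_lt_top {n : ℕ} {x₀ : EuclideanSpace ℝ (Fin n)} {R T : ℝ}
    {q l : ℝ} (hq : 1 < q) (hl : 1 < l) {w : SpaceTime n → ℝ≥0∞}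
    (hwm : Measurable w)
    (hw : ∫⁻ t in Ioo 0 T, (∫⁻ x in Metric.closedBall x₀ R, w (x, t) ^ q) ^ (l / q) < ⊤) :
    ∫⁻ z in Metric.closedBall x₀ R ×ˢ Ioo 0 T, w z < ⊤ := by
  have hq0 : 0 < q := by linarith
  have hl0 : 0 < l := by linarith
  have hq1 : 1 / q ≤ 1 := (div_le_one hq0).2 hq.le
  have hl1 : 1 / l ≤ 1 := (div_le_one hl0).2 hl.le
  have hV : volume (Metric.closedBall x₀ R) ≠ ⊤ := measure_closedBall_lt_top.ne
  have : IsFiniteMeasure (volume.restrict (Metric.closedBall x₀ R)) := ⟨by simpa using hV.lt_top⟩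
  have hNm : Measurable fun t => ∫⁻ x in Metric.closedBall x₀ R, w (x, t) ^ q :=
    Measurable.lintegral_prod_left' (f := fun z : SpaceTime n => w z ^ q) (hwm.pow_const q)
  rw [setLIntegral_spaceTime _ _ hwm.aemeasurable]
  have h1 : ∀ t, ∫⁻ x in Metric.closedBall x₀ R, w (x, t) ≤
      (∫⁻ x in Metric.closedBall x₀ R, w (x, t) ^ q) ^ (1 / q) *
        volume (Metric.closedBall x₀ R) ^ (1 - 1 / q) := fun t => by
    have := setLIntegral_rpow_le (μ := volume.restrict (Metric.closedBall x₀ R)) hq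
      (f := fun x => w (x, t)) (hwm.comp (by fun_prop)).aemeasurable
    rwa [Measure.restrict_apply_univ] at this
  have hc : volume (Metric.closedBall x₀ R) ^ (1 - 1 / q) ≠ ⊤ :=
    ENNReal.rpow_ne_top_of_nonneg (by linarith) hV
  refine (lintegral_mono h1).trans_lt ?_
  rw [lintegral_mul_const' _ _ hc]
  refine ENNReal.mul_lt_top ?_ hc.lt_top
  refine (setLIntegral_rpow_le hl (hNm.pow_const _).aemeasurable).trans_lt ?_
  refine ENNReal.mul_lt_top (ENNReal.rpow_lt_top_of_nonneg (by positivity) ?_)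
    (ENNReal.rpow_lt_top_of_nonneg (by linarith) (by simp))
  simp_rw [← ENNReal.rpow_mul]
  rw [one_div_mul_eq_div]
  exact hw.ne


/-! ### Bounded Lipschitz functions and rules for space and time derivatives. -/

/-- Bounded Lipschitz real functions. -/
def IsBddLipschitz {α : Type*} [PseudoMetricSpace α] (f : α → ℝ) : Prop :=
  (∃ K : ℝ≥0, LipschitzWith K f) ∧ ∃ C : ℝ, ∀ x, |f x| ≤ C

namespace IsBddLipschitz

variable {α β : Type*} [PseudoMetricSpace α] [PseudoMetricSpace β] {f g : α → ℝ}

lemma continuous (hf : IsBddLipschitz f) : Continuous f := hf.1.choose_spec.continuous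

lemma mul (hf : IsBddLipschitz f) (hg : IsBddLipschitz g) :
    IsBddLipschitz (fun x => f x * g x) := by
  obtain ⟨⟨K, hK⟩, A, hA⟩ := hf
  obtain ⟨⟨L, hL⟩, B, hB⟩ := hg
  refine ⟨⟨Real.toNNReal (A * L + B * K), LipschitzWith.of_dist_le_mul fun x y => ?_⟩,
    A * B, fun x => ?_⟩
  · have h1 := hK.dist_le_mul x y
    have h2 := hL.dist_le_mul x y
    rw [Real.dist_eq] at h1 h2 ⊢
    have hA0 : 0 ≤ A := (abs_nonneg _).trans (hA x)
    have hB0 : 0 ≤ B := (abs_nonneg _).trans (hB x)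
    rw [Real.coe_toNNReal _ (by positivity)]
    calc |f x * g x - f y * g y| = |f x * (g x - g y) + g y * (f x - f y)| := by ring_nf
      _ ≤ |f x| * |g x - g y| + |g y| * |f x - f y| := by
          refine (abs_add_le _ _).trans ?_; rw [abs_mul, abs_mul]
      _ ≤ A * (L * dist x y) + B * (K * dist x y) :=
          add_le_add (mul_le_mul (hA x) h2 (abs_nonneg _) hA0)
            (mul_le_mul (hB y) h1 (abs_nonneg _) hB0)
      _ = _ := by ring
  · rw [abs_mul]
    exact mul_le_mul (hA x) (hB x) (abs_nonneg _) ((abs_nonneg _).trans (hA x))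

lemma comp (hf : IsBddLipschitz f) {h : β → α} {K : ℝ≥0} (hh : LipschitzWith K h) :
    IsBddLipschitz (fun x => f (h x)) := by
  obtain ⟨⟨L, hL⟩, B, hB⟩ := hf
  exact ⟨⟨L * K, hL.comp hh⟩, B, fun x => hB _⟩

lemma of_hasCompactSupport {K : ℝ≥0} (hf : LipschitzWith K f) (hc : HasCompactSupport f) :
    IsBddLipschitz f := by
  obtain ⟨C, hC⟩ := hc.exists_bound_of_continuous hf.continuous
  exact ⟨⟨K, hf⟩, C, hC⟩

end IsBddLipschitz

section Derivatives

variable {n : ℕ} {u v : SpaceTime n → ℝ} {z : SpaceTime n}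

lemma abs_spaceDeriv_le {K : ℝ≥0} (hu : LipschitzWith K u) (i : Fin n) (z : SpaceTime n) :
    |spaceDeriv i u z| ≤ K := by
  have h1 := (fderiv ℝ u z).le_opNorm ((EuclideanSpace.single i 1, 0) : SpaceTime n)
  have h2 : ‖((EuclideanSpace.single i 1, 0) : SpaceTime n)‖ = 1 := by simp [Prod.norm_def]
  rw [h2, mul_one] at h1
  exact h1.trans (norm_fderiv_le_of_lipschitz ℝ hu)

lemma abs_timeDeriv_le {K : ℝ≥0} (hu : LipschitzWith K u) (z : SpaceTime n) :
    |timeDeriv u z| ≤ K := by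
  have h1 := (fderiv ℝ u z).le_opNorm ((0, 1) : SpaceTime n)
  have h2 : ‖((0, 1) : SpaceTime n)‖ = 1 := by simp [Prod.norm_def]
  rw [h2, mul_one] at h1
  exact h1.trans (norm_fderiv_le_of_lipschitz ℝ hu)

lemma measurable_timeDeriv (u : SpaceTime n → ℝ) : Measurable (timeDeriv u) :=
  measurable_fderiv_apply_const ℝ u _

lemma spaceDeriv_mul (hu : DifferentiableAt ℝ u z) (hv : DifferentiableAt ℝ v z) (i : Fin n) :
    spaceDeriv i (fun y => u y * v y) z = u z * spaceDeriv i v z + v z * spaceDeriv i u z := by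
  simp [spaceDeriv, fderiv_fun_mul hu hv]

lemma timeDeriv_mul (hu : DifferentiableAt ℝ u z) (hv : DifferentiableAt ℝ v z) :
    timeDeriv (fun y => u y * v y) z = u z * timeDeriv v z + v z * timeDeriv u z := by
  simp [timeDeriv, fderiv_fun_mul hu hv]

lemma timeDeriv_comp_fst {φ : EuclideanSpace ℝ (Fin n) → ℝ}
    (h : DifferentiableAt ℝ (fun y : SpaceTime n => φ y.1) z) :
    timeDeriv (fun y : SpaceTime n => φ y.1) z = 0 := by
  rw [timeDeriv, ← h.lineDeriv_eq_fderiv]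
  simp [lineDeriv]

lemma spaceDeriv_comp_snd {ψ : ℝ → ℝ}
    (h : DifferentiableAt ℝ (fun y : SpaceTime n => ψ y.2) z) (i : Fin n) :
    spaceDeriv i (fun y : SpaceTime n => ψ y.2) z = 0 := by
  rw [spaceDeriv, ← h.lineDeriv_eq_fderiv]
  simp [lineDeriv]

lemma timeDeriv_comp_snd {ψ : ℝ → ℝ}
    (h : DifferentiableAt ℝ (fun y : SpaceTime n => ψ y.2) z) :
    timeDeriv (fun y : SpaceTime n => ψ y.2) z = deriv ψ z.2 := by
  have h1 : HasFDerivAt (fun t : ℝ => ((z.1, t) : SpaceTime n))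
      ((0 : ℝ →L[ℝ] EuclideanSpace ℝ (Fin n)).prod (ContinuousLinearMap.id ℝ ℝ)) z.2 :=
    (hasFDerivAt_const z.1 z.2).prodMk (hasFDerivAt_id z.2)
  have h2 := HasFDerivAt.comp z.2 (f := fun t : ℝ => ((z.1, t) : SpaceTime n))
    (g := fun y : SpaceTime n => ψ y.2) h.hasFDerivAt h1
  have h3 := h2.hasDerivAt.deriv
  simp only [Function.comp_def] at h3
  rw [h3]
  simp [timeDeriv]

end Derivatives

/-! ### Testing the divergence condition with Lipschitz functions. -/

section Divergence

open Filter Topology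

variable {n : ℕ}

lemma abs_apply_le_norm (x : EuclideanSpace ℝ (Fin n)) (i : Fin n) : |x i| ≤ ‖x‖ :=
  PiLp.norm_apply_le x i

lemma abs_sum_mul_le (x : EuclideanSpace ℝ (Fin n)) {d : Fin n → ℝ} {L : ℝ}
    (hd : ∀ i, |d i| ≤ L) : |∑ i, x i * d i| ≤ n * L * ‖x‖ := by
  calc |∑ i, x i * d i| ≤ ∑ i, |x i * d i| := Finset.abs_sum_le_sum_abs _ _
    _ ≤ ∑ _i : Fin n, ‖x‖ * L := by
        refine Finset.sum_le_sum fun i _ => ?_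
        rw [abs_mul]
        exact mul_le_mul (abs_apply_le_norm x i) (hd i) (abs_nonneg _) (norm_nonneg _)
    _ = n * L * ‖x‖ := by simp; ring

lemma aestronglyMeasurable_sum_mul {S : Set (SpaceTime n)}
    {b : SpaceTime n → EuclideanSpace ℝ (Fin n)} (hb : IntegrableOn b S)
    {d : Fin n → SpaceTime n → ℝ} (hd : ∀ i, Measurable (d i)) :
    AEStronglyMeasurable (fun z => ∑ i, b z i * d i z) (volume.restrict S) := by
  have hbi : ∀ i, AEStronglyMeasurable (fun z => b z i) (volume.restrict S) := fun i =>
    (EuclideanSpace.proj i : EuclideanSpace ℝ (Fin n) →L[ℝ] ℝ).continuous.comp_aestronglyMeasurable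
      hb.aestronglyMeasurable
  exact Finset.aestronglyMeasurable_fun_sum _ fun i _ => (hbi i).mul (hd i).aestronglyMeasurable

lemma integrableOn_sum_mul {S : Set (SpaceTime n)}
    {b : SpaceTime n → EuclideanSpace ℝ (Fin n)} (hb : IntegrableOn b S)
    {d : Fin n → SpaceTime n → ℝ} (hd : ∀ i, Measurable (d i)) {L : ℝ}
    (hL : ∀ i z, |d i z| ≤ L) : IntegrableOn (fun z => ∑ i, b z i * d i z) S :=
  (hb.norm.const_mul (n * L)).mono' (aestronglyMeasurable_sum_mul hb hd)
    (ae_of_all _ fun z => abs_sum_mul_le (b z) fun i => hL i z)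

lemma setIntegral_eq_of_eq_zero_off {S S' : Set (SpaceTime n)} (hS : MeasurableSet S)
    (hsub : S' ⊆ S) {F : SpaceTime n → ℝ} (hF : ∀ z ∉ S', F z = 0) :
    ∫ z in S, F z = ∫ z in S', F z :=
  setIntegral_eq_of_subset_of_forall_sdiff_eq_zero hS hsub fun z hz => hF z hz.2

lemma spaceDeriv_eq_zero_of_notMem {u : SpaceTime n → ℝ} {S : Set (SpaceTime n)}
    (hS : tsupport u ⊆ S) {z : SpaceTime n} (hz : z ∉ S) (i : Fin n) : spaceDeriv i u z = 0 := by
  have : fderiv ℝ u z = 0 := by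
    by_contra h
    exact hz (hS (tsupport_fderiv_subset ℝ (subset_tsupport _ h)))
  simp [spaceDeriv, this]

/-- The distributional inequality `div b ≤ 0` may be tested with Lipschitz functions. -/
theorem DivNonpos.integral_nonneg {b : SpaceTime n → EuclideanSpace ℝ (Fin n)}
    {Q Q' : Set (SpaceTime n)} (hdiv : DivNonpos b Q) (hQ : MeasurableSet Q) (hQ' : IsOpen Q')
    (hsub : Q' ⊆ Q) (hb : IntegrableOn b Q') {φ : SpaceTime n → ℝ} {K : ℝ≥0}
    (hφ : LipschitzWith K φ) (hc : HasCompactSupport φ) (hs : tsupport φ ⊆ Q')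
    (h0 : ∀ z, 0 ≤ φ z) : 0 ≤ ∫ z in Q', ∑ i, b z i * spaceDeriv i φ z := by
  -- Mollifications of small radius stay supported in Q', where b is integrable, so dominated
  -- convergence needs no integrability of b on all of Q.
  obtain ⟨δ, hδ, hδs⟩ := IsCompact.exists_cthickening_subset_open hc hQ' hs
  have hev : ∀ᶠ k : ℕ in atTop, tsupport (mollify volume k φ) ⊆ Q' := by
    filter_upwards [tendsto_one_div_add_atTop_nhds_zero_nat.eventually (gt_mem_nhds hδ)] with k hk
    exact (tsupport_mollify_subset volume k).trans ((Metric.cthickening_mono hk.le _).trans hδs)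
  have hlim : Tendsto (fun k => ∫ z in Q', ∑ i, b z i * spaceDeriv i (mollify volume k φ) z) atTop
      (𝓝 (∫ z in Q', ∑ i, b z i * spaceDeriv i φ z)) := by
    refine tendsto_integral_of_dominated_convergence (fun z => n * K * ‖b z‖)
      (fun k => aestronglyMeasurable_sum_mul hb fun i => measurable_spaceDeriv i _)
      (hb.norm.const_mul _) (fun k => ae_of_all _ fun z => ?_) ?_
    · refine abs_sum_mul_le (b z) fun i => ?_
      have h1 := (fderiv ℝ (mollify volume k φ) z).le_opNorm
        ((EuclideanSpace.single i 1, 0) : SpaceTime n)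
      have h2 : ‖((EuclideanSpace.single i 1, 0) : SpaceTime n)‖ = 1 := by simp [Prod.norm_def]
      rw [h2, mul_one] at h1
      exact h1.trans (hφ.norm_fderiv_mollify_le volume k z)
    · filter_upwards [ae_restrict_of_ae (hφ.ae_tendsto_fderiv_mollify volume)] with z hz
      refine tendsto_finsetSum _ fun i _ => Tendsto.const_mul _ ?_
      exact ((ContinuousLinearMap.apply ℝ ℝ
        ((EuclideanSpace.single i 1, 0) : SpaceTime n)).continuous.tendsto _).comp hz
  refine ge_of_tendsto hlim ?_
  filter_upwards [hev] with k hk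
  have h1 := hdiv (mollify volume k φ) (contDiff_mollify volume hφ.continuous.locallyIntegrable k)
    (hasCompactSupport_mollify volume hc k) (hk.trans hsub) (mollify_nonneg volume h0 k)
  rw [setIntegral_eq_of_eq_zero_off hQ hsub fun z hz => Finset.sum_eq_zero fun i _ => by
    rw [spaceDeriv_eq_zero_of_notMem hk hz i, mul_zero]] at h1
  linarith

end Divergence


/-! ### Local supersolutions and the energy inequality. -/

/-- A bounded nonnegative Lipschitz function on space-time which is a supersolution in the
cylinder `Q`, together with the properties of the coefficients in `Q`. -/
structure IsBddSupersolution {n : ℕ} (a : SpaceTime n → Matrix (Fin n) (Fin n) ℝ)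
    (b : SpaceTime n → EuclideanSpace ℝ (Fin n)) (ν M : ℝ) (Q : Set (SpaceTime n))
    (U : SpaceTime n → ℝ) : Prop where
  ν_pos : 0 < ν
  isOpen : IsOpen Q
  measure_ne_top : volume Q ≠ ⊤
  aemeasurable : ∀ i j, AEMeasurable (fun z => a z i j) (volume.restrict Q)
  bounded : ∀ᵐ z ∂(volume.restrict Q), ∀ i j, |a z i j| ≤ M
  coercive : ∀ᵐ z ∂(volume.restrict Q), ∀ ξ : Fin n → ℝ,
    ν * ∑ i, ξ i ^ 2 ≤ ∑ i, ∑ j, a z i j * ξ i * ξ j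
  integrableOn : IntegrableOn b Q
  div_nonneg : ∀ φ : SpaceTime n → ℝ, (∃ K : ℝ≥0, LipschitzWith K φ) → HasCompactSupport φ →
    tsupport φ ⊆ Q → (∀ z, 0 ≤ φ z) → 0 ≤ ∫ z in Q, ∑ i, b z i * spaceDeriv i φ z
  isBddLipschitz : IsBddLipschitz U
  nonneg : ∀ z, 0 ≤ U z
  supersolution : ∀ η : SpaceTime n → ℝ, (∃ L : ℝ≥0, LipschitzWith L η) → HasCompactSupport η →
    tsupport η ⊆ Q → (∀ z, 0 ≤ η z) →
    0 ≤ ∫ z in Q, (timeDeriv U z * η z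
      + ∑ i, ∑ j, a z i j * spaceDeriv j U z * spaceDeriv i η z
      + ∑ i, b z i * spaceDeriv i U z * η z)

lemma abs_bilin_le {n : ℕ} {A : Matrix (Fin n) (Fin n) ℝ} {M L : ℝ} (hA : ∀ i j, |A i j| ≤ M)
    {d e : Fin n → ℝ} (he : ∀ i, |e i| ≤ L) :
    |∑ i, ∑ j, A i j * d j * e i| ≤ n * M * L * ∑ j, |d j| := by
  calc |∑ i, ∑ j, A i j * d j * e i| ≤ ∑ i, ∑ j, |A i j * d j * e i| :=
        (Finset.abs_sum_le_sum_abs _ _).trans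
          (Finset.sum_le_sum fun i _ => Finset.abs_sum_le_sum_abs _ _)
    _ ≤ ∑ _i : Fin n, ∑ j, M * |d j| * L := by
        refine Finset.sum_le_sum fun i _ => Finset.sum_le_sum fun j _ => ?_
        rw [abs_mul, abs_mul]
        have hM : 0 ≤ M := (abs_nonneg _).trans (hA i j)
        exact mul_le_mul (mul_le_mul_of_nonneg_right (hA i j) (abs_nonneg _)) (he i)
          (abs_nonneg _) (by positivity)
    _ = _ := by
        rw [Finset.sum_const, Finset.card_univ, Fintype.card_fin, nsmul_eq_mul,
          ← Finset.sum_mul, ← Finset.mul_sum]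
        ring

/-- The absorption of the mixed second order term. -/
lemma absorb_mixed_term {n : ℕ} {ν M L H c P φ S G : ℝ} (hn : (0 : ℝ) < n) (hν : 0 < ν)
    (hc : 0 ≤ c) (hP : 0 ≤ P) (hHP : φ ≠ 0 → H ^ 2 ≤ c * P) (hS : S ^ 2 ≤ n * G) :
    H * (n * M * (2 * φ * L) * S) ≤
      ν / 2 * (c * G * φ ^ 2) + 2 * n ^ 3 * M ^ 2 * L ^ 2 / ν * P := by
  rcases eq_or_ne φ 0 with rfl | hφ
  · have : 0 ≤ 2 * (n : ℝ) ^ 3 * M ^ 2 * L ^ 2 / ν * P := by positivity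
    simpa using this
  have h1 := hHP hφ
  set k := 2 * (n : ℝ) ^ 3 * M ^ 2 * L ^ 2 / ν with hk
  have hG : 0 ≤ G := by nlinarith [sq_nonneg S]
  have hX : 0 ≤ ν / 2 * (c * G * φ ^ 2) + k * P := by positivity
  -- The arithmetic–geometric mean inequality in the form x² ≤ 4AB ≤ (A + B)², where A and B are the
  -- two terms on the right.
  refine abs_le_of_sq_le_sq' ?_ hX |>.2
  have h2 : (H * (n * M * (2 * φ * L) * S)) ^ 2 ≤ 4 * (ν / 2 * (c * G * φ ^ 2)) * (k * P) := by
    have e1 : (H * (n * M * (2 * φ * L) * S)) ^ 2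
        = H ^ 2 * S ^ 2 * (4 * n ^ 2 * M ^ 2 * L ^ 2 * φ ^ 2) := by ring
    have e2 : 4 * (ν / 2 * (c * G * φ ^ 2)) * (k * P)
        = (c * P) * (n * G) * (4 * n ^ 2 * M ^ 2 * L ^ 2 * φ ^ 2) := by
      rw [hk]; field_simp
    rw [e1, e2]
    exact mul_le_mul_of_nonneg_right
      (mul_le_mul h1 hS (sq_nonneg _) (by positivity)) (by positivity)
  nlinarith [sq_nonneg (ν / 2 * (c * G * φ ^ 2) - k * P)]

namespace IsBddSupersolution

variable {n : ℕ} {a : SpaceTime n → Matrix (Fin n) (Fin n) ℝ}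
  {b : SpaceTime n → EuclideanSpace ℝ (Fin n)} {ν M : ℝ} {Q : Set (SpaceTime n)}
  {U : SpaceTime n → ℝ}

lemma integrableOn_of_bdd (h : IsBddSupersolution a b ν M Q U) {f : SpaceTime n → ℝ} {C : ℝ}
    (hf : AEStronglyMeasurable f (volume.restrict Q))
    (hC : ∀ᵐ z ∂(volume.restrict Q), |f z| ≤ C) : IntegrableOn f Q := by
  have : IsFiniteMeasure (volume.restrict Q) := ⟨by simpa using h.measure_ne_top.lt_top⟩
  exact Integrable.of_bound hf C hC

/-- The energy inequality: `W = f(U)` and `H = h(U)` with `f' = -h`, `h' = -c`. -/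
theorem energy_inequality (h : IsBddSupersolution a b ν M Q U) (hn : 0 < n)
    {W H c P : SpaceTime n → ℝ} (hW : IsBddLipschitz W) (hH : IsBddLipschitz H)
    (hW0 : ∀ z, 0 ≤ W z) (hH0 : ∀ z, 0 ≤ H z)
    (hcm : Measurable c) (hc0 : ∀ z, 0 ≤ c z) {Cc : ℝ} (hcb : ∀ z, c z ≤ Cc)
    (hPm : Measurable P) (hP0 : ∀ z, 0 ≤ P z) {CP : ℝ} (hPb : ∀ z, P z ≤ CP)
    (hdW : ∀ᵐ z, fderiv ℝ W z = -(H z) • fderiv ℝ U z)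
    (hdH : ∀ᵐ z, fderiv ℝ H z = -(c z) • fderiv ℝ U z)
    {φ : EuclideanSpace ℝ (Fin n) → ℝ} {ψ : ℝ → ℝ} {L K : ℝ≥0}
    (hφ : LipschitzWith L φ) (hφc : HasCompactSupport φ) (hφ0 : ∀ x, 0 ≤ φ x)
    (hψ : LipschitzWith K ψ) (hψc : HasCompactSupport ψ) (hψ0 : ∀ t, 0 ≤ ψ t)
    (hsupp : tsupport φ ×ˢ tsupport ψ ⊆ Q)
    (hHP : ∀ z, φ z.1 ≠ 0 → H z ^ 2 ≤ c z * P z) :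
    IntegrableOn (fun z => 2 * n ^ 3 * M ^ 2 * L ^ 2 / ν * P z * ψ z.2
        + W z * φ z.1 ^ 2 * deriv ψ z.2
        + 2 * n * L * (W z * ‖b z‖ * φ z.1 * ψ z.2)) Q ∧
    ν / 2 * ∫ z in Q, c z * (∑ i, spaceDeriv i U z ^ 2) * φ z.1 ^ 2 * ψ z.2 ≤
      ∫ z in Q, (2 * n ^ 3 * M ^ 2 * L ^ 2 / ν * P z * ψ z.2
        + W z * φ z.1 ^ 2 * deriv ψ z.2
        + 2 * n * L * (W z * ‖b z‖ * φ z.1 * ψ z.2)) := by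
  obtain ⟨⟨KU, hKU⟩, CU, hCU⟩ := h.isBddLipschitz
  have hφB : IsBddLipschitz (fun z : SpaceTime n => φ z.1) :=
    (IsBddLipschitz.of_hasCompactSupport hφ hφc).comp LipschitzWith.prod_fst
  have hψB : IsBddLipschitz (fun z : SpaceTime n => ψ z.2) :=
    (IsBddLipschitz.of_hasCompactSupport hψ hψc).comp LipschitzWith.prod_snd
  -- Squaring φ leaves one factor φ in Dθ. The mixed term can then be absorbed into the Dirichlet
  -- term, which carries φ².
  set θ : SpaceTime n → ℝ := fun z => φ z.1 * φ z.1 * ψ z.2 with hθ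
  have hθB : IsBddLipschitz θ := (hφB.mul hφB).mul hψB
  have hθ0 : ∀ z, 0 ≤ θ z := fun z => mul_nonneg (mul_self_nonneg _) (hψ0 _)
  have hcomp : IsCompact (tsupport φ ×ˢ tsupport ψ) := hφc.prod hψc
  have hθs : tsupport θ ⊆ tsupport φ ×ˢ tsupport ψ := by
    refine closure_minimal (fun z hz => ?_) hcomp.isClosed
    simp only [hθ, Function.mem_support, ne_eq, mul_eq_zero, not_or] at hz
    exact ⟨subset_tsupport _ hz.1.1, subset_tsupport _ hz.2⟩
  have hprod : ∀ f : SpaceTime n → ℝ, tsupport (fun z => f z * θ z) ⊆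
      tsupport φ ×ˢ tsupport ψ := fun f => (tsupport_mul_subset_right (f := f)).trans hθs
  have hprodc : ∀ f : SpaceTime n → ℝ, HasCompactSupport (fun z => f z * θ z) := fun f =>
    hcomp.of_isClosed_subset (isClosed_tsupport _) (hprod f)
  obtain ⟨KH, hKH⟩ := (hH.mul hθB).1
  obtain ⟨KW, hKW⟩ := (hW.mul hθB).1
  -- the three integral facts
  have hS := h.supersolution (fun z => H z * θ z) ⟨KH, hKH⟩ (hprodc H) ((hprod H).trans hsupp)
    (fun z => mul_nonneg (hH0 z) (hθ0 z))
  have hD := h.div_nonneg (fun z => W z * θ z) ⟨KW, hKW⟩ (hprodc W) ((hprod W).trans hsupp)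
    (fun z => mul_nonneg (hW0 z) (hθ0 z))
  have hT : ∫ z in Q, timeDeriv (fun y => W y * θ y) z = 0 := by
    rw [← integral_fderiv_apply_eq_zero volume hKW (hprodc W) ((0, 1) : SpaceTime n)]
    refine setIntegral_eq_integral_of_forall_compl_eq_zero fun z hz => ?_
    have : fderiv ℝ (fun y => W y * θ y) z = 0 := by
      by_contra hne
      exact hz (hsupp (hprod W (tsupport_fderiv_subset ℝ (subset_tsupport _ hne))))
    simp [timeDeriv, this]
  -- integrability
  have ham : ∀ i j, AEStronglyMeasurable (fun z => a z i j) (volume.restrict Q) := fun i j =>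
    (h.aemeasurable i j).aestronglyMeasurable
  have hiT : IntegrableOn (fun z => timeDeriv (fun y => W y * θ y) z) Q :=
    h.integrableOn_of_bdd (measurable_timeDeriv _).aestronglyMeasurable
      (ae_of_all _ fun z => abs_timeDeriv_le hKW z)
  have hiD : IntegrableOn (fun z => ∑ i, b z i * spaceDeriv i (fun y => W y * θ y) z) Q :=
    integrableOn_sum_mul h.integrableOn (fun i => measurable_spaceDeriv i _)
      fun i z => abs_spaceDeriv_le hKW i z
  obtain ⟨CHθ, hCHθ⟩ := (hH.mul hθB).2
  have hi1 : IntegrableOn (fun z => timeDeriv U z * (H z * θ z)) Q := by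
    refine h.integrableOn_of_bdd (C := KU * CHθ) ?_ (ae_of_all _ fun z => ?_)
    · exact ((measurable_timeDeriv U).mul (hH.mul hθB).continuous.measurable).aestronglyMeasurable
    · rw [abs_mul]
      exact mul_le_mul (abs_timeDeriv_le hKU z) (hCHθ z) (abs_nonneg _) (by positivity)
  have hi2 : IntegrableOn (fun z => ∑ i, ∑ j, a z i j * spaceDeriv j U z *
      spaceDeriv i (fun y => H y * θ y) z) Q := by
    refine h.integrableOn_of_bdd (C := n * M * KH * ∑ _j : Fin n, (KU : ℝ)) ?_ ?_
    · refine Finset.aestronglyMeasurable_fun_sum _ fun i _ =>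
        Finset.aestronglyMeasurable_fun_sum _ fun j _ => ?_
      exact ((ham i j).mul (measurable_spaceDeriv j U).aestronglyMeasurable).mul
        (measurable_spaceDeriv i _).aestronglyMeasurable
    · filter_upwards [h.bounded] with z hz
      refine (abs_bilin_le hz fun i => abs_spaceDeriv_le hKH i z).trans ?_
      have hM : 0 ≤ M := (abs_nonneg _).trans (hz ⟨0, hn⟩ ⟨0, hn⟩)
      refine mul_le_mul_of_nonneg_left ?_ (by positivity)
      exact Finset.sum_le_sum fun j _ => abs_spaceDeriv_le hKU j z
  have hi3 : IntegrableOn (fun z => ∑ i, b z i * spaceDeriv i U z * (H z * θ z)) Q := by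
    have := integrableOn_sum_mul (L := KU * CHθ) h.integrableOn
      (d := fun i z => spaceDeriv i U z * (H z * θ z))
      (fun i => (measurable_spaceDeriv i U).mul (hH.mul hθB).continuous.measurable) fun i z => by
        rw [abs_mul]
        exact mul_le_mul (abs_spaceDeriv_le hKU i z) (hCHθ z) (abs_nonneg _) (by positivity)
    simpa only [mul_assoc] using this
  have hiS : IntegrableOn (fun z => timeDeriv U z * (H z * θ z)
      + ∑ i, ∑ j, a z i j * spaceDeriv j U z * spaceDeriv i (fun y => H y * θ y) z
      + ∑ i, b z i * spaceDeriv i U z * (H z * θ z)) Q := (hi1.add hi2).add hi3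
  have hiTD : IntegrableOn (fun z => timeDeriv (fun y => W y * θ y) z
        + ∑ i, b z i * spaceDeriv i (fun y => W y * θ y) z) Q := hiT.add hiD
  have hsum0 : 0 ≤ ∫ z in Q, ((timeDeriv U z * (H z * θ z)
      + ∑ i, ∑ j, a z i j * spaceDeriv j U z * spaceDeriv i (fun y => H y * θ y) z
      + ∑ i, b z i * spaceDeriv i U z * (H z * θ z))
      + (timeDeriv (fun y => W y * θ y) z
        + ∑ i, b z i * spaceDeriv i (fun y => W y * θ y) z)) := by
    rw [integral_add hiS hiTD, integral_add hiT hiD, hT]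
    linarith
  -- integrability of the final terms
  obtain ⟨Cψ, hCψ⟩ := hψB.2
  obtain ⟨CW, hCW⟩ := hW.2
  obtain ⟨Cθ, hCθ⟩ := hθB.2
  have hGm : Measurable fun z => ∑ i, spaceDeriv i U z ^ 2 :=
    Finset.measurable_sum _ fun i _ => (measurable_spaceDeriv i U).pow_const 2
  have hGb : ∀ z, ∑ i, spaceDeriv i U z ^ 2 ≤ n * (KU : ℝ) ^ 2 := fun z => by
    calc ∑ i, spaceDeriv i U z ^ 2 ≤ ∑ _i : Fin n, (KU : ℝ) ^ 2 := by
          refine Finset.sum_le_sum fun i _ => ?_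
          exact sq_le_sq' (abs_le.1 (abs_spaceDeriv_le hKU i z)).1
            (abs_le.1 (abs_spaceDeriv_le hKU i z)).2
      _ = _ := by simp
  have hG0 : ∀ z, 0 ≤ ∑ i, spaceDeriv i U z ^ 2 := fun z =>
    Finset.sum_nonneg fun i _ => sq_nonneg _
  have hj0 : IntegrableOn (fun z => c z * (∑ i, spaceDeriv i U z ^ 2) * φ z.1 ^ 2 * ψ z.2) Q := by
    refine h.integrableOn_of_bdd (C := Cc * (n * KU ^ 2) * Cθ) ?_ (ae_of_all _ fun z => ?_)
    · exact (((hcm.mul hGm).mul (hφB.continuous.measurable.pow_const 2)).mul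
        hψB.continuous.measurable).aestronglyMeasurable
    · have : c z * (∑ i, spaceDeriv i U z ^ 2) * φ z.1 ^ 2 * ψ z.2 =
          c z * (∑ i, spaceDeriv i U z ^ 2) * θ z := by simp only [hθ]; ring
      rw [this, abs_mul, abs_of_nonneg (mul_nonneg (hc0 z) (hG0 z))]
      exact mul_le_mul (mul_le_mul (hcb z) (hGb z) (hG0 z) ((hc0 z).trans (hcb z))) (hCθ z)
        (abs_nonneg _) (mul_nonneg ((hc0 z).trans (hcb z)) (by positivity))
  have hj1 : IntegrableOn (fun z => 2 * n ^ 3 * M ^ 2 * L ^ 2 / ν * P z * ψ z.2) Q := by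
    have : IntegrableOn (fun z : SpaceTime n => P z * ψ z.2) Q := by
      refine h.integrableOn_of_bdd (C := CP * Cψ) ?_ (ae_of_all _ fun z => ?_)
      · exact (hPm.mul hψB.continuous.measurable).aestronglyMeasurable
      · rw [abs_mul, abs_of_nonneg (hP0 z)]
        exact mul_le_mul (hPb z) (hCψ z) (abs_nonneg _) ((hP0 z).trans (hPb z))
    exact (this.const_mul (2 * n ^ 3 * M ^ 2 * L ^ 2 / ν)).congr
      (ae_of_all _ fun z => (mul_assoc _ _ _).symm)
  have hj2 : IntegrableOn (fun z => W z * φ z.1 ^ 2 * deriv ψ z.2) Q := by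
    obtain ⟨C, hC⟩ := (hW.mul (hφB.mul hφB)).2
    refine h.integrableOn_of_bdd (C := C * K) ?_ (ae_of_all _ fun z => ?_)
    · exact ((hW.continuous.measurable.mul (hφB.continuous.measurable.pow_const 2)).mul
        ((measurable_deriv ψ).comp measurable_snd)).aestronglyMeasurable
    · rw [abs_mul, sq]
      exact mul_le_mul (hC z) (norm_deriv_le_of_lipschitz hψ) (abs_nonneg _)
        ((abs_nonneg _).trans (hC z))
  have hj3 : IntegrableOn (fun z => 2 * n * L * (W z * ‖b z‖ * φ z.1 * ψ z.2)) Q := by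
    obtain ⟨C, hC⟩ := (hW.mul (hφB.mul hψB)).2
    refine Integrable.const_mul ?_ _
    refine (h.integrableOn.norm.const_mul C).mono' ?_ (ae_of_all _ fun z => ?_)
    · exact (((hW.continuous.aestronglyMeasurable).mul
        h.integrableOn.aestronglyMeasurable.norm).mul hφB.continuous.aestronglyMeasurable).mul
        hψB.continuous.aestronglyMeasurable
    · have : W z * ‖b z‖ * φ z.1 * ψ z.2 = (W z * (φ z.1 * ψ z.2)) * ‖b z‖ := by ring
      rw [this, Real.norm_eq_abs, abs_mul, abs_norm]
      exact mul_le_mul_of_nonneg_right (hC z) (norm_nonneg _)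
  -- the pointwise inequality
  have hpt : ∀ᵐ z ∂(volume.restrict Q), ((timeDeriv U z * (H z * θ z)
      + ∑ i, ∑ j, a z i j * spaceDeriv j U z * spaceDeriv i (fun y => H y * θ y) z
      + ∑ i, b z i * spaceDeriv i U z * (H z * θ z))
      + (timeDeriv (fun y => W y * θ y) z
        + ∑ i, b z i * spaceDeriv i (fun y => W y * θ y) z)) ≤
      (2 * n ^ 3 * M ^ 2 * L ^ 2 / ν * P z * ψ z.2
        + W z * φ z.1 ^ 2 * deriv ψ z.2
        + 2 * n * L * (W z * ‖b z‖ * φ z.1 * ψ z.2))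
      - ν / 2 * (c z * (∑ i, spaceDeriv i U z ^ 2) * φ z.1 ^ 2 * ψ z.2) := by
    obtain ⟨KH', hKH'⟩ := hH.1
    obtain ⟨KW', hKW'⟩ := hW.1
    have hφL : LipschitzWith L (fun z : SpaceTime n => φ z.1) :=
      (hφ.comp LipschitzWith.prod_fst).weaken (by simp)
    have hψL : LipschitzWith K (fun z : SpaceTime n => ψ z.2) :=
      (hψ.comp LipschitzWith.prod_snd).weaken (by simp)
    filter_upwards [h.bounded, h.coercive, ae_restrict_of_ae hdW, ae_restrict_of_ae hdH,
      ae_restrict_of_ae (hKH'.ae_differentiableAt (μ := volume)),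
      ae_restrict_of_ae (hKW'.ae_differentiableAt (μ := volume)),
      ae_restrict_of_ae (hφL.ae_differentiableAt (μ := volume)),
      ae_restrict_of_ae (hψL.ae_differentiableAt (μ := volume))]
      with z hM hco hdWz hdHz hHz hWz hφz hψz
    have hφφ : DifferentiableAt ℝ (fun y : SpaceTime n => φ y.1 * φ y.1) z := hφz.mul hφz
    have hθz : DifferentiableAt ℝ θ z := hφφ.mul hψz
    have sθ : ∀ i, spaceDeriv i θ z
        = 2 * φ z.1 * ψ z.2 * spaceDeriv i (fun y : SpaceTime n => φ y.1) z := fun i => by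
      rw [hθ, spaceDeriv_mul hφφ hψz, spaceDeriv_mul hφz hφz, spaceDeriv_comp_snd hψz]
      ring
    have tθ : timeDeriv θ z = φ z.1 ^ 2 * deriv ψ z.2 := by
      rw [hθ, timeDeriv_mul hφφ hψz, timeDeriv_mul hφz hφz, timeDeriv_comp_fst hφz,
        timeDeriv_comp_snd hψz]
      ring
    have sH : ∀ i, spaceDeriv i H z = -(c z) * spaceDeriv i U z := fun i => by
      simp [spaceDeriv, hdHz]
    have sW : ∀ i, spaceDeriv i W z = -(H z) * spaceDeriv i U z := fun i => by
      simp [spaceDeriv, hdWz]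
    have tW : timeDeriv W z = -(H z) * timeDeriv U z := by simp [timeDeriv, hdWz]
    -- Since ∂ₜW = -H ∂ₜU, the time derivatives of U cancel and W ∂ₜθ remains.
    rw [timeDeriv_mul hWz hθz, tθ, tW]
    simp only [spaceDeriv_mul hWz hθz, spaceDeriv_mul hHz hθz, sH, sW]
    have e1 : ∑ i, ∑ j, a z i j * spaceDeriv j U z *
          (H z * spaceDeriv i θ z + θ z * (-(c z) * spaceDeriv i U z))
        = H z * ∑ i, ∑ j, a z i j * spaceDeriv j U z * spaceDeriv i θ z
          - c z * θ z * ∑ i, ∑ j, a z i j * spaceDeriv i U z * spaceDeriv j U z := by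
      simp only [Finset.mul_sum, ← Finset.sum_sub_distrib]
      exact Finset.sum_congr rfl fun i _ => Finset.sum_congr rfl fun j _ => by ring
    -- The same cancellation for the drift: b is left multiplied by a derivative of the cutoff only.
    have e2 : ∑ i, b z i * spaceDeriv i U z * (H z * θ z)
          + ∑ i, b z i * (W z * spaceDeriv i θ z + θ z * (-(H z) * spaceDeriv i U z))
        = W z * ∑ i, b z i * spaceDeriv i θ z := by
      rw [Finset.mul_sum, ← Finset.sum_add_distrib]
      exact Finset.sum_congr rfl fun i _ => by ring
    have hθb : ∀ i, |spaceDeriv i θ z| ≤ 2 * φ z.1 * L * ψ z.2 := fun i => by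
      rw [sθ, abs_mul, abs_of_nonneg (mul_nonneg (mul_nonneg two_pos.le (hφ0 _)) (hψ0 _))]
      calc _ ≤ 2 * φ z.1 * ψ z.2 * L := mul_le_mul_of_nonneg_left (abs_spaceDeriv_le hφL i z)
            (mul_nonneg (mul_nonneg two_pos.le (hφ0 _)) (hψ0 _))
        _ = _ := by ring
    have hco' := mul_le_mul_of_nonneg_left (hco fun i => spaceDeriv i U z)
      (mul_nonneg (hc0 z) (hθ0 z))
    -- Half of the coercive term is spent on the mixed term, which is why ν / 2 appears in the
    -- conclusion.
    have hmix : H z * ∑ i, ∑ j, a z i j * spaceDeriv j U z * spaceDeriv i θ z ≤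
        (ν / 2 * (c z * (∑ i, spaceDeriv i U z ^ 2) * φ z.1 ^ 2)
          + 2 * n ^ 3 * M ^ 2 * L ^ 2 / ν * P z) * ψ z.2 := by
      have h1 := (le_abs_self _).trans
        (abs_bilin_le (d := fun j => spaceDeriv j U z) hM hθb)
      have h2 := absorb_mixed_term (n := n) (M := M) (L := L) (S := ∑ j, |spaceDeriv j U z|)
        (G := ∑ i, spaceDeriv i U z ^ 2)
        (by exact_mod_cast hn) h.ν_pos (hc0 z) (hP0 z) (hHP z) (by
          have := sq_sum_le_card_mul_sum_sq (s := Finset.univ) (f := fun j => |spaceDeriv j U z|)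
          simpa using this)
      calc _ ≤ H z * (n * M * (2 * φ z.1 * L * ψ z.2) * ∑ j, |spaceDeriv j U z|) :=
            mul_le_mul_of_nonneg_left h1 (hH0 z)
        _ = H z * (n * M * (2 * φ z.1 * L) * ∑ j, |spaceDeriv j U z|) * ψ z.2 := by ring
        _ ≤ _ := mul_le_mul_of_nonneg_right h2 (hψ0 _)
    have hdr : W z * ∑ i, b z i * spaceDeriv i θ z ≤
        2 * n * L * (W z * ‖b z‖ * φ z.1 * ψ z.2) := by
      have h1 := (le_abs_self _).trans (abs_sum_mul_le (b z) hθb)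
      calc _ ≤ W z * (n * (2 * φ z.1 * L * ψ z.2) * ‖b z‖) :=
            mul_le_mul_of_nonneg_left h1 (hW0 z)
        _ = _ := by ring
    rw [e1]
    have e3 : c z * θ z * (ν * ∑ i, spaceDeriv i U z ^ 2)
        = ν * (c z * (∑ i, spaceDeriv i U z ^ 2) * φ z.1 ^ 2 * ψ z.2) := by
      simp only [hθ]; ring
    rw [e3] at hco'
    linarith
  have hj : IntegrableOn (fun z => 2 * n ^ 3 * M ^ 2 * L ^ 2 / ν * P z * ψ z.2
        + W z * φ z.1 ^ 2 * deriv ψ z.2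
        + 2 * n * L * (W z * ‖b z‖ * φ z.1 * ψ z.2)) Q := (hj1.add hj2).add hj3
  have hfin := hsum0.trans (integral_mono_ae (hiS.add hiTD) (hj.sub (hj0.const_mul (ν / 2))) hpt)
  rw [integral_sub' hj (hj0.const_mul (ν / 2)), integral_const_mul] at hfin
  exact ⟨hj, by linarith⟩

end IsBddSupersolution


/-! ### Spatial cutoffs and the functions (U + ε)⁻¹ and log(U + ε). -/

section Cutoff

variable {X : Type*} [PseudoMetricSpace X]

/-- The Lipschitz cutoff equal to `1` on the closed ball of radius `r` and to `0` outside the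
closed ball of radius `r + δ`. -/
noncomputable def radialCutoff (x₀ : X) (r δ : ℝ) (x : X) : ℝ :=
  max 0 (min 1 (1 + δ⁻¹ * (r - dist x x₀)))

lemma radialCutoff_nonneg (x₀ : X) (r δ : ℝ) (x : X) : 0 ≤ radialCutoff x₀ r δ x :=
  le_max_left _ _

lemma radialCutoff_le_one (x₀ : X) (r δ : ℝ) (x : X) : radialCutoff x₀ r δ x ≤ 1 :=
  max_le zero_le_one (min_le_left _ _)

lemma radialCutoff_eq_one {x₀ : X} {r δ : ℝ} (hδ : 0 < δ) {x : X}
    (hx : x ∈ Metric.closedBall x₀ r) : radialCutoff x₀ r δ x = 1 := by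
  have h : 0 ≤ δ⁻¹ * (r - dist x x₀) := mul_nonneg (by positivity) (sub_nonneg.2 hx)
  rw [radialCutoff, min_eq_left (by linarith), max_eq_right zero_le_one]

lemma radialCutoff_eq_zero {x₀ : X} {r δ : ℝ} (hδ : 0 < δ) {x : X}
    (hx : x ∉ Metric.closedBall x₀ (r + δ)) : radialCutoff x₀ r δ x = 0 := by
  have h : r + δ < dist x x₀ := by simpa using hx
  have h2 : 1 + δ⁻¹ * (r - dist x x₀) ≤ 0 := by
    have : δ⁻¹ * (r - dist x x₀) ≤ δ⁻¹ * (-δ) :=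
      mul_le_mul_of_nonneg_left (by linarith) (by positivity)
    have e : δ⁻¹ * (-δ) = -1 := by field_simp
    linarith
  exact max_eq_left ((min_le_right _ _).trans h2)

lemma lipschitzWith_radialCutoff (x₀ : X) (r : ℝ) {δ : ℝ} (hδ : 0 < δ) :
    LipschitzWith (Real.toNNReal δ⁻¹) (radialCutoff x₀ r δ) := by
  have h : LipschitzWith (Real.toNNReal δ⁻¹) (fun x => 1 + δ⁻¹ * (r - dist x x₀)) := by
    refine LipschitzWith.of_dist_le_mul fun x y => ?_
    rw [Real.coe_toNNReal _ (by positivity), Real.dist_eq]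
    have e : 1 + δ⁻¹ * (r - dist x x₀) - (1 + δ⁻¹ * (r - dist y x₀))
        = δ⁻¹ * (dist y x₀ - dist x x₀) := by ring
    rw [e, abs_mul, abs_of_pos (inv_pos.2 hδ), dist_comm x y]
    exact mul_le_mul_of_nonneg_left (abs_dist_sub_le _ _ _) (by positivity)
  exact (h.const_min 1).const_max 0

lemma tsupport_radialCutoff_subset (x₀ : X) (r : ℝ) {δ : ℝ} (hδ : 0 < δ) :
    tsupport (radialCutoff x₀ r δ) ⊆ Metric.closedBall x₀ (r + δ) := by
  refine closure_minimal (fun x hx => ?_) Metric.isClosed_closedBall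
  by_contra h
  exact hx (radialCutoff_eq_zero hδ h)

lemma hasCompactSupport_radialCutoff [ProperSpace X] (x₀ : X) (r : ℝ) {δ : ℝ} (hδ : 0 < δ) :
    HasCompactSupport (radialCutoff x₀ r δ) :=
  (isCompact_closedBall x₀ (r + δ)).of_isClosed_subset (isClosed_tsupport _)
    (tsupport_radialCutoff_subset x₀ r hδ)

end Cutoff

section LogFunctions

variable {α : Type*} [PseudoMetricSpace α] {U : α → ℝ}

lemma isBddLipschitz_inv_add (hU : IsBddLipschitz U) (h0 : ∀ x, 0 ≤ U x) {ε : ℝ} (hε : 0 < ε) :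
    IsBddLipschitz (fun x => (U x + ε)⁻¹) := by
  obtain ⟨⟨K, hK⟩, -⟩ := hU
  have hpos : ∀ x, ε ≤ U x + ε := fun x => by linarith [h0 x]
  refine ⟨⟨Real.toNNReal (ε⁻¹ * ε⁻¹ * K), LipschitzWith.of_dist_le_mul fun x y => ?_⟩,
    ε⁻¹, fun x => ?_⟩
  · have hx : 0 < U x + ε := hε.trans_le (hpos x)
    have hy : 0 < U y + ε := hε.trans_le (hpos y)
    have h1 := hK.dist_le_mul x y
    rw [Real.coe_toNNReal _ (by positivity), Real.dist_eq]
    have e : (U x + ε)⁻¹ - (U y + ε)⁻¹ = (U x + ε)⁻¹ * (U y + ε)⁻¹ * (U y - U x) := by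
      field_simp; ring
    rw [e, abs_mul, abs_of_pos (by positivity), mul_assoc _ (K : ℝ)]
    rw [Real.dist_eq, abs_sub_comm] at h1
    refine mul_le_mul ?_ h1 (abs_nonneg _) (by positivity)
    exact mul_le_mul (inv_anti₀ hε (hpos x)) (inv_anti₀ hε (hpos y)) (by positivity)
      (by positivity)
  · have hx : 0 < U x + ε := hε.trans_le (hpos x)
    rw [abs_of_pos (by positivity)]
    exact inv_anti₀ hε (hpos x)

/-- This is log y ≤ y - 1 at y = (s + ε)/(t + ε). Applied with s and t in both orders, it yields the
Lipschitz bound for the logarithm. -/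
lemma log_add_sub_le {s t ε : ℝ} (hε : 0 < ε) (hs : 0 ≤ s) (ht : 0 ≤ t) :
    Real.log (s + ε) - Real.log (t + ε) ≤ ε⁻¹ * |s - t| := by
  have h1 : 0 < s + ε := by linarith
  have h2 : 0 < t + ε := by linarith
  rw [← Real.log_div h1.ne' h2.ne']
  refine (Real.log_le_sub_one_of_pos (by positivity)).trans ?_
  have e : (s + ε) / (t + ε) - 1 = (t + ε)⁻¹ * (s - t) := by field_simp; ring
  rw [e]
  calc (t + ε)⁻¹ * (s - t) ≤ (t + ε)⁻¹ * |s - t| :=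
        mul_le_mul_of_nonneg_left (le_abs_self _) (by positivity)
    _ ≤ ε⁻¹ * |s - t| :=
        mul_le_mul_of_nonneg_right (inv_anti₀ hε (by linarith)) (abs_nonneg _)

lemma lipschitzWith_log_add {K : ℝ≥0} (hK : LipschitzWith K U) (h0 : ∀ x, 0 ≤ U x) {ε : ℝ}
    (hε : 0 < ε) (c : ℝ) :
    LipschitzWith (Real.toNNReal (ε⁻¹ * K)) (fun x => c - Real.log (U x + ε)) := by
  refine LipschitzWith.of_dist_le_mul fun x y => ?_
  have h1 := hK.dist_le_mul x y
  rw [Real.dist_eq] at h1 ⊢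
  rw [Real.coe_toNNReal _ (by positivity), mul_assoc]
  have h2 := log_add_sub_le hε (h0 x) (h0 y)
  have h3 := log_add_sub_le hε (h0 y) (h0 x)
  rw [abs_sub_comm] at h3
  have h4 : ε⁻¹ * |U x - U y| ≤ ε⁻¹ * (K * dist x y) :=
    mul_le_mul_of_nonneg_left h1 (by positivity)
  rw [abs_le]; constructor <;> linarith

end LogFunctions

lemma hasFDerivAt_inv_add {E : Type*} [NormedAddCommGroup E] [NormedSpace ℝ E] {U : E → ℝ}
    {z : E} (hU : DifferentiableAt ℝ U z) {ε : ℝ} (h : U z + ε ≠ 0) :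
    fderiv ℝ (fun x => (U x + ε)⁻¹) z = -((U z + ε)⁻¹ ^ 2) • fderiv ℝ U z := by
  have h1 : HasDerivAt (fun s : ℝ => (s + ε)⁻¹) (-1 / (U z + ε) ^ 2) (U z) :=
    ((hasDerivAt_id (U z)).add_const ε).inv h
  have h2 := h1.comp_hasFDerivAt z hU.hasFDerivAt
  have h3 : fderiv ℝ (fun x => (U x + ε)⁻¹) z = _ := h2.fderiv
  rw [h3]; congr 1; field_simp

lemma hasFDerivAt_log_add {E : Type*} [NormedAddCommGroup E] [NormedSpace ℝ E] {U : E → ℝ}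
    {z : E} (hU : DifferentiableAt ℝ U z) {ε : ℝ} (h : U z + ε ≠ 0) (c : ℝ) :
    fderiv ℝ (fun x => c - Real.log (U x + ε)) z = -((U z + ε)⁻¹) • fderiv ℝ U z := by
  have h1 : HasDerivAt (fun s : ℝ => c - Real.log (s + ε)) (-(1 / (U z + ε))) (U z) :=
    (((hasDerivAt_id (U z)).add_const ε).log h).const_sub c
  have h2 := h1.comp_hasFDerivAt z hU.hasFDerivAt
  have h3 : fderiv ℝ (fun x => c - Real.log (U x + ε)) z = _ := h2.fderiv
  rw [h3]; congr 1; field_simp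

/-! ### The logarithmic estimate. -/

namespace IsBddSupersolution

open Filter Topology

variable {n : ℕ} {a : SpaceTime n → Matrix (Fin n) (Fin n) ℝ}
  {b : SpaceTime n → EuclideanSpace ℝ (Fin n)} {ν M : ℝ} {Q : Set (SpaceTime n)}
  {U : SpaceTime n → ℝ}

/-- The logarithmic estimate: the Dirichlet integral of `log (U + ε)` grows at most linearly in
`log ε⁻¹`. -/
theorem log_estimate (h : IsBddSupersolution a b ν M Q U) (hn : 0 < n)
    {φ : EuclideanSpace ℝ (Fin n) → ℝ} {ψ : ℝ → ℝ} {L K : ℝ≥0}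
    (hφ : LipschitzWith L φ) (hφc : HasCompactSupport φ) (hφ0 : ∀ x, 0 ≤ φ x)
    (hψ : LipschitzWith K ψ) (hψc : HasCompactSupport ψ) (hψ0 : ∀ t, 0 ≤ ψ t)
    (hsupp : tsupport φ ×ˢ tsupport ψ ⊆ Q) {N : ℝ} (hN : ∀ z, U z ≤ N) :
    ∃ C : ℝ, 0 ≤ C ∧ ∀ k : ℕ,
      ∫ z in Q, (U z + Real.exp (-k))⁻¹ ^ 2 * (∑ i, spaceDeriv i U z ^ 2) * φ z.1 ^ 2 * ψ z.2 ≤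
        C * (1 + Real.log (N + 1) + k) := by
  have hφB : IsBddLipschitz (fun z : SpaceTime n => φ z.1) :=
    (IsBddLipschitz.of_hasCompactSupport hφ hφc).comp LipschitzWith.prod_fst
  have hψB : IsBddLipschitz (fun z : SpaceTime n => ψ z.2) :=
    (IsBddLipschitz.of_hasCompactSupport hψ hψc).comp LipschitzWith.prod_snd
  set C1 : ℝ := 2 * n ^ 3 * M ^ 2 * L ^ 2 / ν with hC1
  have hν := h.ν_pos
  have hC10 : 0 ≤ C1 := by positivity
  obtain ⟨Cψ, hCψ⟩ := hψB.2
  have hF : IntegrableOn (fun z : SpaceTime n => C1 * ψ z.2 + φ z.1 ^ 2 * |deriv ψ z.2|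
      + 2 * n * L * (‖b z‖ * φ z.1 * ψ z.2)) Q := by
    refine (Integrable.add (Integrable.const_mul ?_ _) ?_).add (Integrable.const_mul ?_ _)
    · exact h.integrableOn_of_bdd hψB.continuous.aestronglyMeasurable (ae_of_all _ hCψ)
    · obtain ⟨C, hC⟩ := (hφB.mul hφB).2
      refine h.integrableOn_of_bdd (C := C * K) ?_ (ae_of_all _ fun z => ?_)
      · have : Measurable fun z : SpaceTime n => |deriv ψ z.2| :=
          ((measurable_deriv ψ).comp measurable_snd).norm
        exact ((hφB.continuous.measurable.pow_const 2).mul this).aestronglyMeasurable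
      · rw [abs_mul, sq, abs_abs]
        exact mul_le_mul (hC z) (norm_deriv_le_of_lipschitz hψ) (abs_nonneg _)
          ((abs_nonneg _).trans (hC z))
    · obtain ⟨C, hC⟩ := (hφB.mul hψB).2
      refine (h.integrableOn.norm.const_mul C).mono' ?_ (ae_of_all _ fun z => ?_)
      · exact (h.integrableOn.aestronglyMeasurable.norm.mul
          hφB.continuous.aestronglyMeasurable).mul hψB.continuous.aestronglyMeasurable
      · have : ‖b z‖ * φ z.1 * ψ z.2 = (φ z.1 * ψ z.2) * ‖b z‖ := by ring
        rw [this, Real.norm_eq_abs, abs_mul, abs_norm]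
        exact mul_le_mul_of_nonneg_right (hC z) (norm_nonneg _)
  set F : SpaceTime n → ℝ := fun z => C1 * ψ z.2 + φ z.1 ^ 2 * |deriv ψ z.2|
      + 2 * n * L * (‖b z‖ * φ z.1 * ψ z.2) with hFdef
  have hψ0' : ∀ z : SpaceTime n, 0 ≤ ψ z.2 := fun z => hψ0 _
  have hφ0' : ∀ z : SpaceTime n, 0 ≤ φ z.1 := fun z => hφ0 _
  have hF0 : ∀ z, 0 ≤ F z := fun z => by
    have := hψ0' z; have := hφ0' z
    simp only [hFdef]; positivity
  -- F is the integrand of the energy inequality with W replaced by 1 and ∂ₜψ by its absolute value.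
  -- The factor 1 + log(N + 1) + k dominates both 1 and W, and it is linear in k because ε =
  -- exp(-k).
  refine ⟨2 / ν * ∫ z in Q, F z, mul_nonneg (by positivity) (integral_nonneg hF0), fun k => ?_⟩
  have hε : 0 < Real.exp (-(k : ℝ)) := Real.exp_pos _
  have hε1 : Real.exp (-(k : ℝ)) ≤ 1 := Real.exp_le_one_iff.2 (by simp)
  have hU0 := h.nonneg
  obtain ⟨KU, hKU⟩ := h.isBddLipschitz.1
  have hN0 : 0 ≤ N := (hU0 0).trans (hN 0)
  have hlogN : 0 ≤ Real.log (N + 1) := Real.log_nonneg (by linarith)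
  set W : SpaceTime n → ℝ := fun z => Real.log (N + 1) - Real.log (U z + Real.exp (-k)) with hWdef
  have hpos : ∀ z, 0 < U z + Real.exp (-(k : ℝ)) := fun z => by linarith [hU0 z]
  have hW0 : ∀ z, 0 ≤ W z := fun z =>
    sub_nonneg.2 (Real.log_le_log (hpos z) (by linarith [hN z]))
  have hWk : ∀ z, W z ≤ Real.log (N + 1) + k := fun z => by
    have : -(k : ℝ) ≤ Real.log (U z + Real.exp (-k)) :=
      (Real.le_log_iff_exp_le (hpos z)).2 (by linarith [hU0 z])
    simp only [hWdef]; linarith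
  have hWB : IsBddLipschitz W := ⟨⟨_, lipschitzWith_log_add hKU hU0 hε _⟩,
    Real.log (N + 1) + k, fun z => by rw [abs_of_nonneg (hW0 z)]; exact hWk z⟩
  have hHB := isBddLipschitz_inv_add h.isBddLipschitz hU0 hε
  have hdiff := hKU.ae_differentiableAt (μ := (volume : Measure (SpaceTime n)))
  -- For the logarithm h² = c holds identically, so the bound H² ≤ cP is satisfied with P = 1.
  have hen := h.energy_inequality hn (W := W) (H := fun z => (U z + Real.exp (-k))⁻¹)
    (c := fun z => (U z + Real.exp (-k))⁻¹ ^ 2) (P := fun _ => 1) hWB hHB hW0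
    (fun z => (inv_pos.2 (hpos z)).le) (hHB.continuous.measurable.pow_const 2)
    (fun z => sq_nonneg _) (Cc := (Real.exp (-(k : ℝ)))⁻¹ ^ 2)
    (fun z => pow_le_pow_left₀ (inv_pos.2 (hpos z)).le
      (inv_anti₀ hε (by linarith [hU0 z])) 2)
    measurable_const (fun _ => zero_le_one) (CP := 1) (fun _ => le_rfl)
    (hdiff.mono fun z hz => hasFDerivAt_log_add hz (hpos z).ne' _)
    (hdiff.mono fun z hz => hasFDerivAt_inv_add hz (hpos z).ne')
    hφ hφc hφ0 hψ hψc hψ0 hsupp (fun z _ => by simp)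
  have hle : ∫ z in Q, (C1 * 1 * ψ z.2 + W z * φ z.1 ^ 2 * deriv ψ z.2
        + 2 * n * L * (W z * ‖b z‖ * φ z.1 * ψ z.2)) ≤
      ∫ z in Q, F z * (1 + Real.log (N + 1) + k) := by
    refine integral_mono hen.1 (hF.mul_const _) fun z => ?_
    set Λ : ℝ := 1 + Real.log (N + 1) + k with hΛ
    have hΛ1 : 1 ≤ Λ := by rw [hΛ]; linarith [(Nat.cast_nonneg k : (0 : ℝ) ≤ k)]
    have hWΛ : W z ≤ Λ := by linarith [hWk z]
    have hψz := hψ0' z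
    have hφz := hφ0' z
    have t1 : C1 * 1 * ψ z.2 ≤ C1 * ψ z.2 * Λ := by
      rw [mul_one]; exact le_mul_of_one_le_right (by positivity) hΛ1
    have t2 : W z * φ z.1 ^ 2 * deriv ψ z.2 ≤ φ z.1 ^ 2 * |deriv ψ z.2| * Λ := by
      calc W z * φ z.1 ^ 2 * deriv ψ z.2 ≤ W z * φ z.1 ^ 2 * |deriv ψ z.2| :=
            mul_le_mul_of_nonneg_left (le_abs_self _) (mul_nonneg (hW0 z) (sq_nonneg _))
        _ = φ z.1 ^ 2 * |deriv ψ z.2| * W z := by ring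
        _ ≤ _ := mul_le_mul_of_nonneg_left hWΛ (by positivity)
    have t3 : 2 * n * L * (W z * ‖b z‖ * φ z.1 * ψ z.2) ≤
        2 * n * L * (‖b z‖ * φ z.1 * ψ z.2) * Λ := by
      calc _ = 2 * n * L * (‖b z‖ * φ z.1 * ψ z.2) * W z := by ring
        _ ≤ _ := mul_le_mul_of_nonneg_left hWΛ (by positivity)
    calc _ ≤ C1 * ψ z.2 * Λ + φ z.1 ^ 2 * |deriv ψ z.2| * Λ
          + 2 * n * L * (‖b z‖ * φ z.1 * ψ z.2) * Λ := add_le_add (add_le_add t1 t2) t3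
      _ = F z * Λ := by simp only [hFdef]; ring
  have h2 := hen.2.trans hle
  rw [integral_mul_const] at h2
  have h3 := mul_le_mul_of_nonneg_left h2 (by positivity : 0 ≤ 2 / ν)
  rw [← mul_assoc, ← mul_assoc] at h3
  have e : 2 / ν * (ν / 2) = 1 := by field_simp
  rwa [e, one_mul] at h3

end IsBddSupersolution


/-! ### The zero set has no weak spatial gradient. -/

open Filter Topology in
-- Where s = 0 the logarithm equals -k, and where s > 0 it converges to log s. Division by k
-- therefore produces the indicator of {s = 0}.
lemma tendsto_log_add_exp_div {s c : ℝ} (hs : 0 ≤ s) :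
    Tendsto (fun k : ℕ => (c - Real.log (s + Real.exp (-k))) / k) atTop
      (𝓝 (if s = 0 then 1 else 0)) := by
  have hk : Tendsto (fun k : ℕ => (k : ℝ)) atTop atTop := tendsto_natCast_atTop_atTop
  split_ifs with h
  · subst h
    have h1 : Tendsto (fun k : ℕ => c / k + 1) atTop (𝓝 (0 + 1)) :=
      (tendsto_const_nhds.div_atTop hk).add_const 1
    rw [zero_add] at h1
    refine h1.congr' ?_
    filter_upwards [eventually_gt_atTop 0] with k hk0
    have : (k : ℝ) ≠ 0 := by positivity
    rw [zero_add, Real.log_exp]; field_simp; ring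
  · have hs' : 0 < s := lt_of_le_of_ne hs (Ne.symm h)
    refine Tendsto.div_atTop (a := c - Real.log (s + 0)) ?_ hk
    refine tendsto_const_nhds.sub (Tendsto.log ?_ (by simpa using h))
    exact tendsto_const_nhds.add (Real.tendsto_exp_neg_atTop_nhds_zero.comp hk)

namespace IsBddSupersolution

open Filter Topology

variable {n : ℕ} {a : SpaceTime n → Matrix (Fin n) (Fin n) ℝ}
  {b : SpaceTime n → EuclideanSpace ℝ (Fin n)} {ν M : ℝ} {Q : Set (SpaceTime n)}
  {U : SpaceTime n → ℝ}

/-- The indicator function of the zero set has vanishing weak spatial derivatives. -/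
theorem integral_indicator_zeroSet_mul_spaceDeriv (h : IsBddSupersolution a b ν M Q U)
    (hn : 0 < n) {φ : EuclideanSpace ℝ (Fin n) → ℝ} {ψ : ℝ → ℝ} {L K : ℝ≥0}
    (hφ : LipschitzWith L φ) (hφc : HasCompactSupport φ) (hφ0 : ∀ x, 0 ≤ φ x)
    (hψ : LipschitzWith K ψ) (hψc : HasCompactSupport ψ) (hψ0 : ∀ t, 0 ≤ ψ t)
    (hsupp : tsupport φ ×ˢ tsupport ψ ⊆ Q) {ξ : SpaceTime n → ℝ} {Kξ : ℝ≥0}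
    (hξ : LipschitzWith Kξ ξ) {A : ℝ} (hA : 0 ≤ A)
    (hξA : ∀ z, |ξ z| ≤ A * (φ z.1 ^ 2 * ψ z.2)) (i : Fin n) :
    ∫ z in Q, {z | U z = 0}.indicator 1 z * spaceDeriv i ξ z = 0 := by
  obtain ⟨N, hN⟩ := h.isBddLipschitz.2
  have hN' : ∀ z, U z ≤ N := fun z => (le_abs_self _).trans (hN z)
  obtain ⟨C, hC0, hC⟩ := h.log_estimate hn hφ hφc hφ0 hψ hψc hψ0 hsupp hN'
  have hU0 := h.nonneg
  have hN0 : 0 ≤ N := (hU0 0).trans (hN' 0)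
  have hlogN : 0 ≤ Real.log (N + 1) := Real.log_nonneg (by linarith)
  obtain ⟨KU, hKU⟩ := h.isBddLipschitz.1
  have hfin : IsFiniteMeasure (volume.restrict Q) := ⟨by simpa using h.measure_ne_top.lt_top⟩
  have hcomp : IsCompact (tsupport φ ×ˢ tsupport ψ) := hφc.prod hψc
  have hξs : tsupport ξ ⊆ tsupport φ ×ˢ tsupport ψ := by
    refine closure_minimal (fun z hz => ?_) hcomp.isClosed
    by_contra hz'
    have h1 := hξA z
    have h2 : φ z.1 ^ 2 * ψ z.2 = 0 := by
      by_cases h3 : z.1 ∈ tsupport φ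
      · rw [image_eq_zero_of_notMem_tsupport fun h4 => hz' ⟨h3, h4⟩, mul_zero]
      · rw [image_eq_zero_of_notMem_tsupport h3]; simp
    rw [h2, mul_zero] at h1
    exact hz (abs_nonpos_iff.1 h1)
  have hξc : HasCompactSupport ξ := hcomp.of_isClosed_subset (isClosed_tsupport _) hξs
  have hξB := IsBddLipschitz.of_hasCompactSupport hξ hξc
  have hφB : IsBddLipschitz (fun z : SpaceTime n => φ z.1) :=
    (IsBddLipschitz.of_hasCompactSupport hφ hφc).comp LipschitzWith.prod_fst
  have hψB : IsBddLipschitz (fun z : SpaceTime n => ψ z.2) :=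
    (IsBddLipschitz.of_hasCompactSupport hψ hψc).comp LipschitzWith.prod_snd
  have hε : ∀ k : ℕ, 0 < Real.exp (-(k : ℝ)) := fun k => Real.exp_pos _
  have hpos : ∀ (k : ℕ) z, 0 < U z + Real.exp (-(k : ℝ)) := fun k z => by
    linarith [hU0 z, hε k]
  set W : ℕ → SpaceTime n → ℝ := fun k z =>
    Real.log (N + 1) - Real.log (U z + Real.exp (-k)) with hWdef
  have hWL : ∀ k, LipschitzWith _ (W k) := fun k => lipschitzWith_log_add hKU hU0 (hε k) _
  have hWb : ∀ k z, |W k z| ≤ Real.log (N + 1) + k := fun k z => by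
    have h1 : -(k : ℝ) ≤ Real.log (U z + Real.exp (-k)) :=
      (Real.le_log_iff_exp_le (hpos k z)).2 (by linarith [hU0 z])
    have h2 : Real.log (U z + Real.exp (-k)) ≤ Real.log (N + 1) :=
      Real.log_le_log (hpos k z) (by
        linarith [hN' z, (Real.exp_le_one_iff.2 (by simp) : Real.exp (-(k : ℝ)) ≤ 1)])
    simp only [hWdef]; rw [abs_le]; constructor <;> linarith [(Nat.cast_nonneg k : (0 : ℝ) ≤ k)]
  have hWB : ∀ k, IsBddLipschitz (W k) := fun k => ⟨⟨_, hWL k⟩, _, hWb k⟩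
  -- integration by parts
  have hibp : ∀ k, ∫ z in Q, W k z * spaceDeriv i ξ z = -∫ z in Q, ξ z * spaceDeriv i (W k) z := by
    intro k
    obtain ⟨KP, hKP⟩ := ((hWB k).mul hξB).1
    have hPs : tsupport (fun z => W k z * ξ z) ⊆ Q :=
      ((tsupport_mul_subset_right (f := W k)).trans hξs).trans hsupp
    have hPc : HasCompactSupport (fun z => W k z * ξ z) :=
      hcomp.of_isClosed_subset (isClosed_tsupport _)
        ((tsupport_mul_subset_right (f := W k)).trans hξs)
    have h0 : ∫ z in Q, spaceDeriv i (fun z => W k z * ξ z) z = 0 := by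
      rw [← integral_fderiv_apply_eq_zero volume hKP hPc
        ((EuclideanSpace.single i 1, 0) : SpaceTime n)]
      exact setIntegral_eq_integral_of_forall_compl_eq_zero fun z hz =>
        spaceDeriv_eq_zero_of_notMem hPs hz i
    have h1 : ∫ z in Q, spaceDeriv i (fun z => W k z * ξ z) z =
        ∫ z in Q, (W k z * spaceDeriv i ξ z + ξ z * spaceDeriv i (W k) z) := by
      refine integral_congr_ae (ae_restrict_of_ae ?_)
      filter_upwards [(hWL k).ae_differentiableAt (μ := volume),
        hξ.ae_differentiableAt (μ := volume)] with z hz1 hz2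
      exact spaceDeriv_mul hz1 hz2 i
    obtain ⟨Cξ, hCξ⟩ := hξB.2
    rw [h0, integral_add] at h1
    · linarith
    · refine h.integrableOn_of_bdd (C := (Real.log (N + 1) + k) * Kξ) ?_ (ae_of_all _ fun z => ?_)
      · exact ((hWB k).continuous.measurable.mul (measurable_spaceDeriv i ξ)).aestronglyMeasurable
      · rw [abs_mul]
        exact mul_le_mul (hWb k z) (abs_spaceDeriv_le hξ i z) (abs_nonneg _)
          ((abs_nonneg _).trans (hWb k z))
    · refine h.integrableOn_of_bdd (C := Cξ * (Real.toNNReal ((Real.exp (-(k : ℝ)))⁻¹ * KU)))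
        ?_ (ae_of_all _ fun z => ?_)
      · exact (hξ.continuous.measurable.mul (measurable_spaceDeriv i (W k))).aestronglyMeasurable
      · rw [abs_mul]
        exact mul_le_mul (hCξ z) (abs_spaceDeriv_le (hWL k) i z) (abs_nonneg _)
          ((abs_nonneg _).trans (hCξ z))
  -- the quantitative bound
  obtain ⟨Cθ, hCθ⟩ := ((hφB.mul hφB).mul hψB).2
  have hθi : IntegrableOn (fun z : SpaceTime n => φ z.1 ^ 2 * ψ z.2) Q := by
    refine h.integrableOn_of_bdd (C := Cθ) ?_ (ae_of_all _ fun z => ?_)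
    · exact ((hφB.continuous.measurable.pow_const 2).mul
        hψB.continuous.measurable).aestronglyMeasurable
    · rw [sq]; exact hCθ z
  set D : ℝ := ∫ z in Q, φ z.1 ^ 2 * ψ z.2 with hD
  have hbound : ∀ k : ℕ, 0 < k → |∫ z in Q, W k z / k * spaceDeriv i ξ z| ≤
      A * (C * ((1 + Real.log (N + 1)) / k + 1) + D) * (1 / Real.sqrt k) := by
    intro k hk
    have hk' : (0 : ℝ) < k := by exact_mod_cast hk
    -- The weighted integral of |DW_k|² is of order k. Young's inequality |y| ≤ y²/s + s with s = √k
    -- balances it against the constant part, so both terms are O(√k) and become O(1/√k) after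
    -- division by k.
    set s := Real.sqrt k with hs
    have hs0 : 0 < s := Real.sqrt_pos.2 hk'
    have hss : s * s = k := Real.mul_self_sqrt hk'.le
    have hgi : IntegrableOn (fun z => (U z + Real.exp (-k))⁻¹ ^ 2 *
        (∑ i, spaceDeriv i U z ^ 2) * φ z.1 ^ 2 * ψ z.2) Q := by
      obtain ⟨C', hC'⟩ := ((isBddLipschitz_inv_add h.isBddLipschitz hU0 (hε k)).mul
        ((isBddLipschitz_inv_add h.isBddLipschitz hU0 (hε k)).mul ((hφB.mul hφB).mul hψB))).2
      have hm1 : Measurable fun z => (U z + Real.exp (-(k : ℝ)))⁻¹ :=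
        (isBddLipschitz_inv_add h.isBddLipschitz hU0 (hε k)).continuous.measurable
      have hm2 : Measurable fun z => ∑ i, spaceDeriv i U z ^ 2 :=
        Finset.measurable_sum _ fun i _ => (measurable_spaceDeriv i U).pow_const 2
      refine h.integrableOn_of_bdd (C := C' * ∑ _i : Fin n, (KU : ℝ) ^ 2) ?_
        (ae_of_all _ fun z => ?_)
      · exact ((((hm1.pow_const 2).mul hm2).mul (hφB.continuous.measurable.pow_const 2)).mul
          hψB.continuous.measurable).aestronglyMeasurable
      · have e : (U z + Real.exp (-k))⁻¹ ^ 2 * (∑ i, spaceDeriv i U z ^ 2) * φ z.1 ^ 2 * ψ z.2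
            = (U z + Real.exp (-k))⁻¹ * ((U z + Real.exp (-k))⁻¹ * (φ z.1 * φ z.1 * ψ z.2))
              * (∑ i, spaceDeriv i U z ^ 2) := by ring
        rw [e, abs_mul, abs_of_nonneg (Finset.sum_nonneg fun i _ => sq_nonneg (spaceDeriv i U z))]
        refine mul_le_mul (hC' z) (Finset.sum_le_sum fun i _ => ?_)
          (Finset.sum_nonneg fun i _ => sq_nonneg _) ((abs_nonneg _).trans (hC' z))
        exact sq_le_sq' (abs_le.1 (abs_spaceDeriv_le hKU i z)).1
          (abs_le.1 (abs_spaceDeriv_le hKU i z)).2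
    have h1 : |∫ z in Q, ξ z * spaceDeriv i (W k) z| ≤
        A * ((1 / s) * (C * (1 + Real.log (N + 1) + k)) + s * D) := by
      refine (abs_integral_le_integral_abs).trans ?_
      have h2 : ∫ z in Q, |ξ z * spaceDeriv i (W k) z| ≤
          ∫ z in Q, A * ((1 / s) * ((U z + Real.exp (-k))⁻¹ ^ 2 *
            (∑ i, spaceDeriv i U z ^ 2) * φ z.1 ^ 2 * ψ z.2) + s * (φ z.1 ^ 2 * ψ z.2)) := by
        refine integral_mono_of_nonneg (ae_of_all _ fun z => abs_nonneg _)
          (((hgi.const_mul _).add (hθi.const_mul _)).const_mul _) (ae_restrict_of_ae ?_)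
        filter_upwards [hKU.ae_differentiableAt (μ := volume)] with z hz
        have hfd := hasFDerivAt_log_add hz (hpos k z).ne' (Real.log (N + 1))
        have e1 : spaceDeriv i (W k) z = -((U z + Real.exp (-k))⁻¹) * spaceDeriv i U z := by
          simp only [spaceDeriv, hWdef]; rw [hfd]; simp
        have e2 : spaceDeriv i (W k) z ^ 2 ≤ (U z + Real.exp (-k))⁻¹ ^ 2 *
            ∑ i, spaceDeriv i U z ^ 2 := by
          rw [e1, mul_pow, neg_sq]
          refine mul_le_mul_of_nonneg_left ?_ (sq_nonneg _)
          exact Finset.single_le_sum (f := fun i => spaceDeriv i U z ^ 2)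
            (fun i _ => sq_nonneg _) (Finset.mem_univ i)
        have e3 : |spaceDeriv i (W k) z| ≤
            (1 / s) * ((U z + Real.exp (-k))⁻¹ ^ 2 * ∑ i, spaceDeriv i U z ^ 2) + s := by
          have e4 : |spaceDeriv i (W k) z| ≤ (1 / s) * spaceDeriv i (W k) z ^ 2 + s := by
            rw [← sq_abs, one_div, ← sub_nonneg]
            have : s⁻¹ * |spaceDeriv i (W k) z| ^ 2 + s - |spaceDeriv i (W k) z|
                = s⁻¹ * ((|spaceDeriv i (W k) z| - s / 2) ^ 2 + 3 / 4 * (s * s)) := by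
              field_simp; ring
            rw [this]; positivity
          refine e4.trans ?_
          gcongr
        have hθ0 : 0 ≤ φ z.1 ^ 2 * ψ z.2 := mul_nonneg (sq_nonneg _) (hψ0 _)
        rw [abs_mul]
        calc |ξ z| * |spaceDeriv i (W k) z|
            ≤ (A * (φ z.1 ^ 2 * ψ z.2)) * ((1 / s) * ((U z + Real.exp (-k))⁻¹ ^ 2 *
              ∑ i, spaceDeriv i U z ^ 2) + s) :=
              mul_le_mul (hξA z) e3 (abs_nonneg _) (mul_nonneg hA hθ0)
          _ = _ := by ring
      refine h2.trans ?_
      rw [integral_const_mul, integral_add (hgi.const_mul _) (hθi.const_mul _),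
        integral_const_mul, integral_const_mul]
      gcongr
      exact hC k
    have e0 : ∫ z in Q, W k z / k * spaceDeriv i ξ z
        = (1 / k) * -∫ z in Q, ξ z * spaceDeriv i (W k) z := by
      rw [← hibp, ← integral_const_mul]
      exact integral_congr_ae (ae_of_all _ fun z => by beta_reduce; ring)
    rw [e0, abs_mul, abs_neg, abs_of_pos (by positivity)]
    refine (mul_le_mul_of_nonneg_left h1 (by positivity)).trans (le_of_eq ?_)
    rw [← hss]
    field_simp
  have hlim0 : Tendsto (fun k : ℕ => ∫ z in Q, W k z / k * spaceDeriv i ξ z) atTop (𝓝 0) := by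
    have hk : Tendsto (fun k : ℕ => (k : ℝ)) atTop atTop := tendsto_natCast_atTop_atTop
    have h1 : Tendsto (fun k : ℕ => A * (C * ((1 + Real.log (N + 1)) / k + 1) + D) *
        (1 / Real.sqrt k)) atTop (𝓝 (A * (C * (0 + 1) + D) * 0)) := by
      refine Tendsto.mul (Tendsto.const_mul _ (Tendsto.add_const _ (Tendsto.const_mul _
        (Tendsto.add_const _ (tendsto_const_nhds.div_atTop hk))))) ?_
      exact tendsto_const_nhds.div_atTop (Real.tendsto_sqrt_atTop.comp hk)
    rw [mul_zero] at h1
    refine squeeze_zero_norm' ?_ h1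
    filter_upwards [eventually_gt_atTop 0] with k hk0
    exact hbound k hk0
  -- The functions W_k / k are bounded by log(N + 1) + 1 uniformly in k, so dominated convergence
  -- identifies the limit.
  have hlim1 : Tendsto (fun k : ℕ => ∫ z in Q, W k z / k * spaceDeriv i ξ z) atTop
      (𝓝 (∫ z in Q, {z | U z = 0}.indicator 1 z * spaceDeriv i ξ z)) := by
    refine tendsto_integral_of_dominated_convergence
      (fun _ => (Real.log (N + 1) + 1) * Kξ) (fun k => ?_) (integrable_const _)
      (fun k => ae_of_all _ fun z => ?_) (ae_of_all _ fun z => ?_)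
    · exact (((hWB k).continuous.measurable.div_const _).mul
        (measurable_spaceDeriv i ξ)).aestronglyMeasurable
    · rw [Real.norm_eq_abs, abs_mul, abs_div, Nat.abs_cast]
      refine mul_le_mul ?_ (abs_spaceDeriv_le hξ i z) (abs_nonneg _) (by positivity)
      rcases Nat.eq_zero_or_pos k with rfl | hk
      · simp; positivity
      · have hk' : (1 : ℝ) ≤ k := by exact_mod_cast hk
        rw [div_le_iff₀ (by positivity)]
        nlinarith [hWb k z]
    · refine Tendsto.mul_const _ ?_
      have := tendsto_log_add_exp_div (c := Real.log (N + 1)) (hU0 z)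
      convert this using 2
      simp [Set.indicator]
  exact tendsto_nhds_unique hlim1 hlim0

end IsBddSupersolution


/-! ### Time slices of the zero set. -/

section ZeroSet

open Filter Topology
open scoped Convolution

/-- The derivative is put on the kernel. Differentiating κ(z - y) in y instead of z gives the sign
and the form of a weak derivative tested with a smooth function. -/
lemma spaceDeriv_mollify {n : ℕ} {f : SpaceTime n → ℝ} (hf : LocallyIntegrable f) (k : ℕ)
    (i : Fin n) (z : SpaceTime n) :
    spaceDeriv i (mollify volume k f) z =
      -∫ y, f y * spaceDeriv i
        (fun y => (shrinkingBump (SpaceTime n) k).normed volume (z - y)) y := by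
  set κ := (shrinkingBump (SpaceTime n) k).normed volume with hκ
  have hκd : ContDiff ℝ 1 κ := (shrinkingBump (SpaceTime n) k).contDiff_normed
  have hκc : HasCompactSupport κ := (shrinkingBump (SpaceTime n) k).hasCompactSupport_normed
  have e1 : mollify volume k f = f ⋆[ContinuousLinearMap.mul ℝ ℝ, volume] κ := by
    funext x
    change (κ ⋆[ContinuousLinearMap.lsmul ℝ ℝ, volume] f) x = _
    rw [convolution_eq_swap]
    simp only [convolution, ContinuousLinearMap.lsmul_apply, smul_eq_mul,
      ContinuousLinearMap.mul_apply', mul_comm]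
  have h1 := hκc.hasFDerivAt_convolution_right (ContinuousLinearMap.mul ℝ ℝ) hf hκd z
  rw [spaceDeriv, e1, h1.fderiv, convolution_precompR_apply _ hf (hκc.fderiv ℝ)
    (hκd.continuous_fderiv one_ne_zero)]
  simp only [convolution, ContinuousLinearMap.mul_apply']
  rw [← integral_neg]
  refine integral_congr_ae (ae_of_all _ fun y => ?_)
  have h2 : HasFDerivAt (fun y => κ (z - y)) (-(fderiv ℝ κ (z - y))) y := by
    have := ((hκd.differentiable one_ne_zero) (z - y)).hasFDerivAt.comp y
      ((hasFDerivAt_id y).const_sub z)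
    simpa [Function.comp_def] using this
  beta_reduce
  rw [spaceDeriv, h2.fderiv]
  simp

lemma fderiv_slice_eq_zero {n : ℕ} {g : SpaceTime n → ℝ} {x : EuclideanSpace ℝ (Fin n)} {t : ℝ}
    (hg : DifferentiableAt ℝ g (x, t)) (h : ∀ i, spaceDeriv i g (x, t) = 0) :
    fderiv ℝ (fun y => g (y, t)) x = 0 := by
  have h1 := enorm_clm_sq_le (fderiv ℝ (fun y => g (y, t)) x)
  simp_rw [fderiv_slice_apply hg, h] at h1
  have h2 : ‖fderiv ℝ (fun y => g (y, t)) x‖ₑ ^ (2 : ℝ) = 0 := by simpa using h1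
  rw [ENNReal.rpow_eq_zero_iff_of_pos two_pos, ← ofReal_norm, ENNReal.ofReal_eq_zero] at h2
  exact norm_le_zero_iff.1 h2

namespace IsBddSupersolution

variable {n : ℕ} {a : SpaceTime n → Matrix (Fin n) (Fin n) ℝ}
  {b : SpaceTime n → EuclideanSpace ℝ (Fin n)} {ν M T R : ℝ}
  {x₀ : EuclideanSpace ℝ (Fin n)} {U : SpaceTime n → ℝ}

/-- The translated kernel κ(z - ·) is an admissible test function. It is bounded by A and supported
in the ball of radius ρ, where both cutoffs equal 1, so Aφ²ψ dominates it. The supports of the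
cutoffs reach to radius 2ρ, whence the ball in the hypothesis. -/
lemma spaceDeriv_mollify_indicator (h : IsBddSupersolution a b ν M
      (spaceTimeCylinder (Metric.ball x₀ R) T) U) (hn : 0 < n) {z : SpaceTime n} {k : ℕ}
    (hz : Metric.closedBall z (2 * (1 / ((k : ℝ) + 1))) ⊆
      spaceTimeCylinder (Metric.ball x₀ R) T) (i : Fin n) :
    spaceDeriv i (mollify volume k ({z | U z = 0}.indicator 1)) z = 0 := by
  have hUc := h.isBddLipschitz.continuous
  have hmeas : MeasurableSet {z | U z = 0} := (isClosed_singleton.preimage hUc).measurableSet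
  have hloc : LocallyIntegrable ({z | U z = 0}.indicator (1 : SpaceTime n → ℝ)) :=
    (locallyIntegrable_const (1 : ℝ)).indicator hmeas
  rw [spaceDeriv_mollify hloc, neg_eq_zero]
  set ρ : ℝ := 1 / ((k : ℝ) + 1) with hρ
  have hρ0 : 0 < ρ := by positivity
  set κ := (shrinkingBump (SpaceTime n) k).normed volume with hκ
  have hκd : ContDiff ℝ 1 κ := (shrinkingBump (SpaceTime n) k).contDiff_normed
  have hκc : HasCompactSupport κ := (shrinkingBump (SpaceTime n) k).hasCompactSupport_normed
  obtain ⟨Kκ, hKκ⟩ := hκd.lipschitzWith_of_hasCompactSupport hκc one_ne_zero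
  have hξL : LipschitzWith (Kκ * 1) (fun y => κ (z - y)) :=
    hKκ.comp (LipschitzWith.of_dist_le_mul fun x y => by
      rw [dist_sub_left, NNReal.coe_one, one_mul])
  obtain ⟨A, hA⟩ := hκc.exists_bound_of_continuous hκd.continuous
  have hA0 : 0 ≤ A := (norm_nonneg _).trans (hA 0)
  have hsupp0 : ∀ y, y ∉ Metric.closedBall z ρ → κ (z - y) = 0 := fun y hy => by
    have : z - y ∉ Function.support κ := by
      rw [hκ, ContDiffBump.support_normed_eq]
      simp only [Metric.mem_ball, dist_zero_right, not_lt]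
      rw [Metric.mem_closedBall, not_le, dist_comm, dist_eq_norm] at hy
      exact hy.le
    simpa using this
  have hprod : Metric.closedBall z.1 (2 * ρ) ×ˢ Metric.closedBall z.2 (2 * ρ)
      = Metric.closedBall z (2 * ρ) := closedBall_prod_same _ _ _
  have hmain := h.integral_indicator_zeroSet_mul_spaceDeriv hn
    (φ := radialCutoff z.1 ρ ρ) (ψ := radialCutoff z.2 ρ ρ)
    (lipschitzWith_radialCutoff _ _ hρ0) (hasCompactSupport_radialCutoff _ _ hρ0)
    (radialCutoff_nonneg _ _ _)
    (lipschitzWith_radialCutoff _ _ hρ0) (hasCompactSupport_radialCutoff _ _ hρ0)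
    (radialCutoff_nonneg _ _ _) (by
      refine (Set.prod_mono (tsupport_radialCutoff_subset _ _ hρ0)
        (tsupport_radialCutoff_subset _ _ hρ0)).trans ?_
      rwa [← two_mul, hprod]) hξL hA0 (fun y => by
      by_cases hy : y ∈ Metric.closedBall z ρ
      · have hy' := hy
        rw [← closedBall_prod_same z.1 z.2 ρ] at hy'
        rw [radialCutoff_eq_one hρ0 hy'.1, radialCutoff_eq_one hρ0 hy'.2]
        simpa using hA (z - y)
      · rw [hsupp0 y hy, abs_zero]
        have h1 := radialCutoff_nonneg z.2 ρ ρ y.2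
        positivity) i
  refine Eq.trans (Eq.symm ?_) hmain
  refine setIntegral_eq_integral_of_forall_compl_eq_zero fun y hy => ?_
  rw [spaceDeriv_eq_zero_of_notMem (S := Metric.closedBall z ρ), mul_zero]
  · refine closure_minimal (fun y hy => ?_) Metric.isClosed_closedBall
    by_contra h'
    exact hy (hsupp0 y h')
  · exact fun hy' => hy (hz (Metric.closedBall_subset_closedBall (by linarith) hy'))

/-- Almost every time slice of the zero set is either negligible or everything. -/
theorem ae_slice_zeroSet (h : IsBddSupersolution a b ν M
      (spaceTimeCylinder (Metric.ball x₀ R) T) U) (hn : 0 < n) :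
    ∀ᵐ t : ℝ, t ∈ Ioo 0 T → (∀ᵐ x, x ∈ Metric.ball x₀ R → U (x, t) ≠ 0) ∨
      ∀ x ∈ Metric.ball x₀ R, U (x, t) = 0 := by
  have hUc := h.isBddLipschitz.continuous
  have hmeas : MeasurableSet {z | U z = 0} := (isClosed_singleton.preimage hUc).measurableSet
  have hloc : LocallyIntegrable ({z | U z = 0}.indicator (1 : SpaceTime n → ℝ)) :=
    (locallyIntegrable_const (1 : ℝ)).indicator hmeas
  filter_upwards [ae_ae_of_ae_spaceTime (ae_tendsto_mollify volume hloc)] with t ht htT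
  by_cases hcase : ∀ᵐ x, x ∈ Metric.ball x₀ R → U (x, t) ≠ 0
  · exact Or.inl hcase
  right
  -- Mollified indicators converge at almost every x of this slice, hence at some point of the zero
  -- set, which is not negligible here.
  obtain ⟨x₁, hx₁, hx₁0, hx₁t⟩ : ∃ x₁ ∈ Metric.ball x₀ R, U (x₁, t) = 0 ∧
      Tendsto (fun k => mollify volume k ({z | U z = 0}.indicator (1 : SpaceTime n → ℝ)) (x₁, t))
        atTop (𝓝 ({z | U z = 0}.indicator (1 : SpaceTime n → ℝ) (x₁, t))) := by
    by_contra! hcon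
    refine hcase ?_
    filter_upwards [ht] with x hx hxR h0
    exact hcon x hxR h0 hx
  have hae : ∀ᵐ x, x ∈ Metric.ball x₀ R → U (x, t) = 0 := by
    filter_upwards [ht] with x hx hxR
    -- a common smaller ball
    obtain ⟨R', hR'1, hR'2⟩ : ∃ R', max (dist x x₀) (dist x₁ x₀) < R' ∧ R' < R :=
      exists_between (max_lt hxR hx₁)
    -- For small radii the mollified indicator is constant in x on the smaller ball. Its limits at x
    -- and x₁ coincide, so the indicator is 1 at x as well.
    have hev : ∀ᶠ k : ℕ in atTop,
        mollify volume k ({z | U z = 0}.indicator (1 : SpaceTime n → ℝ)) (x, t)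
          = mollify volume k ({z | U z = 0}.indicator (1 : SpaceTime n → ℝ)) (x₁, t) := by
      have hδ : 0 < min (R - R') (min t (T - t)) / 2 :=
        half_pos (lt_min (by linarith) (lt_min htT.1 (by linarith [htT.2])))
      filter_upwards [tendsto_one_div_add_atTop_nhds_zero_nat.eventually (gt_mem_nhds hδ)]
        with k hk
      have hk2 : 2 * (1 / ((k : ℝ) + 1)) < min (R - R') (min t (T - t)) := by linarith
      have hk3 := hk2.trans_le (min_le_left _ _)
      have hk4 := (hk2.trans_le (min_le_right _ _)).trans_le (min_le_left _ _)
      have hk5 := (hk2.trans_le (min_le_right _ _)).trans_le (min_le_right _ _)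
      have hd : Differentiable ℝ
          (mollify volume k ({z | U z = 0}.indicator (1 : SpaceTime n → ℝ))) :=
        (contDiff_mollify volume hloc k).differentiable (by simp)
      have hzero : ∀ y ∈ Metric.ball x₀ R', fderiv ℝ (fun y => mollify volume k
          ({z | U z = 0}.indicator (1 : SpaceTime n → ℝ)) (y, t)) y = 0 := fun y hy => by
        refine fderiv_slice_eq_zero (hd _) fun i => ?_
        refine h.spaceDeriv_mollify_indicator hn (fun w hw => ?_) i
        rw [← closedBall_prod_same] at hw
        obtain ⟨hw1, hw2⟩ := hw
        rw [Metric.mem_closedBall] at hw1 hw2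
        rw [Metric.mem_ball] at hy
        rw [Real.dist_eq, abs_le] at hw2
        refine ⟨?_, ?_, ?_⟩
        · rw [Metric.mem_ball]
          calc dist w.1 x₀ ≤ dist w.1 y + dist y x₀ := dist_triangle _ _ _
            _ < R := by linarith
        · linarith
        · linarith
      have hslice : Differentiable ℝ (fun y => mollify volume k
          ({z | U z = 0}.indicator (1 : SpaceTime n → ℝ)) (y, t)) :=
        hd.comp (differentiable_id.prodMk (differentiable_const t))
      exact Metric.isOpen_ball.is_const_of_fderiv_eq_zero
        (convex_ball x₀ R').isPreconnected hslice.differentiableOn hzero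
        (Metric.mem_ball.2 ((le_max_left _ _).trans_lt hR'1))
        (Metric.mem_ball.2 ((le_max_right _ _).trans_lt hR'1))
    have heq := tendsto_nhds_unique (hx.congr' hev) hx₁t
    by_contra hne
    have i1 : (x₁, t) ∈ {z | U z = 0} := hx₁0
    have i2 : (x, t) ∉ {z | U z = 0} := hne
    rw [indicator_of_mem i1, indicator_of_notMem i2] at heq
    simp at heq
  have heq : EqOn (fun x => U (x, t)) (fun _ => 0) (Metric.ball x₀ R) := by
    refine Measure.eqOn_open_of_ae_eq (μ := volume) ?_ Metric.isOpen_ball ?_ ?_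
    · exact (ae_restrict_iff' Metric.isOpen_ball.measurableSet).2 hae
    · exact (hUc.comp (by fun_prop)).continuousOn
    · exact continuousOn_const
  exact fun x hx => heq hx

end IsBddSupersolution

end ZeroSet


/-! ### Cutoffs in time and truncations below a level. -/

section Ramp

/-- The piecewise linear function equal to `0` before `s` and to `1` after `t`. -/
noncomputable def ramp (s t x : ℝ) : ℝ := max 0 (min 1 ((t - s)⁻¹ * (x - s)))

lemma ramp_nonneg (s t x : ℝ) : 0 ≤ ramp s t x := le_max_left _ _

lemma ramp_le_one (s t x : ℝ) : ramp s t x ≤ 1 := max_le zero_le_one (min_le_left _ _)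

lemma ramp_eq_zero {s t x : ℝ} (hst : s < t) (hx : x ≤ s) : ramp s t x = 0 := by
  have h1 : 0 < (t - s)⁻¹ := inv_pos.2 (by linarith)
  exact max_eq_left ((min_le_right _ _).trans (mul_nonpos_of_nonneg_of_nonpos h1.le (by linarith)))

lemma ramp_eq_one {s t x : ℝ} (hst : s < t) (hx : t ≤ x) : ramp s t x = 1 := by
  have h1 : 0 < t - s := by linarith
  have h2 : 1 ≤ (t - s)⁻¹ * (x - s) := by
    rw [inv_mul_eq_div, one_le_div h1]; linarith
  rw [ramp, min_eq_left h2, max_eq_right zero_le_one]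

lemma ramp_eq_of_mem {s t x : ℝ} (hx : x ∈ Ioo s t) : ramp s t x = (t - s)⁻¹ * (x - s) := by
  have h1 : 0 < t - s := by linarith [hx.1, hx.2]
  have h2 : (t - s)⁻¹ * (x - s) ≤ 1 := by
    rw [inv_mul_eq_div, div_le_one h1]; linarith [hx.2]
  rw [ramp, min_eq_right h2, max_eq_right]
  exact mul_nonneg (inv_pos.2 h1).le (by linarith [hx.1])

lemma lipschitzWith_ramp {s t : ℝ} (hst : s < t) :
    LipschitzWith (Real.toNNReal (t - s)⁻¹) (ramp s t) := by
  have h1 : 0 < (t - s)⁻¹ := inv_pos.2 (by linarith)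
  have h : LipschitzWith (Real.toNNReal (t - s)⁻¹) (fun x => (t - s)⁻¹ * (x - s)) := by
    refine LipschitzWith.of_dist_le_mul fun x y => ?_
    rw [Real.coe_toNNReal _ h1.le, Real.dist_eq, Real.dist_eq, ← mul_sub, abs_mul,
      abs_of_pos h1, sub_sub_sub_cancel_right]
  exact (h.const_min 1).const_max 0

lemma hasDerivAt_ramp {s t x : ℝ} (hst : s < t) (hs : x ≠ s) (ht : x ≠ t) :
    HasDerivAt (ramp s t) ((Ioo s t).indicator (fun _ => (t - s)⁻¹) x) x := by
  rcases lt_or_gt_of_ne hs with h | h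
  · rw [indicator_of_notMem fun h' => absurd h'.1 (not_lt.2 h.le)]
    refine (hasDerivAt_const x (0 : ℝ)).congr_of_eventuallyEq ?_
    filter_upwards [Iio_mem_nhds h] with y hy using ramp_eq_zero hst (le_of_lt hy)
  rcases lt_or_gt_of_ne ht with h2 | h2
  · rw [indicator_of_mem (show x ∈ Ioo s t from ⟨h, h2⟩)]
    have : HasDerivAt (fun y => (t - s)⁻¹ * (y - s)) ((t - s)⁻¹) x := by
      simpa using ((hasDerivAt_id x).sub_const s).const_mul (t - s)⁻¹
    refine this.congr_of_eventuallyEq ?_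
    filter_upwards [Ioo_mem_nhds h h2] with y hy using ramp_eq_of_mem hy
  · rw [indicator_of_notMem fun h' => absurd h'.2 (not_lt.2 h2.le)]
    refine (hasDerivAt_const x (1 : ℝ)).congr_of_eventuallyEq ?_
    filter_upwards [Ioi_mem_nhds h2] with y hy using ramp_eq_one hst (le_of_lt hy)

/-- The trapezoidal function rising on `[s, s']` and falling on `[τ, τ']`. -/
noncomputable def trapezoid (s s' τ τ' x : ℝ) : ℝ := ramp s s' x - ramp τ τ' x

variable {s s' τ τ' : ℝ}

lemma trapezoid_nonneg (h1 : s < s') (h2 : s' ≤ τ) (h3 : τ < τ') (x : ℝ) :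
    0 ≤ trapezoid s s' τ τ' x := by
  rw [trapezoid, sub_nonneg]
  rcases le_total x τ with h | h
  · rw [ramp_eq_zero h3 h]; exact ramp_nonneg _ _ _
  · rw [ramp_eq_one h1 (h2.trans h)]; exact ramp_le_one _ _ _

lemma trapezoid_le_one (x : ℝ) : trapezoid s s' τ τ' x ≤ 1 := by
  rw [trapezoid]; linarith [ramp_le_one s s' x, ramp_nonneg τ τ' x]

lemma trapezoid_eq_one (h1 : s < s') (h3 : τ < τ') {x : ℝ} (hx : x ∈ Icc s' τ) :
    trapezoid s s' τ τ' x = 1 := by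
  rw [trapezoid, ramp_eq_one h1 hx.1, ramp_eq_zero h3 hx.2, sub_zero]

lemma trapezoid_eq_zero (h1 : s < s') (h2 : s' ≤ τ) (h3 : τ < τ') {x : ℝ}
    (hx : x ∉ Ioo s τ') : trapezoid s s' τ τ' x = 0 := by
  rw [trapezoid]
  rcases le_or_gt x s with h | h
  · rw [ramp_eq_zero h1 h, ramp_eq_zero h3 (by linarith), sub_zero]
  · have h' : τ' ≤ x := by
      by_contra hlt
      exact hx ⟨h, not_le.1 hlt⟩
    rw [ramp_eq_one h1 (by linarith), ramp_eq_one h3 h', sub_self]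

lemma tsupport_trapezoid_subset (h1 : s < s') (h2 : s' ≤ τ) (h3 : τ < τ') :
    tsupport (trapezoid s s' τ τ') ⊆ Icc s τ' := by
  refine closure_minimal (fun x hx => ?_) isClosed_Icc
  by_contra h
  exact hx (trapezoid_eq_zero h1 h2 h3 fun h' => h (Ioo_subset_Icc_self h'))

lemma exists_lipschitzWith_trapezoid (h1 : s < s') (h3 : τ < τ') :
    ∃ K : ℝ≥0, LipschitzWith K (trapezoid s s' τ τ') :=
  ⟨_, (lipschitzWith_ramp h1).sub (lipschitzWith_ramp h3)⟩

/-- Only the four corners are exceptional. The falling edge contributes the negative term that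
becomes a time average in the Caccioppoli inequality. -/
lemma ae_deriv_trapezoid (h1 : s < s') (h3 : τ < τ') :
    ∀ᵐ x : ℝ, deriv (trapezoid s s' τ τ') x =
      (Ioo s s').indicator (fun _ => (s' - s)⁻¹) x
        - (Ioo τ τ').indicator (fun _ => (τ' - τ)⁻¹) x := by
  have hne : ∀ c : ℝ, ∀ᵐ x : ℝ, x ≠ c := fun c => by
    simp [ae_iff]
  filter_upwards [hne s, hne s', hne τ, hne τ'] with x a1 a2 a3 a4
  exact ((hasDerivAt_ramp h1 a1 a2).sub (hasDerivAt_ramp h3 a3 a4)).deriv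

end Ramp

section Truncation

variable {α : Type*} [PseudoMetricSpace α] {U : α → ℝ}

/-- The truncation `(κ - U)₊`. -/
def truncBelow (κ : ℝ) (U : α → ℝ) (x : α) : ℝ := max 0 (κ - U x)

lemma truncBelow_nonneg (κ : ℝ) (x : α) : 0 ≤ truncBelow κ U x := le_max_left _ _

lemma truncBelow_le {κ : ℝ} (hκ : 0 ≤ κ) (hU : ∀ x, 0 ≤ U x) (x : α) :
    truncBelow κ U x ≤ κ := max_le hκ (by linarith [hU x])

lemma truncBelow_of_lt {κ : ℝ} {x : α} (h : U x < κ) : truncBelow κ U x = κ - U x :=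
  max_eq_right (by linarith)

lemma truncBelow_of_le {κ : ℝ} {x : α} (h : κ ≤ U x) : truncBelow κ U x = 0 :=
  max_eq_left (by linarith)

lemma lipschitzWith_truncBelow {K : ℝ≥0} (hK : LipschitzWith K U) (κ : ℝ) :
    LipschitzWith K (truncBelow κ U) := by
  have : LipschitzWith K (fun x => κ - U x) := by
    refine LipschitzWith.of_dist_le_mul fun x y => ?_
    rw [dist_sub_left]; exact hK.dist_le_mul x y
  exact this.const_max 0

lemma isBddLipschitz_truncBelow (hU : IsBddLipschitz U) (h0 : ∀ x, 0 ≤ U x) {κ : ℝ}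
    (hκ : 0 ≤ κ) : IsBddLipschitz (truncBelow κ U) := by
  obtain ⟨⟨K, hK⟩, -⟩ := hU
  exact ⟨⟨K, lipschitzWith_truncBelow hK κ⟩, κ, fun x => by
    rw [abs_of_nonneg (truncBelow_nonneg κ x)]; exact truncBelow_le hκ h0 x⟩

/-- This holds at every point. Where U ≥ κ the truncation attains its minimum 0, so `fderiv`
vanishes there, by convention if the derivative does not exist. -/
lemma fderiv_truncBelow {E : Type*} [NormedAddCommGroup E] [NormedSpace ℝ E] {U : E → ℝ}
    (hUc : Continuous U) (κ : ℝ) (z : E) :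
    fderiv ℝ (truncBelow κ U) z = -({z | U z < κ}.indicator (1 : E → ℝ) z) • fderiv ℝ U z := by
  by_cases hz : U z < κ
  · have h1 : truncBelow κ U =ᶠ[nhds z] fun y => κ - U y := by
      filter_upwards [(isOpen_lt hUc continuous_const).mem_nhds hz] with y hy
      exact truncBelow_of_lt hy
    rw [h1.fderiv_eq, fderiv_const_sub, indicator_of_mem (show z ∈ {z | U z < κ} from hz)]
    simp
  · rw [indicator_of_notMem (show z ∉ {z | U z < κ} from hz)]
    have : IsLocalMin (truncBelow κ U) z := Filter.Eventually.of_forall fun y => by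
      rw [truncBelow_of_le (not_lt.1 hz)]; exact truncBelow_nonneg κ y
    simp [this.fderiv_eq_zero]

/-- Together with the derivative of the truncation, this gives the relations f' = -h and h' = -c for
f(s) = (κ - s)₊²/2, with c the indicator of {s < κ}. -/
lemma fderiv_half_sq_truncBelow {E : Type*} [NormedAddCommGroup E] [NormedSpace ℝ E] {U : E → ℝ}
    (hUc : Continuous U) {κ : ℝ} {z : E} (hd : DifferentiableAt ℝ (truncBelow κ U) z) :
    fderiv ℝ (fun y => 2⁻¹ * (truncBelow κ U y * truncBelow κ U y)) z
      = -(truncBelow κ U z) • fderiv ℝ U z := by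
  have hm : DifferentiableAt ℝ (fun y => truncBelow κ U y * truncBelow κ U y) z := hd.mul hd
  rw [fderiv_const_mul hm, fderiv_fun_mul hd hd, fderiv_truncBelow hUc]
  by_cases hz : U z < κ
  · rw [indicator_of_mem (show z ∈ {z | U z < κ} from hz), ← add_smul, smul_smul, Pi.one_apply,
      neg_one_smul, smul_neg, neg_smul]
    congr 2; ring
  · rw [truncBelow_of_le (not_lt.1 hz)]; simp

end Truncation


/-! ### The Caccioppoli inequality. -/

namespace IsBddSupersolution

variable {n : ℕ} {a : SpaceTime n → Matrix (Fin n) (Fin n) ℝ}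
  {b : SpaceTime n → EuclideanSpace ℝ (Fin n)} {ν M T R : ℝ}
  {x₀ : EuclideanSpace ℝ (Fin n)} {U : SpaceTime n → ℝ}

/-- The part of a cylinder where `U < κ`. -/
def sublevel (U : SpaceTime n → ℝ) (κ : ℝ) (x₀ : EuclideanSpace ℝ (Fin n)) (r s t₀ : ℝ) :
    Set (SpaceTime n) :=
  {z | U z < κ} ∩ Metric.closedBall x₀ r ×ˢ Ioo s t₀

lemma measurableSet_sublevel (hU : Continuous U) (κ : ℝ) (x₀ : EuclideanSpace ℝ (Fin n))
    (r s t₀ : ℝ) : MeasurableSet (sublevel U κ x₀ r s t₀) :=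
  (isOpen_lt hU continuous_const).measurableSet.inter
    (measurableSet_closedBall.prod measurableSet_Ioo)

/-- The Caccioppoli inequality for the truncations `(κ - U)₊`. -/
theorem caccioppoli (h : IsBddSupersolution a b ν M
      (spaceTimeCylinder (Metric.ball x₀ R) T) U) (hn : 0 < n)
    {r r' s s' τ τ' t₀ κ D : ℝ} (hr : r' < r) (hrR : r < R) (hs : 0 < s) (hss : s < s')
    (hτ : s' ≤ τ) (hττ : τ < τ') (hτt : τ' < t₀) (ht₀ : t₀ ≤ T) (hκ : 0 ≤ κ) (hD : 1 ≤ D)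
    (hD1 : (r - r')⁻¹ ≤ D) (hD2 : (s' - s)⁻¹ ≤ D ^ 2) :
    ν / 2 * (∫ z in spaceTimeCylinder (Metric.ball x₀ R) T,
        {z | U z < κ}.indicator 1 z * (∑ i, spaceDeriv i U z ^ 2) *
          radialCutoff x₀ r' (r - r') z.1 ^ 2 * trapezoid s s' τ τ' z.2) +
      (τ' - τ)⁻¹ * (∫ z in spaceTimeCylinder (Metric.ball x₀ R) T,
        (Ioo τ τ').indicator 1 z.2 *
          (2⁻¹ * (truncBelow κ U z * truncBelow κ U z) * radialCutoff x₀ r' (r - r') z.1 ^ 2)) ≤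
    (2 * n ^ 3 * M ^ 2 / ν + 1 + n) * κ ^ 2 * D ^ 2 *
      ∫ z in spaceTimeCylinder (Metric.ball x₀ R) T,
        (sublevel U κ x₀ r s t₀).indicator 1 z * (1 + ‖b z‖) := by
  set Q := spaceTimeCylinder (Metric.ball x₀ R) T with hQ
  have hδ : 0 < r - r' := by linarith
  have hD0 : 0 ≤ D := by linarith
  have hν := h.ν_pos
  have hUc := h.isBddLipschitz.continuous
  obtain ⟨KU, hKU⟩ := h.isBddLipschitz.1
  set φ := radialCutoff x₀ r' (r - r') with hφ
  set ψ := trapezoid s s' τ τ' with hψ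
  set v := truncBelow κ U with hv
  have hvB : IsBddLipschitz v := isBddLipschitz_truncBelow h.isBddLipschitz h.nonneg hκ
  have hv0 : ∀ z, 0 ≤ v z := truncBelow_nonneg κ
  have hvκ : ∀ z, v z ≤ κ := truncBelow_le hκ h.nonneg
  have hWB : IsBddLipschitz (fun z => 2⁻¹ * (v z * v z)) :=
    IsBddLipschitz.mul ⟨⟨0, LipschitzWith.const _⟩, |2⁻¹|, fun _ => le_rfl⟩ (hvB.mul hvB)
  have hφL : LipschitzWith (Real.toNNReal D) φ :=
    (lipschitzWith_radialCutoff _ _ hδ).weaken (Real.toNNReal_le_toNNReal hD1)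
  obtain ⟨Kψ, hKψ⟩ := exists_lipschitzWith_trapezoid (s := s) (s' := s') (τ := τ) (τ' := τ')
    hss hττ
  have hψs := tsupport_trapezoid_subset hss hτ hττ
  have hψc : HasCompactSupport ψ := isCompact_Icc.of_isClosed_subset (isClosed_tsupport _) hψs
  have hφs : tsupport φ ⊆ Metric.closedBall x₀ r := by
    have := tsupport_radialCutoff_subset x₀ r' hδ
    rwa [add_sub_cancel] at this
  have hsupp : tsupport φ ×ˢ tsupport ψ ⊆ Q := by
    refine prod_mono (hφs.trans (Metric.closedBall_subset_ball hrR)) (hψs.trans fun t ht => ?_)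
    exact ⟨by linarith [ht.1], by linarith [ht.2]⟩
  have hSm : MeasurableSet {z | U z < κ} := (isOpen_lt hUc continuous_const).measurableSet
  -- On the support of φ one has h² = cP. The energy inequality puts no factor φ on P, so the
  -- indicator of the ball is needed to confine the right-hand side to the sublevel set.
  set P : SpaceTime n → ℝ := fun z => (Metric.closedBall x₀ r).indicator 1 z.1 * (v z * v z)
    with hP
  have hi0 : ∀ (S : Set (SpaceTime n)) z, 0 ≤ S.indicator (1 : SpaceTime n → ℝ) z :=
    fun S z => indicator_nonneg (fun _ _ => zero_le_one) z
  have hi1 : ∀ (S : Set (SpaceTime n)) z, S.indicator (1 : SpaceTime n → ℝ) z ≤ 1 :=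
    fun S z => indicator_le_self' (fun _ _ => zero_le_one) z
  have hj0 : ∀ x, 0 ≤ (Metric.closedBall x₀ r).indicator (1 : EuclideanSpace ℝ (Fin n) → ℝ) x :=
    fun x => indicator_nonneg (fun _ _ => zero_le_one) x
  have hj1 : ∀ x, (Metric.closedBall x₀ r).indicator (1 : EuclideanSpace ℝ (Fin n) → ℝ) x ≤ 1 :=
    fun x => indicator_le_self' (fun _ _ => zero_le_one) x
  have hvv0 : ∀ z, 0 ≤ v z * v z := fun z => mul_self_nonneg _
  have hvv : ∀ z, v z * v z ≤ κ ^ 2 := fun z => by nlinarith [hv0 z, hvκ z]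
  have hP0 : ∀ z, 0 ≤ P z := fun z => mul_nonneg (hj0 _) (hvv0 z)
  have hdiff := (lipschitzWith_truncBelow hKU κ).ae_differentiableAt
    (μ := (volume : Measure (SpaceTime n)))
  obtain ⟨hint, hen⟩ := h.energy_inequality hn (W := fun z => 2⁻¹ * (v z * v z)) (H := v)
    (c := {z | U z < κ}.indicator 1) (P := P) hWB hvB
    (fun z => mul_nonneg (by norm_num) (hvv0 z)) hv0
    (measurable_one.indicator hSm) (hi0 _) (Cc := 1) (hi1 _)
    (((measurable_one.indicator measurableSet_closedBall).comp measurable_fst).mul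
      (hvB.continuous.measurable.mul hvB.continuous.measurable)) hP0 (CP := 1 * κ ^ 2)
    (fun z => mul_le_mul (hj1 _) (hvv z) (hvv0 z) zero_le_one)
    (hdiff.mono fun z hz => fderiv_half_sq_truncBelow hUc hz)
    (ae_of_all _ fun z => fderiv_truncBelow hUc κ z)
    hφL (hasCompactSupport_radialCutoff _ _ hδ) (radialCutoff_nonneg _ _ _)
    hKψ hψc (trapezoid_nonneg hss hτ hττ) hsupp (fun z hz => by
      have hzr : z.1 ∈ Metric.closedBall x₀ r := hφs (subset_tsupport _ hz)
      simp only [hP, indicator_of_mem hzr, Pi.one_apply, one_mul]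
      by_cases hzκ : U z < κ
      · rw [indicator_of_mem (show z ∈ {z | U z < κ} from hzκ), Pi.one_apply, one_mul, sq]
      · have : v z = 0 := truncBelow_of_le (not_lt.1 hzκ)
        rw [this]; simp)
  -- the right-hand side
  set A := sublevel U κ x₀ r s t₀ with hA
  have hAm : MeasurableSet A := measurableSet_sublevel hUc κ x₀ r s t₀
  have hfin : IsFiniteMeasure (volume.restrict Q) := ⟨by simpa using h.measure_ne_top.lt_top⟩
  have hI1 : IntegrableOn (fun z => A.indicator 1 z * (1 + ‖b z‖)) Q := by
    have : IntegrableOn (fun z => 1 + ‖b z‖) Q := (integrable_const 1).add h.integrableOn.norm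
    refine (this.indicator hAm).congr (ae_of_all _ fun z => ?_)
    by_cases hz : z ∈ A <;> simp [hz]
  have hI2 : IntegrableOn (fun z : SpaceTime n => (Ioo τ τ').indicator 1 z.2 *
      (2⁻¹ * (v z * v z) * φ z.1 ^ 2)) Q := by
    refine h.integrableOn_of_bdd (C := κ ^ 2) ?_ (ae_of_all _ fun z => ?_)
    · refine (Measurable.mul ?_ ?_).aestronglyMeasurable
      · exact (measurable_one.indicator measurableSet_Ioo).comp measurable_snd
      · exact hWB.continuous.measurable.mul
          ((hφL.continuous.measurable.comp measurable_fst).pow_const 2)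
    · have h0 : 0 ≤ (Ioo τ τ').indicator (1 : ℝ → ℝ) z.2 :=
        indicator_nonneg (fun _ _ => zero_le_one) _
      have h1 : (Ioo τ τ').indicator (1 : ℝ → ℝ) z.2 ≤ 1 :=
        indicator_le_self' (fun _ _ => zero_le_one) _
      have h2 : 0 ≤ φ z.1 := radialCutoff_nonneg _ _ _ _
      have h3 : φ z.1 ≤ 1 := radialCutoff_le_one _ _ _ _
      have h4 : φ z.1 ^ 2 ≤ 1 := pow_le_one₀ h2 h3
      have h5 := hvv0 z
      rw [abs_of_nonneg (by positivity)]
      calc _ ≤ 1 * (2⁻¹ * κ ^ 2 * 1) := by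
            refine mul_le_mul h1 (mul_le_mul ?_ h4 (by positivity) (by positivity))
              (by positivity) zero_le_one
            exact mul_le_mul_of_nonneg_left (hvv z) (by norm_num)
        _ ≤ κ ^ 2 := by nlinarith [sq_nonneg κ]
  set Cst : ℝ := (2 * n ^ 3 * M ^ 2 / ν + 1 + n) * κ ^ 2 * D ^ 2 with hCst
  have hle : ∫ z in Q, (2 * n ^ 3 * M ^ 2 * (Real.toNNReal D : ℝ) ^ 2 / ν * P z * ψ z.2
        + 2⁻¹ * (v z * v z) * φ z.1 ^ 2 * deriv ψ z.2
        + 2 * n * (Real.toNNReal D : ℝ) * (2⁻¹ * (v z * v z) * ‖b z‖ * φ z.1 * ψ z.2)) ≤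
      ∫ z in Q, (Cst * (A.indicator 1 z * (1 + ‖b z‖)) - (τ' - τ)⁻¹ *
        ((Ioo τ τ').indicator 1 z.2 * (2⁻¹ * (v z * v z) * φ z.1 ^ 2))) := by
    refine integral_mono_ae hint ((hI1.const_mul _).sub (hI2.const_mul _))
      (ae_restrict_of_ae ?_)
    have hder : ∀ᵐ z : SpaceTime n, deriv ψ z.2 =
        (Ioo s s').indicator (fun _ => (s' - s)⁻¹) z.2
          - (Ioo τ τ').indicator (fun _ => (τ' - τ)⁻¹) z.2 :=
      (Measure.quasiMeasurePreserving_snd (μ := volume) (ν := volume)).ae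
        (ae_deriv_trapezoid hss hττ)
    filter_upwards [hder] with z hz
    rw [hz, Real.coe_toNNReal _ hD0]
    have e1 : (Ioo τ τ').indicator (fun _ => (τ' - τ)⁻¹) z.2
        = (τ' - τ)⁻¹ * (Ioo τ τ').indicator 1 z.2 := by
      by_cases hm : z.2 ∈ Ioo τ τ' <;> simp [hm]
    have hb0 := norm_nonneg (b z)
    have hφ0 : 0 ≤ φ z.1 := radialCutoff_nonneg _ _ _ _
    have hφ1 : φ z.1 ≤ 1 := radialCutoff_le_one _ _ _ _
    have hψ0 : 0 ≤ ψ z.2 := trapezoid_nonneg hss hτ hττ _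
    have hψ1 : ψ z.2 ≤ 1 := trapezoid_le_one _
    have hs0 : 0 ≤ (Ioo s s').indicator (fun _ => (s' - s)⁻¹) z.2 :=
      indicator_nonneg (fun _ _ => inv_nonneg.2 (by linarith)) _
    have hs1 : (Ioo s s').indicator (fun _ => (s' - s)⁻¹) z.2 ≤ D ^ 2 :=
      (indicator_le_self' (fun _ _ => inv_nonneg.2 (by linarith)) _).trans hD2
    have hvz := hvv z
    have hvz0 := hvv0 z
    have hφ2 : φ z.1 ^ 2 ≤ 1 := pow_le_one₀ hφ0 hφ1
    -- On the sublevel set (κ - U)₊ ≤ κ, and D ≤ D² lets one power of D serve all three terms. Off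
    -- it every term vanishes.
    have key : 2 * n ^ 3 * M ^ 2 * D ^ 2 / ν * P z * ψ z.2
        + 2⁻¹ * (v z * v z) * φ z.1 ^ 2 * (Ioo s s').indicator (fun _ => (s' - s)⁻¹) z.2
        + 2 * n * D * (2⁻¹ * (v z * v z) * ‖b z‖ * φ z.1 * ψ z.2) ≤
        Cst * (A.indicator 1 z * (1 + ‖b z‖)) := by
      by_cases hzA : z ∈ A
      · rw [indicator_of_mem hzA, Pi.one_apply, one_mul]
        have t1 : 2 * n ^ 3 * M ^ 2 * D ^ 2 / ν * P z * ψ z.2 ≤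
            2 * n ^ 3 * M ^ 2 * D ^ 2 / ν * κ ^ 2 := by
          rw [mul_assoc]
          refine mul_le_mul_of_nonneg_left ?_ (by positivity)
          calc P z * ψ z.2 ≤ (1 * κ ^ 2) * 1 :=
                mul_le_mul (mul_le_mul (hj1 _) hvz hvz0 zero_le_one) hψ1 hψ0 (by positivity)
            _ = κ ^ 2 := by ring
        have t2 : 2⁻¹ * (v z * v z) * φ z.1 ^ 2 *
            (Ioo s s').indicator (fun _ => (s' - s)⁻¹) z.2 ≤ κ ^ 2 * D ^ 2 := by
          calc _ ≤ (1 * κ ^ 2) * 1 * D ^ 2 := by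
                refine mul_le_mul (mul_le_mul (mul_le_mul (by norm_num) hvz hvz0 zero_le_one) hφ2
                  (by positivity) (by positivity)) hs1 hs0 (by positivity)
            _ = _ := by ring
        have t3 : 2 * n * D * (2⁻¹ * (v z * v z) * ‖b z‖ * φ z.1 * ψ z.2) ≤
            n * κ ^ 2 * D ^ 2 * ‖b z‖ := by
          calc _ = n * D * (v z * v z) * ‖b z‖ * (φ z.1 * ψ z.2) := by ring
            _ ≤ n * D * κ ^ 2 * ‖b z‖ * (1 * 1) := by
                refine mul_le_mul ?_ (mul_le_mul hφ1 hψ1 hψ0 zero_le_one) (by positivity)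
                  (by positivity)
                exact mul_le_mul_of_nonneg_right (mul_le_mul_of_nonneg_left hvz (by positivity))
                  hb0
            _ ≤ n * (D * D) * κ ^ 2 * ‖b z‖ * (1 * 1) := by
                have : D ≤ D * D := by nlinarith
                gcongr
            _ = _ := by ring
        have hp1 : 0 ≤ 2 * n ^ 3 * M ^ 2 / ν * κ ^ 2 * D ^ 2 * ‖b z‖ := by positivity
        have hp2 : 0 ≤ κ ^ 2 * D ^ 2 * ‖b z‖ := by positivity
        have hp3 : 0 ≤ n * κ ^ 2 * D ^ 2 := by positivity
        calc _ ≤ 2 * n ^ 3 * M ^ 2 * D ^ 2 / ν * κ ^ 2 + κ ^ 2 * D ^ 2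
              + n * κ ^ 2 * D ^ 2 * ‖b z‖ := add_le_add (add_le_add t1 t2) t3
          _ ≤ 2 * n ^ 3 * M ^ 2 * D ^ 2 / ν * κ ^ 2 + κ ^ 2 * D ^ 2
              + n * κ ^ 2 * D ^ 2 * ‖b z‖ + (2 * n ^ 3 * M ^ 2 / ν * κ ^ 2 * D ^ 2 * ‖b z‖
              + κ ^ 2 * D ^ 2 * ‖b z‖ + n * κ ^ 2 * D ^ 2) := by linarith
          _ = _ := by simp only [hCst]; ring
      · rw [indicator_of_notMem hzA, zero_mul, mul_zero]
        have hcases : v z = 0 ∨ φ z.1 = 0 ∧ P z = 0 ∨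
            ψ z.2 = 0 ∧ (Ioo s s').indicator (fun _ => (s' - s)⁻¹) z.2 = 0 := by
          by_cases c1 : U z < κ
          · right
            by_cases c2 : z.1 ∈ Metric.closedBall x₀ r
            · right
              have c3 : z.2 ∉ Ioo s t₀ := fun c3 => hzA ⟨c1, c2, c3⟩
              refine ⟨trapezoid_eq_zero hss hτ hττ fun c4 => c3 ⟨c4.1, by linarith [c4.2]⟩,
                indicator_of_notMem (fun c4 => c3 ⟨c4.1, by linarith [c4.2]⟩) _⟩
            · left
              refine ⟨image_eq_zero_of_notMem_tsupport fun c3 => c2 (hφs c3), ?_⟩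
              simp [hP, c2]
          · left
            exact truncBelow_of_le (not_lt.1 c1)
        rcases hcases with hc | ⟨hc1, hc2⟩ | ⟨hc1, hc2⟩
        · have : P z = 0 := by simp [hP, hc]
          rw [this, hc]; simp
        · rw [hc1, hc2]; simp
        · rw [hc1, hc2]; simp
    rw [e1]
    linarith
  have hfinal := hen.trans hle
  rw [integral_sub (hI1.const_mul _) (hI2.const_mul _), integral_const_mul,
    integral_const_mul] at hfinal
  linarith

end IsBddSupersolution


/-! ### Energy bounds for the localized truncations. -/

/-- A bound for the time averages of the slice integrals is a bound for the slice integrals. -/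
lemma integral_slice_le_of_average_le {n : ℕ} {F : SpaceTime n → ℝ} (hFc : Continuous F)
    (hF0 : ∀ z, 0 ≤ F z) {C : ℝ} (hFC : ∀ z, F z ≤ C) {S : Set (EuclideanSpace ℝ (Fin n))}
    (hS : IsCompact S) (hFS : ∀ z, z.1 ∉ S → F z = 0) {s t₀ E : ℝ}
    (h : ∀ τ τ', s < τ → τ < τ' → τ' < t₀ →
      (τ' - τ)⁻¹ * ∫ z in univ ×ˢ Ioo τ τ', F z ≤ E) :
    ∀ τ ∈ Ioo s t₀, ∫ x, F (x, τ) ≤ E := by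
  intro τ hτ
  by_contra! hlt
  set g : ℝ → ℝ := fun t => ∫ x, F (x, t) with hg
  -- Slice integrals are continuous in time. If one exceeded E at τ, all would exceed some E' > E on
  -- a short interval to the right of τ, and so would their average.
  have hgc : Continuous g := by
    refine continuous_of_dominated (bound := S.indicator fun _ => C) (fun t => ?_) (fun t => ?_)
      ?_ ?_
    · exact (hFc.comp (by fun_prop)).aestronglyMeasurable
    · refine ae_of_all _ fun x => ?_
      rw [Real.norm_eq_abs, abs_of_nonneg (hF0 _)]
      by_cases hx : x ∈ S
      · rw [indicator_of_mem hx]; exact hFC _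
      · rw [indicator_of_notMem hx, hFS _ hx]
    · rw [integrable_indicator_iff hS.measurableSet]
      exact integrableOn_const hS.measure_ne_top
    · exact ae_of_all _ fun x => hFc.comp (by fun_prop)
  obtain ⟨E', hE1, hE2⟩ := exists_between hlt
  obtain ⟨ε, hε, hεE⟩ := Metric.eventually_nhds_iff.1 (hgc.continuousAt.eventually_const_lt hE2)
  obtain ⟨τ', h1, h2⟩ := exists_between (lt_min (lt_add_of_pos_right τ hε) hτ.2)
  have h3 := h τ τ' hτ.1 h1 (h2.trans_le (min_le_right _ _))
  have hd : 0 < τ' - τ := by linarith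
  have hint : IntegrableOn F (univ ×ˢ Ioo τ τ') := by
    have hfin : volume (S ×ˢ Ioo τ τ' : Set (SpaceTime n)) < ⊤ := by
      rw [Measure.volume_eq_prod, Measure.prod_prod]
      exact ENNReal.mul_lt_top hS.measure_lt_top measure_Ioo_lt_top
    have h0 : IntegrableOn F (S ×ˢ Ioo τ τ') :=
      Measure.integrableOn_of_bounded (M := C) hfin.ne hFc.aestronglyMeasurable
        (ae_of_all _ fun z => by rw [Real.norm_eq_abs, abs_of_nonneg (hF0 _)]; exact hFC z)
    refine h0.of_forall_sdiff_eq_zero (MeasurableSet.univ.prod measurableSet_Ioo) fun z hz => ?_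
    exact hFS z fun hz1 => hz.2 ⟨hz1, hz.1.2⟩
  have hm : (volume : Measure (SpaceTime n)).restrict (univ ×ˢ Ioo τ τ')
      = volume.prod (volume.restrict (Ioo τ τ')) := by
    rw [Measure.volume_eq_prod, ← Measure.prod_restrict, Measure.restrict_univ]
  have heq : ∫ z in univ ×ˢ Ioo τ τ', F z = ∫ t in Ioo τ τ', g t := by
    rw [IntegrableOn, hm] at hint
    rw [hm]
    exact integral_prod_symm _ hint
  have hge : E' * (τ' - τ) ≤ ∫ t in Ioo τ τ', g t := by
    have := setIntegral_ge_of_const_le_real (μ := volume) (s := Ioo τ τ') (f := g) (c := E')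
      measurableSet_Ioo measure_Ioo_lt_top.ne (fun t ht => (hεE (by
        rw [Real.dist_eq, abs_of_pos (by linarith [ht.1])]
        linarith [ht.2, h2.trans_le (min_le_left _ _)])).le)
      ((hgc.integrableOn_Icc (a := τ) (b := τ')).mono_set Ioo_subset_Icc_self)
    rwa [Real.volume_real_Ioo_of_le h1.le] at this
  rw [heq] at h3
  have : E' ≤ (τ' - τ)⁻¹ * ∫ t in Ioo τ τ', g t := by
    rw [inv_mul_eq_div, le_div_iff₀ hd]; exact hge
  linarith

namespace IsBddSupersolution

variable {n : ℕ} {a : SpaceTime n → Matrix (Fin n) (Fin n) ℝ}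
  {b : SpaceTime n → EuclideanSpace ℝ (Fin n)} {ν M T R : ℝ}
  {x₀ : EuclideanSpace ℝ (Fin n)} {U : SpaceTime n → ℝ}

lemma sublevel_subset {κ r s t₀ : ℝ} (hrR : r < R) (hs : 0 ≤ s) (ht₀ : t₀ ≤ T) :
    sublevel U κ x₀ r s t₀ ⊆ spaceTimeCylinder (Metric.ball x₀ R) T := fun _ hz =>
  ⟨Metric.closedBall_subset_ball hrR hz.2.1, Ioo_subset_Ioo hs ht₀ hz.2.2⟩

/-- Passage from the real integral in the Caccioppoli inequality to the `ℝ≥0∞`-valued weight in the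
embedding. It also shows that the weighted measure of A is finite. -/
lemma integral_indicator_weight (h : IsBddSupersolution a b ν M
      (spaceTimeCylinder (Metric.ball x₀ R) T) U) {w : SpaceTime n → ℝ≥0∞}
    (hw : ∀ᵐ z ∂(volume.restrict (spaceTimeCylinder (Metric.ball x₀ R) T)), w z = 1 + ‖b z‖ₑ)
    {A : Set (SpaceTime n)} (hA : MeasurableSet A)
    (hAQ : A ⊆ spaceTimeCylinder (Metric.ball x₀ R) T) :
    ∫⁻ z in A, w z = ENNReal.ofReal (∫ z in spaceTimeCylinder (Metric.ball x₀ R) T,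
      A.indicator 1 z * (1 + ‖b z‖)) := by
  have hfin : IsFiniteMeasure (volume.restrict (spaceTimeCylinder (Metric.ball x₀ R) T)) :=
    ⟨by simpa using h.measure_ne_top.lt_top⟩
  have hi : IntegrableOn (fun z => 1 + ‖b z‖) (spaceTimeCylinder (Metric.ball x₀ R) T) :=
    (integrable_const 1).add h.integrableOn.norm
  have e1 : ∀ z, A.indicator (1 : SpaceTime n → ℝ) z * (1 + ‖b z‖)
      = A.indicator (fun z => 1 + ‖b z‖) z := fun z => by
    by_cases hz : z ∈ A <;> simp [hz]
  simp_rw [e1]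
  rw [integral_indicator hA, Measure.restrict_restrict hA, inter_eq_left.2 hAQ,
    ofReal_integral_eq_lintegral_ofReal (hi.mono_set hAQ) (ae_of_all _ fun z => by positivity)]
  refine lintegral_congr_ae ((ae_restrict_of_ae_restrict_of_subset hAQ hw).mono fun z hz => ?_)
  beta_reduce
  rw [hz, ENNReal.ofReal_add zero_le_one (norm_nonneg _), ENNReal.ofReal_one, ofReal_norm]

/-- The localized truncation. -/
noncomputable def localTrunc (U : SpaceTime n → ℝ) (κ : ℝ) (x₀ : EuclideanSpace ℝ (Fin n))
    (r' r : ℝ) (z : SpaceTime n) : ℝ :=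
  truncBelow κ U z * radialCutoff x₀ r' (r - r') z.1

lemma isBddLipschitz_localTrunc (hU : IsBddLipschitz U) (h0 : ∀ z, 0 ≤ U z) {κ r r' : ℝ}
    (hκ : 0 ≤ κ) (hr : r' < r) : IsBddLipschitz (localTrunc U κ x₀ r' r) :=
  (isBddLipschitz_truncBelow hU h0 hκ).mul
    ((IsBddLipschitz.of_hasCompactSupport (lipschitzWith_radialCutoff x₀ r' (sub_pos.2 hr))
      (hasCompactSupport_radialCutoff x₀ r' (sub_pos.2 hr))).comp LipschitzWith.prod_fst)

lemma localTrunc_eq_zero {κ r r' : ℝ} (hr : r' < r) {z : SpaceTime n}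
    (hz : z.1 ∉ Metric.closedBall x₀ r) : localTrunc U κ x₀ r' r z = 0 := by
  rw [localTrunc, radialCutoff_eq_zero (sub_pos.2 hr) (by rwa [add_sub_cancel]), mul_zero]

lemma localTrunc_nonneg {κ r r' : ℝ} (z : SpaceTime n) : 0 ≤ localTrunc U κ x₀ r' r z :=
  mul_nonneg (truncBelow_nonneg _ _) (radialCutoff_nonneg _ _ _ _)

lemma localTrunc_le (h0 : ∀ z, 0 ≤ U z) {κ r r' : ℝ} (hκ : 0 ≤ κ) (z : SpaceTime n) :
    localTrunc U κ x₀ r' r z ≤ κ := by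
  calc _ ≤ κ * 1 := mul_le_mul (truncBelow_le hκ h0 z) (radialCutoff_le_one _ _ _ _)
        (radialCutoff_nonneg _ _ _ _) hκ
    _ = κ := mul_one κ

/-- The product rule and (A + B)² ≤ 2A² + 2B². The term with the derivative of the cutoff vanishes
where U ≥ κ and off the ball of radius r. -/
lemma spaceDeriv_localTrunc_sq_le (hU : IsBddLipschitz U) (h0 : ∀ z, 0 ≤ U z) {κ r r' D : ℝ}
    (hκ : 0 ≤ κ) (hr : r' < r) (hD : (r - r')⁻¹ ≤ D) :
    ∀ᵐ z : SpaceTime n, ∀ i, spaceDeriv i (localTrunc U κ x₀ r' r) z ^ 2 ≤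
      2 * ({z | U z < κ}.indicator 1 z * spaceDeriv i U z ^ 2 *
        radialCutoff x₀ r' (r - r') z.1 ^ 2) +
      2 * (κ ^ 2 * D ^ 2 * (({z | U z < κ} ∩ Metric.closedBall x₀ r ×ˢ univ).indicator 1 z)) := by
  have hδ : 0 < r - r' := sub_pos.2 hr
  have hD0 : 0 ≤ D := (inv_pos.2 hδ).le.trans hD
  obtain ⟨K, hK⟩ := hU.1
  have hφ : LipschitzWith (Real.toNNReal D)
      (fun z : SpaceTime n => radialCutoff x₀ r' (r - r') z.1) := by
    have := ((lipschitzWith_radialCutoff x₀ r' hδ).weaken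
      (Real.toNNReal_le_toNNReal hD)).comp (LipschitzWith.prod_fst (β := ℝ))
    rwa [mul_one] at this
  filter_upwards [(lipschitzWith_truncBelow hK κ).ae_differentiableAt (μ := volume),
    hφ.ae_differentiableAt (μ := volume)] with z hz1 hz2 i
  have e1 : spaceDeriv i (localTrunc U κ x₀ r' r) z =
      truncBelow κ U z * spaceDeriv i (fun y : SpaceTime n => radialCutoff x₀ r' (r - r') y.1) z +
      radialCutoff x₀ r' (r - r') z.1 * spaceDeriv i (truncBelow κ U) z :=
    spaceDeriv_mul hz1 hz2 i
  have e2 : spaceDeriv i (truncBelow κ U) z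
      = -({z | U z < κ}.indicator (1 : SpaceTime n → ℝ) z) * spaceDeriv i U z := by
    simp [spaceDeriv, fderiv_truncBelow hK.continuous]
  have e3 := abs_spaceDeriv_le hφ i z
  rw [Real.coe_toNNReal _ hD0] at e3
  set dφ := spaceDeriv i (fun y : SpaceTime n => radialCutoff x₀ r' (r - r') y.1) z with hdφ
  have e4 : dφ ^ 2 ≤ D ^ 2 := sq_le_sq' (abs_le.1 e3).1 (abs_le.1 e3).2
  have hv0 : 0 ≤ truncBelow κ U z := truncBelow_nonneg _ _
  have hv1 : truncBelow κ U z ≤ κ := truncBelow_le hκ h0 z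
  have e5 : truncBelow κ U z ^ 2 * dφ ^ 2 ≤ κ ^ 2 * D ^ 2 *
      (({z | U z < κ} ∩ Metric.closedBall x₀ r ×ˢ univ).indicator 1 z) := by
    by_cases hzA : z ∈ ({z | U z < κ} ∩ Metric.closedBall x₀ r ×ˢ univ : Set (SpaceTime n))
    · rw [indicator_of_mem hzA, Pi.one_apply, mul_one]
      exact mul_le_mul (pow_le_pow_left₀ hv0 hv1 2) e4 (sq_nonneg _) (sq_nonneg _)
    · rw [indicator_of_notMem hzA, mul_zero]
      by_cases hzκ : U z < κ
      · have hz3 : z ∉ (Metric.closedBall x₀ r ×ˢ univ : Set (SpaceTime n)) :=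
          fun h' => hzA ⟨hzκ, h'⟩
        have hts : tsupport (fun y : SpaceTime n => radialCutoff x₀ r' (r - r') y.1) ⊆
            Metric.closedBall x₀ r ×ˢ univ := by
          refine closure_minimal (fun y hy => ⟨?_, mem_univ _⟩)
            (Metric.isClosed_closedBall.prod isClosed_univ)
          by_contra hy'
          exact hy (radialCutoff_eq_zero hδ (by rwa [add_sub_cancel]))
        have : dφ = 0 := spaceDeriv_eq_zero_of_notMem hts hz3 i
        rw [this]; simp
      · rw [truncBelow_of_le (not_lt.1 hzκ)]; simp
  have e6 : ({z | U z < κ}.indicator (1 : SpaceTime n → ℝ) z) ^ 2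
      = {z | U z < κ}.indicator 1 z := by
    by_cases hzκ : z ∈ {z | U z < κ} <;> simp [hzκ]
  have e7 : (radialCutoff x₀ r' (r - r') z.1 * spaceDeriv i (truncBelow κ U) z) ^ 2 =
      {z | U z < κ}.indicator 1 z * spaceDeriv i U z ^ 2 *
        radialCutoff x₀ r' (r - r') z.1 ^ 2 := by
    rw [e2]
    calc _ = ({z | U z < κ}.indicator (1 : SpaceTime n → ℝ) z) ^ 2 * spaceDeriv i U z ^ 2 *
          radialCutoff x₀ r' (r - r') z.1 ^ 2 := by ring
      _ = _ := by rw [e6]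
  rw [e1, ← e7]
  nlinarith [sq_nonneg (truncBelow κ U z * dφ -
    radialCutoff x₀ r' (r - r') z.1 * spaceDeriv i (truncBelow κ U) z)]

end IsBddSupersolution


namespace IsBddSupersolution

variable {n : ℕ} {a : SpaceTime n → Matrix (Fin n) (Fin n) ℝ}
  {b : SpaceTime n → EuclideanSpace ℝ (Fin n)} {ν M T R : ℝ}
  {x₀ : EuclideanSpace ℝ (Fin n)} {U : SpaceTime n → ℝ}

lemma ofReal_const_mul_le {C c I : ℝ} (hC : 0 ≤ C) (hc : 0 ≤ c) {D : ℝ} (hCD : C ≤ D) :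
    ENNReal.ofReal (C * c * I) ≤ (Real.toNNReal D : ℝ≥0∞) * ENNReal.ofReal c *
      ENNReal.ofReal I := by
  rw [ENNReal.ofReal_mul (mul_nonneg hC hc), ENNReal.ofReal_mul hC]
  gcongr
  exact ENNReal.ofReal_le_ofReal hCD

/-- The energy bounds for the localized truncations. -/
theorem exists_energy_bound_localTrunc (h : IsBddSupersolution a b ν M
      (spaceTimeCylinder (Metric.ball x₀ R) T) U) (hn : 0 < n) {w : SpaceTime n → ℝ≥0∞}
    (hw : ∀ᵐ z ∂(volume.restrict (spaceTimeCylinder (Metric.ball x₀ R) T)), w z = 1 + ‖b z‖ₑ) :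
    ∃ C : ℝ≥0, ∀ {r r' s s' t₀ κ D : ℝ}, r' < r → r < R → 0 < s → s < s' → t₀ ≤ T →
      0 ≤ κ → 1 ≤ D → (r - r')⁻¹ ≤ D → (s' - s)⁻¹ ≤ D ^ 2 →
      (∀ τ ∈ Ioo s' t₀, ∫⁻ x, ‖localTrunc U κ x₀ r' r (x, τ)‖ₑ ^ (2 : ℝ) ≤
        C * ENNReal.ofReal (κ ^ 2 * D ^ 2) * ∫⁻ z in sublevel U κ x₀ r s t₀, w z) ∧
      ∫⁻ z in univ ×ˢ Ioo s' t₀, gradSq (localTrunc U κ x₀ r' r) z ≤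
        C * ENNReal.ofReal (κ ^ 2 * D ^ 2) * ∫⁻ z in sublevel U κ x₀ r s t₀, w z := by
  set C₀ : ℝ := 2 * n ^ 3 * M ^ 2 / ν + 1 + n with hC₀
  have hν := h.ν_pos
  have hC₀0 : 0 ≤ C₀ := by positivity
  -- The summands pay, in order, for the slice bound (the 2 undoes the 1/2 in f), for the gradient
  -- of the truncation and for the gradient of the cutoff.
  refine ⟨Real.toNNReal (2 * C₀ + 2 * (2 / ν * C₀) + 2 * n), ?_⟩
  intro r r' s s' t₀ κ D hr hrR hs hss ht₀ hκ hD hD1 hD2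
  set Q := spaceTimeCylinder (Metric.ball x₀ R) T with hQ
  have hUc := h.isBddLipschitz.continuous
  obtain ⟨K, hK⟩ := h.isBddLipschitz.1
  set A := sublevel U κ x₀ r s t₀ with hA
  have hAm : MeasurableSet A := measurableSet_sublevel hUc κ x₀ r s t₀
  have hAQ : A ⊆ Q := sublevel_subset hrR hs.le ht₀
  set u := localTrunc U κ x₀ r' r with hu
  have huB : IsBddLipschitz u := isBddLipschitz_localTrunc h.isBddLipschitz h.nonneg hκ hr
  have hu0 : ∀ z, 0 ≤ u z := localTrunc_nonneg
  have huκ : ∀ z, u z ≤ κ := localTrunc_le h.nonneg hκ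
  have huz : ∀ z, z.1 ∉ Metric.closedBall x₀ r → u z = 0 := fun z => localTrunc_eq_zero hr
  set φ := radialCutoff x₀ r' (r - r') with hφ
  set I := ∫ z in Q, A.indicator 1 z * (1 + ‖b z‖) with hI
  have hW : ∫⁻ z in A, w z = ENNReal.ofReal I := h.integral_indicator_weight hw hAm hAQ
  have hI0 : 0 ≤ I := integral_nonneg fun z =>
    mul_nonneg (indicator_nonneg (fun _ _ => zero_le_one) z) (by positivity)
  rw [hW]
  have hi0 : ∀ (S : Set (SpaceTime n)) z, 0 ≤ S.indicator (1 : SpaceTime n → ℝ) z :=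
    fun S z => indicator_nonneg (fun _ _ => zero_le_one) z
  have hi1 : ∀ (S : Set (SpaceTime n)) z, S.indicator (1 : SpaceTime n → ℝ) z ≤ 1 :=
    fun S z => indicator_le_self' (fun _ _ => zero_le_one) z
  set G : SpaceTime n → ℝ := fun z => {z | U z < κ}.indicator 1 z *
    (∑ i, spaceDeriv i U z ^ 2) * φ z.1 ^ 2 with hG
  have hG0 : ∀ z, 0 ≤ G z := fun z =>
    mul_nonneg (mul_nonneg (hi0 _ _) (Finset.sum_nonneg fun i _ => sq_nonneg _)) (sq_nonneg _)
  have hGz : ∀ z, z.1 ∉ Metric.closedBall x₀ r → G z = 0 := fun z hz => by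
    have : φ z.1 = 0 := radialCutoff_eq_zero (sub_pos.2 hr) (by rwa [add_sub_cancel])
    simp [hG, this]
  have hφm : Measurable φ := (lipschitzWith_radialCutoff x₀ r' (sub_pos.2 hr)).continuous.measurable
  have hGm : Measurable G :=
    ((measurable_one.indicator (isOpen_lt hUc continuous_const).measurableSet).mul
      (Finset.measurable_sum _ fun i _ => (measurable_spaceDeriv i U).pow_const 2)).mul
      ((hφm.comp measurable_fst).pow_const 2)
  have hcac : ∀ τ τ', s' ≤ τ → τ < τ' → τ' < t₀ →
      ν / 2 * (∫ z in Q, G z * trapezoid s s' τ τ' z.2) +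
      (τ' - τ)⁻¹ * (2⁻¹ * ∫ z in univ ×ˢ Ioo τ τ', u z ^ 2) ≤ C₀ * (κ ^ 2 * D ^ 2) * I := by
    intro τ τ' h1 h2 h3
    have hc := h.caccioppoli hn hr hrR hs hss h1 h2 h3 ht₀ hκ hD hD1 hD2
    have hsub : (Metric.closedBall x₀ r ×ˢ Ioo τ τ' : Set (SpaceTime n)) ⊆ Q :=
      prod_mono (Metric.closedBall_subset_ball hrR) (Ioo_subset_Ioo (by linarith) (by linarith))
    have e : ∫ z in Q, (Ioo τ τ').indicator 1 z.2 *
        (2⁻¹ * (truncBelow κ U z * truncBelow κ U z) * radialCutoff x₀ r' (r - r') z.1 ^ 2)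
        = 2⁻¹ * ∫ z in univ ×ˢ Ioo τ τ', u z ^ 2 := by
      rw [setIntegral_eq_of_eq_zero_off (S' := Metric.closedBall x₀ r ×ˢ Ioo τ τ')
        h.isOpen.measurableSet hsub, setIntegral_eq_of_subset_of_forall_sdiff_eq_zero
        (MeasurableSet.univ.prod measurableSet_Ioo)
        (prod_mono (subset_univ (Metric.closedBall x₀ r)) (subset_refl (Ioo τ τ')))
        (fun z hz => ?_), ← integral_const_mul]
      · refine setIntegral_congr_fun (measurableSet_closedBall.prod measurableSet_Ioo)
          fun z hz => ?_
        simp only [indicator_of_mem hz.2, Pi.one_apply, hu, localTrunc]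
        ring
      · rw [huz z fun hz1 => hz.2 ⟨hz1, hz.1.2⟩]; simp
      · intro z hz
        by_cases hz1 : z.1 ∈ Metric.closedBall x₀ r
        · rw [indicator_of_notMem fun hz2 => hz ⟨hz1, hz2⟩, zero_mul]
        · rw [radialCutoff_eq_zero (sub_pos.2 hr) (by rwa [add_sub_cancel])]; simp
    rw [e] at hc
    refine hc.trans (le_of_eq ?_)
    rw [hC₀, hI, hA]; ring
  have hB0 : 0 ≤ C₀ * (κ ^ 2 * D ^ 2) * I := by positivity
  constructor
  · intro τ hτ
    have h1 := integral_slice_le_of_average_le (F := fun z => u z ^ 2) (C := κ ^ 2)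
      (huB.continuous.pow 2) (fun z => sq_nonneg _) (fun z => pow_le_pow_left₀ (hu0 z) (huκ z) 2)
      (isCompact_closedBall x₀ r) (fun z hz => by rw [huz z hz]; simp)
      (s := s') (t₀ := t₀) (E := 2 * (C₀ * (κ ^ 2 * D ^ 2) * I)) (fun σ σ' g1 g2 g3 => by
        have := hcac σ σ' g1.le g2 g3
        have h0 : 0 ≤ ∫ z in Q, G z * trapezoid s s' σ σ' z.2 := integral_nonneg fun z =>
          mul_nonneg (hG0 z) (trapezoid_nonneg hss g1.le g2 _)
        have h0' : 0 ≤ ν / 2 * ∫ z in Q, G z * trapezoid s s' σ σ' z.2 := by positivity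
        linarith) τ hτ
    have h2 : ∫⁻ x, ‖u (x, τ)‖ₑ ^ (2 : ℝ) = ENNReal.ofReal (∫ x, u (x, τ) ^ 2) := by
      rw [ofReal_integral_eq_lintegral_ofReal ?_ (ae_of_all _ fun x => sq_nonneg _)]
      · refine lintegral_congr fun x => ?_
        rw [ENNReal.rpow_two, Real.enorm_of_nonneg (hu0 _), ENNReal.ofReal_pow (hu0 _)]
      · refine Continuous.integrable_of_hasCompactSupport ?_ ?_
        · exact (huB.continuous.comp (by fun_prop)).pow 2
        · refine HasCompactSupport.intro (isCompact_closedBall x₀ r) fun x hx => ?_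
          rw [huz (x, τ) hx]; simp
    rw [h2]
    refine (ENNReal.ofReal_le_ofReal h1).trans ?_
    rw [← mul_assoc, ← mul_assoc]
    refine ofReal_const_mul_le (by positivity) (by positivity) ?_
    have : 0 ≤ 2 * (2 / ν * C₀) + 2 * n := by positivity
    linarith
  · have hGle : ∫⁻ z in univ ×ˢ Ioo s' t₀, ENNReal.ofReal (G z) ≤
        ENNReal.ofReal (2 / ν * (C₀ * (κ ^ 2 * D ^ 2) * I)) := by
      -- The time cutoff must fall before t₀. Times σ k increasing to t₀ and monotone convergence
      -- recover the whole interval.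
      obtain ⟨σ, hσm, hσt, hσ⟩ := exists_seq_strictMono_tendsto t₀
      have hun : (univ ×ˢ Ioo s' t₀ : Set (SpaceTime n)) = ⋃ k, univ ×ˢ Ioo s' (σ k) := by
        ext z
        simp only [mem_prod, mem_univ, true_and, mem_iUnion, mem_Ioo]
        constructor
        · rintro ⟨g1, g2⟩
          obtain ⟨k, hk⟩ := (hσ.eventually_const_lt g2).exists
          exact ⟨k, g1, hk⟩
        · rintro ⟨k, g1, g2⟩
          exact ⟨g1, g2.trans (hσt k)⟩
      have hdir : Directed (· ⊆ ·) fun k => (univ ×ˢ Ioo s' (σ k) : Set (SpaceTime n)) :=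
        Monotone.directed_le fun i j hij =>
          prod_mono subset_rfl (Ioo_subset_Ioo_right (hσm.monotone hij))
      rw [hun, setLIntegral_iUnion_of_directed _ hdir]
      refine iSup_le fun k => ?_
      rcases le_or_gt (σ k) s' with hk | hk
      · rw [Ioo_eq_empty (not_lt.2 hk), prod_empty]; simp
      obtain ⟨τ', g1, g2⟩ := exists_between (hσt k)
      have hc := hcac (σ k) τ' hk.le g1 g2
      have hψ0 := trapezoid_nonneg hss hk.le g1
      have h0 : 0 ≤ (τ' - σ k)⁻¹ * (2⁻¹ * ∫ z in univ ×ˢ Ioo (σ k) τ', u z ^ 2) := by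
        have : 0 < τ' - σ k := by linarith
        have h0' : 0 ≤ ∫ z in univ ×ˢ Ioo (σ k) τ', u z ^ 2 := integral_nonneg fun z => sq_nonneg _
        positivity
      have hX : ∫ z in Q, G z * trapezoid s s' (σ k) τ' z.2 ≤
          2 / ν * (C₀ * (κ ^ 2 * D ^ 2) * I) := by
        rw [div_mul_eq_mul_div, le_div_iff₀ hν]
        linarith
      have hint : IntegrableOn (fun z => G z * trapezoid s s' (σ k) τ' z.2) Q := by
        refine h.integrableOn_of_bdd (C := 1 * (∑ _i : Fin n, (K : ℝ) ^ 2) * 1 * 1) ?_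
          (ae_of_all _ fun z => ?_)
        · obtain ⟨Kψ, hKψ⟩ := exists_lipschitzWith_trapezoid (s := s) (s' := s') (τ := σ k)
            (τ' := τ') hss g1
          exact (hGm.mul (hKψ.continuous.measurable.comp measurable_snd)).aestronglyMeasurable
        · rw [abs_of_nonneg (mul_nonneg (hG0 z) (hψ0 _))]
          refine mul_le_mul (mul_le_mul (mul_le_mul (hi1 _ _) ?_
            (Finset.sum_nonneg fun i _ => sq_nonneg _) zero_le_one) ?_ (sq_nonneg _) ?_)
            (trapezoid_le_one _) (hψ0 _) ?_
          · refine Finset.sum_le_sum fun i _ => ?_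
            have := abs_le.1 (abs_spaceDeriv_le hK i z)
            exact sq_le_sq' this.1 this.2
          · exact pow_le_one₀ (radialCutoff_nonneg _ _ _ _) (radialCutoff_le_one _ _ _ _)
          · positivity
          · positivity
      calc ∫⁻ z in univ ×ˢ Ioo s' (σ k), ENNReal.ofReal (G z)
          ≤ ∫⁻ z in Q, ENNReal.ofReal (G z * trapezoid s s' (σ k) τ' z.2) := by
            rw [← lintegral_indicator (MeasurableSet.univ.prod measurableSet_Ioo),
              ← lintegral_indicator h.isOpen.measurableSet]
            refine lintegral_mono fun z => ?_
            by_cases hz : z ∈ (univ ×ˢ Ioo s' (σ k) : Set (SpaceTime n))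
            · rw [indicator_of_mem hz]
              by_cases hz1 : z.1 ∈ Metric.closedBall x₀ r
              · have hzQ : z ∈ Q := ⟨Metric.closedBall_subset_ball hrR hz1,
                  by linarith [hz.2.1], by linarith [hz.2.2]⟩
                rw [indicator_of_mem hzQ, trapezoid_eq_one hss g1 (Ioo_subset_Icc_self hz.2),
                  mul_one]
              · rw [hGz z hz1]; simp
            · rw [indicator_of_notMem hz]; exact zero_le
        _ = ENNReal.ofReal (∫ z in Q, G z * trapezoid s s' (σ k) τ' z.2) :=
            (ofReal_integral_eq_lintegral_ofReal hint
              (ae_of_all _ fun z => mul_nonneg (hG0 z) (hψ0 _))).symm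
        _ ≤ _ := ENNReal.ofReal_le_ofReal hX
    set A' : Set (SpaceTime n) := {z | U z < κ} ∩ Metric.closedBall x₀ r ×ˢ univ with hA'
    have hA'm : MeasurableSet A' := (isOpen_lt hUc continuous_const).measurableSet.inter
      (measurableSet_closedBall.prod MeasurableSet.univ)
    have hcD : 0 ≤ κ ^ 2 * D ^ 2 := by positivity
    have hpt : ∀ᵐ z ∂(volume.restrict (univ ×ˢ Ioo s' t₀ : Set (SpaceTime n))), gradSq u z ≤
        2 * ENNReal.ofReal (G z) +
          ENNReal.ofReal (2 * n * (κ ^ 2 * D ^ 2)) * A'.indicator 1 z := by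
      refine ae_restrict_of_ae ?_
      filter_upwards [spaceDeriv_localTrunc_sq_le (x₀ := x₀) h.isBddLipschitz h.nonneg hκ hr hD1]
        with z hz
      have e1 : gradSq u z = ENNReal.ofReal (∑ i, spaceDeriv i u z ^ 2) := by
        rw [ENNReal.ofReal_sum_of_nonneg fun i _ => sq_nonneg _]
        refine Finset.sum_congr rfl fun i _ => ?_
        rw [ENNReal.rpow_two, ← ofReal_norm, ← ENNReal.ofReal_pow (norm_nonneg _),
          Real.norm_eq_abs, sq_abs]
      have e2 : (A'.indicator (1 : SpaceTime n → ℝ≥0∞) z)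
          = ENNReal.ofReal (A'.indicator (1 : SpaceTime n → ℝ) z) := by
        by_cases hzA : z ∈ A' <;> simp [hzA]
      have e3 : (2 : ℝ≥0∞) = ENNReal.ofReal 2 := by simp
      rw [e1, e2, e3, ← ENNReal.ofReal_mul zero_le_two, ← ENNReal.ofReal_mul (by positivity),
        ← ENNReal.ofReal_add (mul_nonneg zero_le_two (hG0 z))
          (mul_nonneg (by positivity) (hi0 _ _))]
      refine ENNReal.ofReal_le_ofReal ((Finset.sum_le_sum fun i _ => hz i).trans (le_of_eq ?_))
      rw [Finset.sum_add_distrib, Finset.sum_const, Finset.card_univ, Fintype.card_fin,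
        nsmul_eq_mul, ← Finset.mul_sum, ← Finset.sum_mul, ← Finset.mul_sum]
      simp only [hG, hA']
      ring
    -- Here the summand 1 of the weight is used: w ≥ 1 bounds Lebesgue measure by the weighted
    -- measure.
    have hAvol : ∫⁻ z in univ ×ˢ Ioo s' t₀, A'.indicator 1 z ≤ ENNReal.ofReal I := by
      rw [← hW, lintegral_indicator_one hA'm, Measure.restrict_apply hA'm]
      calc volume (A' ∩ univ ×ˢ Ioo s' t₀) ≤ volume A := measure_mono fun z hz =>
            ⟨hz.1.1, hz.1.2.1, by linarith [hz.2.2.1], hz.2.2.2⟩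
        _ = ∫⁻ z in A, 1 := by simp
        _ ≤ ∫⁻ z in A, w z := lintegral_mono_ae
            ((ae_restrict_of_ae_restrict_of_subset hAQ hw).mono fun z hz => by rw [hz]; simp)
    calc ∫⁻ z in univ ×ˢ Ioo s' t₀, gradSq u z
        ≤ ∫⁻ z in univ ×ˢ Ioo s' t₀, (2 * ENNReal.ofReal (G z) +
          ENNReal.ofReal (2 * n * (κ ^ 2 * D ^ 2)) * A'.indicator 1 z) := lintegral_mono_ae hpt
      _ = 2 * (∫⁻ z in univ ×ˢ Ioo s' t₀, ENNReal.ofReal (G z)) +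
          ENNReal.ofReal (2 * n * (κ ^ 2 * D ^ 2)) *
            ∫⁻ z in univ ×ˢ Ioo s' t₀, A'.indicator 1 z := by
          rw [lintegral_add_left (hGm.ennreal_ofReal.const_mul _),
            lintegral_const_mul _ hGm.ennreal_ofReal,
            lintegral_const_mul _ (measurable_one.indicator hA'm)]
      _ ≤ ENNReal.ofReal 2 * ENNReal.ofReal (2 / ν * (C₀ * (κ ^ 2 * D ^ 2) * I)) +
          ENNReal.ofReal (2 * n * (κ ^ 2 * D ^ 2)) * ENNReal.ofReal I := by
          refine add_le_add (mul_le_mul' (by simp) hGle) (by gcongr)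
      _ = ENNReal.ofReal ((2 * (2 / ν * C₀) + 2 * n) * (κ ^ 2 * D ^ 2) * I) := by
          rw [← ENNReal.ofReal_mul zero_le_two, ← ENNReal.ofReal_mul (by positivity),
            ← ENNReal.ofReal_add (by positivity) (by positivity)]
          congr 1; ring
      _ ≤ _ := ofReal_const_mul_le (by positivity) hcD (by linarith)

end IsBddSupersolution


/-! ### The De Giorgi iteration. -/

/-- Fast geometric convergence. -/
lemma exists_tendsto_zero_of_superlinear {p : ℝ} (hp : 1 < p) (C : ℝ≥0) {A : ℝ≥0} (hA : 1 < A) :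
    ∃ δ : ℝ≥0, 0 < δ ∧ ∀ Y : ℕ → ℝ≥0∞, Y 0 ≤ δ → (∀ j, Y (j + 1) ≤ C * A ^ j * Y j ^ p) →
      Filter.Tendsto Y Filter.atTop (nhds 0) := by
  have hp1 : 0 < p - 1 := by linarith
  have hA0 : 0 < A := zero_lt_one.trans hA
  set q : ℝ≥0 := A⁻¹ ^ (1 / (p - 1)) with hq
  have hq0 : 0 < q := NNReal.rpow_pos (inv_pos.2 hA0)
  have hq1 : q < 1 := NNReal.rpow_lt_one (inv_lt_one_of_one_lt₀ hA) (by positivity)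
  have hqp : q ^ (p - 1) = A⁻¹ := by
    rw [hq, ← NNReal.rpow_mul, one_div_mul_cancel hp1.ne', NNReal.rpow_one]
  set δ : ℝ≥0 := (q / (C + 1)) ^ (1 / (p - 1)) with hδ
  have hδ0 : 0 < δ := NNReal.rpow_pos (by positivity)
  have hδp : C * δ ^ (p - 1) ≤ q := by
    rw [hδ, ← NNReal.rpow_mul, one_div_mul_cancel hp1.ne', NNReal.rpow_one, mul_div_assoc',
      div_le_iff₀ (by positivity), mul_comm C q]
    gcongr; exact le_add_of_nonneg_right zero_le_one
  refine ⟨δ, hδ0, fun Y h0 hY => ?_⟩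
  -- The bound reproduces itself: q^(p - 1) = A⁻¹ absorbs the growth A^j, and Cδ^(p - 1) ≤ q
  -- supplies the next factor q.
  have key : ∀ j, Y j ≤ ((δ * q ^ j : ℝ≥0) : ℝ≥0∞) := by
    intro j
    induction j with
    | zero => simpa using h0
    | succ j ih =>
      refine (hY j).trans ?_
      have e : C * A ^ j * (δ * q ^ j) ^ p ≤ δ * q ^ (j + 1) := by
        have hne : δ * q ^ j ≠ 0 := by positivity
        have hcomm : ∀ x : ℝ≥0, (x ^ j) ^ (p - 1) = (x ^ (p - 1)) ^ j := fun x => by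
          rw [← NNReal.rpow_natCast, ← NNReal.rpow_natCast, ← NNReal.rpow_mul, ← NNReal.rpow_mul,
            mul_comm]
        have e1 : (δ * q ^ j) ^ p = (δ * q ^ j) * (δ ^ (p - 1) * (A⁻¹) ^ j) := by
          conv_lhs => rw [show p = 1 + (p - 1) by ring]
          rw [NNReal.rpow_add hne, NNReal.rpow_one, NNReal.mul_rpow, ← hqp, hcomm]
        have e2 : A ^ j * A⁻¹ ^ j = 1 := by
          rw [← mul_pow, mul_inv_cancel₀ hA0.ne', one_pow]
        calc C * A ^ j * (δ * q ^ j) ^ p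
            = (C * δ ^ (p - 1)) * (δ * q ^ j) * (A ^ j * A⁻¹ ^ j) := by rw [e1]; ring
          _ ≤ q * (δ * q ^ j) * 1 := by rw [e2]; gcongr
          _ = _ := by ring
      calc (C : ℝ≥0∞) * A ^ j * Y j ^ p
          ≤ C * A ^ j * ((δ * q ^ j : ℝ≥0) : ℝ≥0∞) ^ p := by gcongr
        _ = ((C * A ^ j * (δ * q ^ j) ^ p : ℝ≥0) : ℝ≥0∞) := by
            rw [← ENNReal.coe_rpow_of_nonneg _ (by linarith : 0 ≤ p)]; push_cast; rfl
        _ ≤ _ := ENNReal.coe_le_coe.2 e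
  refine tendsto_of_tendsto_of_tendsto_of_le_of_le tendsto_const_nhds ?_ (fun _ => zero_le) key
  have : Filter.Tendsto (fun j : ℕ => δ * q ^ j) Filter.atTop (nhds 0) := by
    simpa using (NNReal.tendsto_pow_atTop_nhds_zero_of_lt_one hq1).const_mul δ
  simpa using ENNReal.tendsto_coe.2 this

namespace IsBddSupersolution

variable {n : ℕ} {a : SpaceTime n → Matrix (Fin n) (Fin n) ℝ}
  {b : SpaceTime n → EuclideanSpace ℝ (Fin n)} {ν M T R : ℝ}
  {x₀ : EuclideanSpace ℝ (Fin n)} {U : SpaceTime n → ℝ}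

/-- One step of the De Giorgi iteration. -/
theorem exists_setLIntegral_sublevel_le (h : IsBddSupersolution a b ν M
      (spaceTimeCylinder (Metric.ball x₀ R) T) U) (hn : 2 ≤ n) {q l : ℝ} (hq : 1 < q)
    (hl : 1 < l) (hql : n / q + 2 / l < 2) {w : SpaceTime n → ℝ≥0∞} (hwm : Measurable w)
    (hw : ∀ᵐ z ∂(volume.restrict (spaceTimeCylinder (Metric.ball x₀ R) T)), w z = 1 + ‖b z‖ₑ)
    (hwf : ∫⁻ t in Ioo 0 T, (∫⁻ x in Metric.closedBall x₀ R, w (x, t) ^ q) ^ (l / q) < ⊤) :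
    ∃ p : ℝ, 1 < p ∧ ∃ C : ℝ≥0, ∀ {r r' s s' t₀ k κ κ' D ε : ℝ}, r' < r → r < R → 0 < s →
      s < s' → t₀ ≤ T → 0 ≤ κ → κ ≤ k → 0 < k → 0 < ε → κ' + ε * k ≤ κ → 1 ≤ D →
      (r - r')⁻¹ ≤ D → (s' - s)⁻¹ ≤ D ^ 2 →
      ∫⁻ z in sublevel U κ' x₀ r' s' t₀, w z ≤
        C * ENNReal.ofReal (D / ε) ^ (2 * p) * (∫⁻ z in sublevel U κ x₀ r s t₀, w z) ^ p := by
  obtain ⟨p, hp, C₂, hC₂⟩ := exists_parabolic_embedding hn x₀ R T hq hl hql hwm hwf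
  obtain ⟨C₁, hC₁⟩ := h.exists_energy_bound_localTrunc (by omega) hw
  refine ⟨p, hp, C₂ * C₁ ^ p, ?_⟩
  intro r r' s s' t₀ k κ κ' D ε hr hrR hs hss ht₀ hκ hκk hk hε hκ' hD hD1 hD2
  obtain ⟨hE1, hE2⟩ := hC₁ hr hrR hs hss ht₀ hκ hD hD1 hD2
  have hUc := h.isBddLipschitz.continuous
  have hp0 : 0 ≤ p := by linarith
  have hemb := hC₂ _ (isBddLipschitz_localTrunc (x₀ := x₀) h.isBddLipschitz h.nonneg hκ hr).1
    (fun z hz => localTrunc_eq_zero hr fun hz' =>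
      hz (Metric.closedBall_subset_closedBall hrR.le hz')) s' t₀ (by linarith) ht₀ _ hE1 hE2
  set W := ∫⁻ z in sublevel U κ x₀ r s t₀, w z with hW
  set A' := sublevel U κ' x₀ r' s' t₀ with hA'
  have hA'm : MeasurableSet A' := measurableSet_sublevel hUc κ' x₀ r' s' t₀
  have hεk : 0 < ε * k := by positivity
  -- Chebyshev's inequality: on the smaller sublevel set the cutoff is 1 and κ - U ≥ κ - κ' ≥ εk.
  have hlow : ENNReal.ofReal (ε * k) ^ (2 * p) * ∫⁻ z in A', w z ≤
      C₂ * (C₁ * ENNReal.ofReal (κ ^ 2 * D ^ 2) * W) ^ p := by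
    refine le_trans ?_ hemb
    rw [← lintegral_const_mul _ hwm]
    refine (setLIntegral_mono' hA'm fun z hz => ?_).trans (lintegral_mono_set fun z hz =>
      ⟨Metric.closedBall_subset_closedBall (hr.trans hrR).le hz.2.1, hz.2.2⟩)
    rw [mul_comm]
    gcongr
    have e : localTrunc U κ x₀ r' r z = κ - U z := by
      rw [localTrunc, radialCutoff_eq_one (sub_pos.2 hr) hz.2.1, mul_one,
        truncBelow_of_lt (by have : U z < κ' := hz.1; linarith)]
    have hzκ : U z < κ' := hz.1
    rw [← ofReal_norm]
    refine ENNReal.ofReal_le_ofReal ?_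
    rw [e]
    exact (by linarith : ε * k ≤ κ - U z).trans (le_abs_self _)
  have hup : (C₂ : ℝ≥0∞) * (C₁ * ENNReal.ofReal (κ ^ 2 * D ^ 2) * W) ^ p ≤
      ENNReal.ofReal (ε * k) ^ (2 * p) *
        (((C₂ * C₁ ^ p : ℝ≥0) : ℝ≥0∞) * ENNReal.ofReal (D / ε) ^ (2 * p) * W ^ p) := by
    -- As κ ≤ k, the powers of k cancel and the estimate does not depend on the level. The smallness
    -- threshold of the iteration can thus be fixed before k is chosen.
    have e1 : ENNReal.ofReal (κ ^ 2 * D ^ 2) ≤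
        (ENNReal.ofReal (ε * k) * ENNReal.ofReal (D / ε)) ^ (2 : ℝ) := by
      rw [← ENNReal.ofReal_mul hεk.le, ENNReal.rpow_two,
        ← ENNReal.ofReal_pow (by positivity)]
      refine ENNReal.ofReal_le_ofReal ?_
      rw [show ε * k * (D / ε) = k * D by field_simp, mul_pow]
      gcongr
    calc (C₂ : ℝ≥0∞) * (C₁ * ENNReal.ofReal (κ ^ 2 * D ^ 2) * W) ^ p
        ≤ C₂ * (C₁ * (ENNReal.ofReal (ε * k) * ENNReal.ofReal (D / ε)) ^ (2 : ℝ) * W) ^ p := by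
          gcongr
      _ = _ := by
          rw [ENNReal.mul_rpow_of_nonneg _ _ hp0, ENNReal.mul_rpow_of_nonneg _ _ hp0,
            ← ENNReal.rpow_mul, ENNReal.mul_rpow_of_nonneg _ _ (by positivity), ENNReal.coe_mul,
            ENNReal.coe_rpow_of_nonneg _ hp0]
          ring
  have hne0 : ENNReal.ofReal (ε * k) ^ (2 * p) ≠ 0 := by
    refine (ENNReal.rpow_pos ?_ ENNReal.ofReal_ne_top).ne'
    exact ENNReal.ofReal_pos.2 hεk
  have hnet : ENNReal.ofReal (ε * k) ^ (2 * p) ≠ ⊤ :=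
    ENNReal.rpow_ne_top_of_nonneg (by positivity) ENNReal.ofReal_ne_top
  exact (ENNReal.mul_le_mul_iff_right hne0 hnet).1 (hlow.trans hup)

/-- If `U` does not vanish almost everywhere in a cylinder then it does not vanish at the centre
of its upper base. -/
theorem ne_zero_of_ae_ne_zero (h : IsBddSupersolution a b ν M
      (spaceTimeCylinder (Metric.ball x₀ R) T) U) (hn : 2 ≤ n) (hR : 0 < R) {q l : ℝ} (hq : 1 < q)
    (hl : 1 < l) (hql : n / q + 2 / l < 2) {w : SpaceTime n → ℝ≥0∞} (hwm : Measurable w)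
    (hw : ∀ᵐ z ∂(volume.restrict (spaceTimeCylinder (Metric.ball x₀ R) T)), w z = 1 + ‖b z‖ₑ)
    (hwf : ∫⁻ t in Ioo 0 T, (∫⁻ x in Metric.closedBall x₀ R, w (x, t) ^ q) ^ (l / q) < ⊤)
    {t₁ t₀ : ℝ} (ht₁ : 0 < t₁) (ht : t₁ < t₀) (ht₀ : t₀ ≤ T)
    (hne : ∀ᵐ z ∂(volume.restrict (Metric.closedBall x₀ (R / 2) ×ˢ Ioo t₁ t₀)), U z ≠ 0) :
    U (x₀, t₀) ≠ 0 := by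
  have hUc := h.isBddLipschitz.continuous
  obtain ⟨p, hp, C, hC⟩ := h.exists_setLIntegral_sublevel_le hn hq hl hql hwm hw hwf
  set d : ℝ := (t₀ - t₁) / 2 with hd
  have hd0 : 0 < d := by rw [hd]; linarith
  set D₀ : ℝ := max 1 (max (8 / R) (2 / d)) with hD₀
  have hD1 : 1 ≤ D₀ := le_max_left _ _
  have hD2 : 8 / R ≤ D₀ := (le_max_left _ _).trans (le_max_right _ _)
  have hD3 : 2 / d ≤ D₀ := (le_max_right _ _).trans (le_max_right _ _)
  have h2p : 0 < 2 * p := by linarith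
  set A : ℝ≥0 := (4 : ℝ≥0) ^ (2 * p) with hA
  have hA1 : 1 < A := NNReal.one_lt_rpow (by norm_num) h2p
  obtain ⟨δ, hδ, hconv⟩ := exists_tendsto_zero_of_superlinear hp
    (C * Real.toNNReal (4 * D₀) ^ (2 * p)) hA1
  -- smallness of the initial sublevel set
  set S : ℕ → Set (SpaceTime n) := fun m => sublevel U (1 / ((m : ℝ) + 1)) x₀ (R / 2) t₁ t₀ with hS
  have hSm : ∀ m, MeasurableSet (S m) := fun m => measurableSet_sublevel hUc _ _ _ _ _
  have hanti : Antitone S := fun i j hij z hz =>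
    ⟨lt_of_lt_of_le (show U z < _ from hz.1) (Nat.one_div_le_one_div hij), hz.2⟩
  -- The sets S m decrease to a part of {U = 0} that is null by assumption, and their weighted
  -- measure is finite. Continuity from above replaces a quantitative estimate.
  have hSt : Filter.Tendsto (fun m => ∫⁻ z in S m, w z) Filter.atTop (nhds 0) := by
    have h1 := tendsto_measure_iInter_atTop (μ := volume.withDensity w) (s := S)
      (fun m => (hSm m).nullMeasurableSet) hanti ⟨0, by
        rw [withDensity_apply _ (hSm 0), h.integral_indicator_weight hw (hSm 0)
          (sublevel_subset (by linarith) ht₁.le ht₀)]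
        exact ENNReal.ofReal_ne_top⟩
    have h2 : (volume.withDensity w) (⋂ m, S m) = 0 := by
      refine withDensity_absolutelyContinuous _ _ ?_
      rw [ae_restrict_iff' (measurableSet_closedBall.prod measurableSet_Ioo)] at hne
      refine measure_mono_null (fun z hz => ?_) (ae_iff.1 hne)
      simp only [mem_ofPred_eq, Classical.not_imp, not_not]
      rw [mem_iInter] at hz
      refine ⟨(hz 0).2, le_antisymm ?_ (h.nonneg z)⟩
      refine ge_of_tendsto' tendsto_one_div_add_atTop_nhds_zero_nat fun m => ?_
      exact le_of_lt (hz m).1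
    rw [h2] at h1
    exact h1.congr fun m => withDensity_apply _ (hSm m)
  obtain ⟨m, hm⟩ := (hSt.eventually_lt_const (ENNReal.coe_pos.2 hδ)).exists
  set k : ℝ := 1 / ((m : ℝ) + 1) with hk
  have hk0 : 0 < k := by positivity
  -- With θ j = 2^(-j), level, radius and starting time move from k, R/2, t₁ towards k/2, R/4, t₁ +
  -- d, while the upper end t₀ stays fixed.
  set θ : ℕ → ℝ := fun j => (1 / 2) ^ j with hθ
  have hθ0 : ∀ j, 0 < θ j := fun j => by positivity
  have hθ1 : ∀ j, θ j ≤ 1 := fun j => pow_le_one₀ (by norm_num) (by norm_num)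
  have hθs : ∀ j, θ (j + 1) = θ j / 2 := fun j => by simp only [hθ, pow_succ]; ring
  have hθi : ∀ j, (θ j)⁻¹ = 2 ^ j := fun j => by simp [hθ]
  set Y : ℕ → ℝ≥0∞ := fun j => ∫⁻ z in sublevel U (k / 2 * (1 + θ j)) x₀ (R / 4 * (1 + θ j))
    (t₁ + d * (1 - θ j)) t₀, w z with hY
  have hY0 : Y 0 ≤ δ := by
    have e : Y 0 = ∫⁻ z in S m, w z := by
      have e1 : θ 0 = 1 := by simp [hθ]
      simp only [hY, hS, e1]
      have e2 : ∀ x : ℝ, x / 2 * (1 + 1) = x := fun x => by ring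
      rw [e2, show R / 4 * (1 + 1) = R / 2 by ring,
        show t₁ + d * (1 - 1) = t₁ by ring]
    rw [e]; exact hm.le
  have hYt := hconv Y hY0 fun j => by
    have hθj := hθ0 j
    have hθj1 := hθ1 j
    have h2j : (1 : ℝ) ≤ 2 ^ j := one_le_pow₀ (by norm_num)
    have hDj : 1 ≤ D₀ * 2 ^ j := one_le_mul_of_one_le_of_one_le hD1 h2j
    -- The gaps are θ j · k/4 in level, θ j · R/8 in radius and θ j · d/2 in time. This dictates ε
    -- and the quantities 8/R and 2/d in D₀. The ratio D/ε = 4 D₀ 4^j explains A = 4^(2p).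
    have hstep := hC (r := R / 4 * (1 + θ j)) (r' := R / 4 * (1 + θ (j + 1)))
      (s := t₁ + d * (1 - θ j)) (s' := t₁ + d * (1 - θ (j + 1))) (t₀ := t₀) (k := k)
      (κ := k / 2 * (1 + θ j)) (κ' := k / 2 * (1 + θ (j + 1))) (D := D₀ * 2 ^ j) (ε := θ j / 4)
      (by rw [hθs]; nlinarith) (by nlinarith) (by nlinarith) (by rw [hθs]; nlinarith) ht₀
      (by positivity) (by nlinarith) hk0 (by positivity) (by rw [hθs]; nlinarith) hDj
      (by
        rw [hθs, show R / 4 * (1 + θ j) - R / 4 * (1 + θ j / 2) = R / 8 * θ j by ring, mul_inv,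
          hθi, inv_div]
        gcongr)
      (by
        rw [hθs, show t₁ + d * (1 - θ j / 2) - (t₁ + d * (1 - θ j)) = d / 2 * θ j by ring, mul_inv,
          hθi, inv_div]
        have : 2 / d * 2 ^ j ≤ D₀ * 2 ^ j := by gcongr
        nlinarith)
    refine hstep.trans (le_of_eq ?_)
    have e1 : D₀ * 2 ^ j / (θ j / 4) = 4 * D₀ * 4 ^ j := by
      rw [div_eq_mul_inv, inv_div, div_eq_mul_inv, hθi, show (4 : ℝ) ^ j = 2 ^ j * 2 ^ j by
        rw [← mul_pow]; norm_num]
      ring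
    have e2 : ENNReal.ofReal (4 * D₀ * 4 ^ j) ^ (2 * p) =
        (Real.toNNReal (4 * D₀) : ℝ≥0∞) ^ (2 * p) * (A : ℝ≥0∞) ^ j := by
      rw [ENNReal.ofReal_mul (by positivity), ENNReal.mul_rpow_of_nonneg _ _ h2p.le,
        ENNReal.ofReal_pow (by norm_num), hA, ENNReal.coe_rpow_of_nonneg _ h2p.le,
        ← ENNReal.rpow_natCast, ← ENNReal.rpow_natCast, ← ENNReal.rpow_mul, ← ENNReal.rpow_mul,
        mul_comm (j : ℝ)]
      congr 2
      simp
    have e3 : ((Real.toNNReal (4 * D₀) ^ (2 * p) : ℝ≥0) : ℝ≥0∞)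
        = (Real.toNNReal (4 * D₀) : ℝ≥0∞) ^ (2 * p) := ENNReal.coe_rpow_of_nonneg _ h2p.le
    rw [e1, e2, ENNReal.coe_mul, e3, ← mul_assoc]
  -- the limiting sublevel set is null, hence empty
  set O : Set (SpaceTime n) := {z | U z < k / 2} ∩ Metric.ball x₀ (R / 4) ×ˢ Ioo (t₁ + d) t₀
    with hO
  have hOo : IsOpen O :=
    (isOpen_lt hUc continuous_const).inter (Metric.isOpen_ball.prod isOpen_Ioo)
  have hOQ : O ⊆ spaceTimeCylinder (Metric.ball x₀ R) T := fun z hz =>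
    ⟨Metric.ball_subset_ball (by linarith) hz.2.1, by linarith [hz.2.2.1],
      by linarith [hz.2.2.2]⟩
  have hO0 : volume O = 0 := by
    have hle : ∀ j, volume O ≤ Y j := fun j => by
      have hθj := hθ0 j
      calc volume O = ∫⁻ z in O, 1 := by simp
        _ ≤ ∫⁻ z in O, w z := lintegral_mono_ae
            ((ae_restrict_of_ae_restrict_of_subset hOQ hw).mono fun z hz => by rw [hz]; simp)
        _ ≤ Y j := lintegral_mono_set fun z hz => by
            refine ⟨lt_of_lt_of_le (show U z < _ from hz.1) (by nlinarith),
              Metric.ball_subset_closedBall (Metric.ball_subset_ball (by nlinarith) hz.2.1), ?_,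
              hz.2.2.2⟩
            have := hz.2.2.1
            nlinarith
    exact le_antisymm (ge_of_tendsto' hYt hle) zero_le
  have hOe : O = ∅ := (hOo.measure_eq_zero_iff volume).1 hO0
  have hge : ∀ t ∈ Ioo (t₁ + d) t₀, k / 2 ≤ U (x₀, t) := fun t ht' => by
    by_contra! hlt
    have : (x₀, t) ∈ O := ⟨hlt, Metric.mem_ball_self (by linarith), ht'⟩
    rw [hOe] at this
    exact this
  -- The iteration gives U ≥ k/2 only for times before t₀; continuity carries the bound to t₀, which
  -- may be T.
  have hlim : Filter.Tendsto (fun t => U (x₀, t)) (nhdsWithin t₀ (Iio t₀)) (nhds (U (x₀, t₀))) :=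
    (Continuous.tendsto (by fun_prop) t₀).mono_left nhdsWithin_le_nhds
  have : k / 2 ≤ U (x₀, t₀) := by
    refine ge_of_tendsto hlim ?_
    filter_upwards [Ioo_mem_nhdsLT (show t₁ + d < t₀ by rw [hd]; linarith)] with t ht'
      using hge t ht'
  linarith

end IsBddSupersolution


/-! ### Localization, propagation of the minimum and the conclusion. -/

lemma spaceTimeCylinder_mono {n : ℕ} {B Ω : Set (EuclideanSpace ℝ (Fin n))} (h : B ⊆ Ω) (T : ℝ) :
    spaceTimeCylinder B T ⊆ spaceTimeCylinder Ω T := prod_mono h subset_rfl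

lemma mem_closure_spaceTimeCylinder {n : ℕ} {Ω : Set (EuclideanSpace ℝ (Fin n))} {T : ℝ}
    (hT : 0 < T) {x : EuclideanSpace ℝ (Fin n)} (hx : x ∈ Ω) {t : ℝ} (ht : t ∈ Icc 0 T) :
    ((x, t) : SpaceTime n) ∈ closure (spaceTimeCylinder Ω T) := by
  rw [spaceTimeCylinder, closure_prod_eq, closure_Ioo hT.ne]
  exact ⟨subset_closure hx, ht⟩

/-- The points of the boundary of the cylinder off the closure of its parabolic boundary lie in
the interior of the upper base. -/
lemma mem_upper_base {n : ℕ} {Ω : Set (EuclideanSpace ℝ (Fin n))} (hΩ : IsOpen Ω) {T : ℝ}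
    (hT : 0 < T) {z : SpaceTime n}
    (hz : z ∈ frontier (spaceTimeCylinder Ω T) \ closure (parabolicBoundary Ω T)) :
    z.1 ∈ Ω ∧ z.2 = T := by
  obtain ⟨h1, h2⟩ := hz
  have hcl : z ∈ closure Ω ×ˢ Icc 0 T := by
    have := frontier_subset_closure h1
    rwa [spaceTimeCylinder, closure_prod_eq, closure_Ioo hT.ne] at this
  rw [parabolicBoundary, closure_union, mem_union, not_or] at h2
  have hz1 : z.1 ∈ Ω := by
    by_contra hzΩ
    refine h2.1 ?_
    rw [lateralSurface, closure_prod_eq, closure_Ioo hT.ne]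
    exact ⟨subset_closure ⟨hcl.1, by rwa [hΩ.interior_eq]⟩, hcl.2⟩
  refine ⟨hz1, ?_⟩
  have hz0 : z.2 ≠ 0 := fun h0 => h2.2 (subset_closure ⟨hcl.1, h0⟩)
  by_contra hzT
  have hzQ : z ∈ spaceTimeCylinder Ω T :=
    ⟨hz1, lt_of_le_of_ne hcl.2.1 (Ne.symm hz0), lt_of_le_of_ne hcl.2.2 hzT⟩
  exact h1.2 (mem_interior_iff_mem_nhds.2 ((hΩ.prod isOpen_Ioo).mem_nhds hzQ))

section Localization

variable {n : ℕ} {Ω : Set (EuclideanSpace ℝ (Fin n))} {T : ℝ}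
  {a : SpaceTime n → Matrix (Fin n) (Fin n) ℝ} {ν : ℝ}
  {b : SpaceTime n → EuclideanSpace ℝ (Fin n)} {V : SpaceTime n → ℝ} {m : ℝ}
  {x₀ : EuclideanSpace ℝ (Fin n)} {R : ℝ}

/-- A Lipschitz supersolution bounded below agrees near an interior cylinder, up to a constant,
with a bounded nonnegative one. -/
theorem exists_isBddSupersolution (hΩ : IsOpen Ω) (hT : 0 < T)
    (ha : IsUniformlyElliptic a ν (spaceTimeCylinder Ω T))
    (hdiv : DivNonpos b (spaceTimeCylinder Ω T))
    (hV : IsLipschitzSupersolution a b (spaceTimeCylinder Ω T) V)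
    (hm : ∀ z ∈ closure (spaceTimeCylinder Ω T), m ≤ V z)
    (hB : Metric.closedBall x₀ R ⊆ Ω)
    (hb : IntegrableOn b (spaceTimeCylinder (Metric.ball x₀ R) T)) :
    ∃ M U, IsBddSupersolution a b ν M (spaceTimeCylinder (Metric.ball x₀ R) T) U ∧
      ∀ z ∈ Metric.closedBall x₀ R ×ˢ Icc 0 T, U z = V z - m := by
  obtain ⟨⟨K, hK⟩, hsup⟩ := hV
  obtain ⟨g, hg, hgV⟩ := hK.extend_real
  obtain ⟨M, hM⟩ := ha.bounded
  have hBΩ : Metric.ball x₀ R ⊆ Ω := Metric.ball_subset_closedBall.trans hB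
  set Q := spaceTimeCylinder Ω T with hQ
  set Q' := spaceTimeCylinder (Metric.ball x₀ R) T with hQ'
  have hsub : Q' ⊆ Q := spaceTimeCylinder_mono hBΩ T
  have hQo : IsOpen Q := hΩ.prod isOpen_Ioo
  have hQ'o : IsOpen Q' := Metric.isOpen_ball.prod isOpen_Ioo
  have hcomp : IsCompact (Metric.closedBall x₀ R ×ˢ Icc 0 T) :=
    (isCompact_closedBall x₀ R).prod isCompact_Icc
  obtain ⟨N, hN⟩ := hcomp.exists_bound_of_continuousOn hg.continuous.continuousOn
  -- V is controlled only on the closure of Q, so a Lipschitz extension g is used. The two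
  -- truncations make U bounded and nonnegative everywhere and are inactive on the closed cylinder
  -- over the ball.
  set U : SpaceTime n → ℝ := fun z => min (|N| + |m|) (max 0 (g z - m)) with hU
  have hN0 : 0 ≤ |N| + |m| := by positivity
  have hU0 : ∀ z, 0 ≤ U z := fun z => le_min hN0 (le_max_left _ _)
  have hUV : ∀ z ∈ Metric.closedBall x₀ R ×ˢ Icc 0 T, U z = V z - m := fun z hz => by
    have hzc : z ∈ closure Q := mem_closure_spaceTimeCylinder hT (hB hz.1) hz.2
    have h1 := hN z hz
    have h2 := hm z hzc
    rw [hgV hzc] at h2 ⊢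
    rw [Real.norm_eq_abs] at h1
    simp only [hU]
    rw [max_eq_right (by linarith), min_eq_right]
    linarith [le_abs_self (g z), le_abs_self N, neg_abs_le m]
  have hgm : LipschitzWith K (fun z => g z - m) := by
    refine LipschitzWith.of_dist_le_mul fun x y => ?_
    rw [dist_sub_right]; exact hg.dist_le_mul x y
  have hfd : ∀ z ∈ Q', fderiv ℝ V z = fderiv ℝ U z := fun z hz => by
    have : V =ᶠ[nhds z] fun y => U y + m := by
      filter_upwards [hQ'o.mem_nhds hz] with y hy
      rw [hUV y ⟨Metric.ball_subset_closedBall hy.1, Ioo_subset_Icc_self hy.2⟩]; ring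
    rw [this.fderiv_eq, fderiv_add_const]
  have hvol : volume Q' ≠ ⊤ := by
    rw [hQ', spaceTimeCylinder, Measure.volume_eq_prod, Measure.prod_prod]
    exact (ENNReal.mul_lt_top measure_ball_lt_top measure_Ioo_lt_top).ne
  refine ⟨M, U, ⟨ha.pos, hQ'o, hvol, fun i j => (ha.aemeasurable i j).mono_set hsub,
    ae_restrict_of_ae_restrict_of_subset hsub hM, ?_, hb, ?_, ?_, hU0, ?_⟩, hUV⟩
  · refine (ae_restrict_of_ae_restrict_of_subset hsub ha.elliptic).mono fun z hz ξ => ?_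
    have := (hz (WithLp.toLp 2 ξ)).1
    rwa [EuclideanSpace.real_norm_sq_eq] at this
  · rintro φ ⟨L, hL⟩ hc hs h0
    exact hdiv.integral_nonneg hQo.measurableSet hQ'o hsub hb hL hc hs h0
  · exact ⟨⟨K, (hgm.const_max 0).const_min _⟩, |N| + |m|, fun z => by
      rw [abs_of_nonneg (hU0 z)]; exact min_le_left _ _⟩
  · intro η hη hc hs h0
    have h1 := hsup η hη hc (hs.trans hsub) h0
    rw [setIntegral_eq_of_eq_zero_off hQo.measurableSet hsub fun z hz => ?_] at h1
    · refine h1.trans (le_of_eq (setIntegral_congr_fun hQ'o.measurableSet fun z hz => ?_))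
      simp only [timeDeriv, spaceDeriv, hfd z hz]
    · have e1 : η z = 0 := image_eq_zero_of_notMem_tsupport fun h => hz (hs h)
      have e2 : ∀ i, spaceDeriv i η z = 0 := spaceDeriv_eq_zero_of_notMem hs hz
      simp [e1, e2]

/-- If a bounded nonnegative supersolution vanishes at the centre of the upper base of a cylinder
then it vanishes in the cylinder. -/
theorem IsBddSupersolution.eq_zero_of_eq_zero {M : ℝ} {U : SpaceTime n → ℝ}
    (h : IsBddSupersolution a b ν M (spaceTimeCylinder (Metric.ball x₀ R) T) U) (hn : 2 ≤ n)
    (hR : 0 < R) (hT : 0 < T) {q l : ℝ} (hq : 1 < q)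
    (hl : 1 < l) (hql : n / q + 2 / l < 2) {w : SpaceTime n → ℝ≥0∞} (hwm : Measurable w)
    (hw : ∀ᵐ z ∂(volume.restrict (spaceTimeCylinder (Metric.ball x₀ R) T)), w z = 1 + ‖b z‖ₑ)
    (hwf : ∫⁻ t in Ioo 0 T, (∫⁻ x in Metric.closedBall x₀ R, w (x, t) ^ q) ^ (l / q) < ⊤)
    (h0 : U (x₀, T) = 0) :
    ∀ x ∈ Metric.ball x₀ R, ∀ t ∈ Icc 0 T, U (x, t) = 0 := by
  have hUc := h.isBddLipschitz.continuous
  -- If no slice between t₁ and t₀ were full, the dichotomy would make almost all of them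
  -- negligible. Then U ≠ 0 almost everywhere just below t₀, which the De Giorgi iteration forbids
  -- when U(x₀, t₀) = 0.
  have hZ : ∀ t₀ ∈ Ioc 0 T, U (x₀, t₀) = 0 → ∀ t₁ ∈ Ioo 0 t₀,
      ∃ t ∈ Ioo t₁ t₀, ∀ x ∈ Metric.ball x₀ R, U (x, t) = 0 := by
    intro t₀ ht₀ hU0 t₁ ht₁
    by_contra! hcon
    refine h.ne_zero_of_ae_ne_zero hn hR hq hl hql hwm hw hwf ht₁.1 ht₁.2 ht₀.2 ?_ hU0
    have hZm : MeasurableSet {z | U z = 0} := (isClosed_eq hUc continuous_const).measurableSet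
    have hint : ∫⁻ z in Metric.closedBall x₀ (R / 2) ×ˢ Ioo t₁ t₀,
        {z | U z = 0}.indicator 1 z = 0 := by
      rw [setLIntegral_spaceTime _ _ (measurable_one.indicator hZm).aemeasurable]
      refine (setLIntegral_congr_fun_ae (g := 0) measurableSet_Ioo ?_).trans lintegral_zero
      filter_upwards [h.ae_slice_zeroSet (by omega)] with t ht htm
      rcases ht ⟨ht₁.1.trans htm.1, htm.2.trans_le ht₀.2⟩ with h1 | h1
      · refine (setLIntegral_congr_fun_ae (g := 0) measurableSet_closedBall
          (h1.mono fun x hx hxm => ?_)).trans lintegral_zero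
        have hx' : (x, t) ∉ {z | U z = 0} :=
          hx (Metric.closedBall_subset_ball (by linarith) hxm)
        exact indicator_of_notMem hx' _
      · obtain ⟨x, hx, hne⟩ := hcon t htm
        exact absurd (h1 x hx) hne
    rw [lintegral_indicator_one hZm] at hint
    rw [ae_iff]
    simpa using hint
  have hmain : ∀ x ∈ Metric.ball x₀ R, Ioo 0 T ⊆ {t | U (x, t) = 0} := by
    intro x hx t ht
    -- The times in [t, T] with a full zero slice form a closed set. At its infimum U vanishes at
    -- x₀, so an infimum above t would yield a still earlier full slice.
    set S : Set ℝ := Icc t T ∩ {σ | ∀ y ∈ Metric.ball x₀ R, U (y, σ) = 0} with hS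
    have hSc : IsClosed S := by
      refine isClosed_Icc.inter ?_
      simp only [ofPred_forall]
      exact isClosed_biInter fun y _ => isClosed_eq (by fun_prop) continuous_const
    have hSne : S.Nonempty := by
      obtain ⟨σ, hσ, hσ'⟩ := hZ T ⟨hT, le_rfl⟩ h0 t ht
      exact ⟨σ, Ioo_subset_Icc_self hσ, hσ'⟩
    have hSb : BddBelow S := ⟨t, fun σ hσ => hσ.1.1⟩
    have hmem := hSc.csInf_mem hSne hSb
    rcases hmem.1.1.eq_or_lt with heq | hlt
    · have := hmem.2 x hx
      rwa [← heq] at this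
    · obtain ⟨σ, hσ, hσ'⟩ := hZ (sInf S) ⟨ht.1.trans hlt, hmem.1.2⟩
        (hmem.2 x₀ (Metric.mem_ball_self hR)) t ⟨ht.1, hlt⟩
      have : sInf S ≤ σ := csInf_le hSb ⟨⟨hσ.1.le, hσ.2.le.trans hmem.1.2⟩, hσ'⟩
      exact absurd hσ.2 (not_lt.2 this)
  intro x hx t ht
  rw [← closure_Ioo hT.ne] at ht
  exact closure_minimal (hmain x hx) (isClosed_eq (by fun_prop) continuous_const) ht

/-- Local propagation of a minimum. -/
theorem IsLipschitzSupersolution.eq_of_eq (hn : 2 ≤ n) (hΩ : IsOpen Ω) (hT : 0 < T)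
    (ha : IsUniformlyElliptic a ν (spaceTimeCylinder Ω T)) {q ℓ : ℝ≥0∞}
    (hqℓ : (n : ℝ≥0∞) / q + 2 / ℓ < 2) (hb : MemMixedLp b q ℓ Ω T)
    (hdiv : DivNonpos b (spaceTimeCylinder Ω T))
    (hV : IsLipschitzSupersolution a b (spaceTimeCylinder Ω T) V)
    (hm : ∀ z ∈ closure (spaceTimeCylinder Ω T), m ≤ V z) (hR : 0 < R)
    (hB : Metric.closedBall x₀ R ⊆ Ω) (h0 : V (x₀, T) = m) :
    ∀ x ∈ Metric.ball x₀ R, ∀ t ∈ Icc 0 T, V (x, t) = m := by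
  obtain ⟨q', l', hq', hl', hql', w, hwm, hw, hwf⟩ :=
    exists_drift_weight hn hΩ.measurableSet hqℓ hb hB
  have hsub : spaceTimeCylinder (Metric.ball x₀ R) T ⊆ Metric.closedBall x₀ R ×ˢ Ioo 0 T :=
    prod_mono Metric.ball_subset_closedBall subset_rfl
  have hw' := ae_restrict_of_ae_restrict_of_subset hsub hw
  have hbi : IntegrableOn b (spaceTimeCylinder (Metric.ball x₀ R) T) := by
    refine ⟨hb.1.mono_set (spaceTimeCylinder_mono
      (Metric.ball_subset_closedBall.trans hB) T), ?_⟩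
    calc ∫⁻ z in spaceTimeCylinder (Metric.ball x₀ R) T, ‖b z‖ₑ
        ≤ ∫⁻ z in spaceTimeCylinder (Metric.ball x₀ R) T, w z :=
          lintegral_mono_ae (hw'.mono fun z hz => by rw [hz]; exact le_add_self)
      _ ≤ ∫⁻ z in Metric.closedBall x₀ R ×ˢ Ioo 0 T, w z := lintegral_mono_set hsub
      _ < ⊤ := setLIntegral_weight_lt_top hq' hl' hwm hwf
  obtain ⟨M, U, hU, hUV⟩ := exists_isBddSupersolution hΩ hT ha hdiv hV hm hB hbi
  have hU0 : U (x₀, T) = 0 := by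
    rw [hUV (x₀, T) ⟨Metric.mem_closedBall_self hR.le, hT.le, le_rfl⟩, h0, sub_self]
  intro x hx t ht
  have h1 := hU.eq_zero_of_eq_zero hn hR hT hq' hl' hql' hwm hw' hwf hU0 x hx t ht
  rw [hUV (x, t) ⟨Metric.ball_subset_closedBall hx, ht⟩] at h1
  linarith

end Localization

theorem corollary3p5 {n : ℕ} (hn : 2 ≤ n)
    (Ω : Set (EuclideanSpace ℝ (Fin n))) (hΩ_open : IsOpen Ω) (hΩ_conn : IsConnected Ω)
    (T : ℝ) (hT : 0 < T)
    (a : SpaceTime n → Matrix (Fin n) (Fin n) ℝ) (ν : ℝ)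
    (ha : IsUniformlyElliptic a ν (spaceTimeCylinder Ω T))
    (b : SpaceTime n → EuclideanSpace ℝ (Fin n)) (q ℓ : ℝ≥0∞)
    (hqℓ : (n : ℝ≥0∞) / q + 2 / ℓ ∈ Set.Ico (1 : ℝ≥0∞) 2)
    (hb : MemMixedLp b q ℓ Ω T)
    (hdiv : DivNonpos b (spaceTimeCylinder Ω T))
    (V : SpaceTime n → ℝ)
    (hV : IsLipschitzSupersolution a b (spaceTimeCylinder Ω T) V)
    (hV_nonconst : ¬ ∃ c : ℝ, ∀ z ∈ spaceTimeCylinder Ω T, V z = c) :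
    ∀ z ∈ frontier (spaceTimeCylinder Ω T) \ closure (parabolicBoundary Ω T),
      ¬ IsMinOn V (closure (spaceTimeCylinder Ω T)) z := by
  intro z hz hmin
  obtain ⟨hz1, hz2⟩ := mem_upper_base hΩ_open hT hz
  set m := V z with hm
  have hmV : ∀ y ∈ closure (spaceTimeCylinder Ω T), m ≤ V y := fun y hy => hmin hy
  have hloc : ∀ x₀ ∈ Ω, V (x₀, T) = m → ∃ R > 0, Metric.ball x₀ R ⊆ Ω ∧
      ∀ x ∈ Metric.ball x₀ R, ∀ t ∈ Icc 0 T, V (x, t) = m := fun x₀ hx₀ h0 => by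
    obtain ⟨R, hR, hB⟩ := Metric.nhds_basis_closedBall.mem_iff.1 (hΩ_open.mem_nhds hx₀)
    exact ⟨R, hR, Metric.ball_subset_closedBall.trans hB,
      hV.eq_of_eq hn hΩ_open hT ha hqℓ.2 hb hdiv hmV hR hB h0⟩
  obtain ⟨K, hK⟩ := hV.1
  obtain ⟨g, hg, hgV⟩ := hK.extend_real
  have hTm : ∀ x ∈ Ω, ((x, T) : SpaceTime n) ∈ closure (spaceTimeCylinder Ω T) := fun x hx =>
    mem_closure_spaceTimeCylinder hT hx ⟨hT.le, le_rfl⟩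
  -- Openness comes from local propagation, relative closedness from continuity. The values of V off
  -- the closure of Q are arbitrary, so closedness is taken from the extension g.
  have hall : Ω ⊆ {x | x ∈ Ω ∧ V (x, T) = m} := by
    refine hΩ_conn.isPreconnected.subset_of_closure_inter_subset ?_ ?_ ?_
    · refine Metric.isOpen_iff.2 fun x hx => ?_
      obtain ⟨R, hR, hB, hV0⟩ := hloc x hx.1 hx.2
      exact ⟨R, hR, fun y hy => ⟨hB hy, hV0 y hy T ⟨hT.le, le_rfl⟩⟩⟩
    · refine ⟨z.1, hz1, hz1, ?_⟩
      rw [hm, ← hz2]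
    · rintro x ⟨hx, hxΩ⟩
      refine ⟨hxΩ, ?_⟩
      have hcl : IsClosed {x | g (x, T) = m} :=
        isClosed_eq (hg.continuous.comp (by fun_prop)) continuous_const
      have : x ∈ {x | g (x, T) = m} := closure_minimal
        (fun y hy => by
          have := hgV (hTm y hy.1)
          rw [mem_ofPred_eq, ← this]; exact hy.2) hcl hx
      rw [hgV (hTm x hxΩ)]; exact this
  refine hV_nonconst ⟨m, fun y hy => ?_⟩
  obtain ⟨R, hR, -, hV0⟩ := hloc y.1 hy.1 (hall hy.1).2
  exact hV0 y.1 (Metric.mem_ball_self hR) y.2 (Ioo_subset_Icc_self hy.2)
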